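/- Let $d\ge 1$ and let $\Omega\subset\mathbb R^d$ be a bounded polygonal (polyhedral) domain. Let $\alpha$ be a measurable, symmetric, bounded and uniformly positive definite matrix field on $\Omega$, $c=\alpha^{-1}$, and $f\in L^2(\Omega)$. *Meshes.* $\mathcal T_h$ is a conforming simplicial triangulation of $\overline\Omega$ that is shape regular with constant $\gamma>0$: each $K\in\mathcal T_h$ contains a ball of radius $\gamma h_K$, $h_K=\operatorname{diam}K$. $\mathcal E_h$ is the set of all facets, $\mathcal E_h^i$ the set of interior ones, $h_e=\operatorname{diam}e$ (for $d=1$: the length of the longest interval ending in $e$), and $\boldsymbol n_K$ is the outward unit normal of $K$. On an interior facet $\{v\}=\frac12(v^++v^-)$ and $[\![v]\!]=v^+\boldsymbol n^++v^-\boldsymbol n^-$; on a boundary facet $[\![v]\!]=v\boldsymbol n$. Write $(\cdot,\cdot)_{\mathcal T_h}=\sum_K(\cdot,\cdot)_{L^2(K)}$, $\langle\cdot,\cdot\rangle_{\partial\mathcal T_h}=\sum_K\langle\cdot,\cdot\rangle_{L^2(\partial K)}$, and $\nabla_h$, $\operatorname{div}_h$ for the piecewise gradient and divergence. *Spaces.*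 $V_h$ and $\boldsymbol Q_h$ are linear spaces of scalar and vector-valued piecewise polynomials on $\mathcal T_h$ of degree at most $k$; for each facet $e$, $\hat V(e)\subset L^2(e)$ is a finite-dimensional space; $\hat V_h=\{\hat v:\hat v|_e\in\hat V(e)\ \forall e\in\mathcal E_h^i,\ \hat v=0 \text{ on boundary facets}\}$, $\tilde V_h=V_h\times\hat V_h$, and $V_h^c=V_h\cap H^1_0(\Omega)$. Assume 1. $\nabla_hV_h\subset\boldsymbol Q_h$; 2. $\{v\}|_e\in\hat V(e)$ for all $v\in V_h$, $e\in\mathcal E_h^i$; 3. for all $u_h\in V_h$, $$\inf_{u_h^I\in V_h^c}\bigl(\|u_h^I-u_h\|+\|\nabla_h(u_h^I-u_h)\|\bigr)\le C_p^I\Bigl(\sum_{e\in\mathcal E_h}h_e^{-1}\|[\![u_h]\!]\|_{0,e}^2\Bigr)^{1/2}.$$ *Methods.* For $\rho>0$, the HDG method with $\tau=\rho^{-1}h_K^{-1}$ is: find $(\boldsymbol p_h^\tau,u_h^\tau,\hat u_h^\tau)\in\boldsymbol Q_h\times V_h\times\hat V_h$ such that for all $(\boldsymbol q,v,\hat v)\in\boldsymbol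 Q_h\times V_h\times\hat V_h$ $$(c\boldsymbol p_h^\tau,\boldsymbol q)_{\mathcal T_h}-(u_h^\tau,\operatorname{div}_h\boldsymbol q)_{\mathcal T_h}+\langle\hat u_h^\tau,\boldsymbol q\cdot\boldsymbol n_K\rangle_{\partial\mathcal T_h}=0,$$ $$-(v,\operatorname{div}_h\boldsymbol p_h^\tau)_{\mathcal T_h}+\langle\hat v,\boldsymbol p_h^\tau\cdot\boldsymbol n_K\rangle_{\partial\mathcal T_h}-\rho^{-1}\langle h_K^{-1}(u_h^\tau-\hat u_h^\tau),v-\hat v\rangle_{\partial\mathcal T_h}=-(f,v)_{\mathcal T_h}.$$ The primal conforming method is: find $(\boldsymbol p_h^c,u_h^c)\in\boldsymbol Q_h\times V_h^c$ such that $$(c\boldsymbol p_h^c,\boldsymbol q)_{\mathcal T_h}+(\nabla u_h^c,\boldsymbol q)_{\mathcal T_h}=0\quad\forall\boldsymbol q\in\boldsymbol Q_h,\qquad -(\boldsymbol p_h^c,\nabla v^c)_{\mathcal T_h}=(f,v^c)_{\mathcal T_h}\quad\forall v^c\in V_h^c.$$ *Norms.* In the estimate below the flux norm is $\|\boldsymbol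 q\|^2=(c\boldsymbol q,\boldsymbol q)_{\mathcal T_h}$ (in assumption 3, $\|\cdot\|$ is the $L^2(\Omega)$ norm); $\|v\|_{1,h}^2=\|v\|_{L^2}^2+\|\nabla_hv\|_{L^2}^2$; $\|\tilde v\|_{\tilde1,\rho,h}^2=\|\nabla_hv\|_{L^2}^2+\rho^{-1}\sum_Kh_K^{-1}\|v-\hat v\|_{0,\partial K}^2$ for $\tilde v=(v,\hat v)$; and $\|f\|_{-\tilde1,\rho,h}=\sup_{0\ne\tilde v\in\tilde V_h}(f,v)_{\mathcal T_h}/\|\tilde v\|_{\tilde1,\rho,h}$ (zero if $\tilde V_h=0$). **Theorem.** Both methods have a unique solution (the HDG method for every $\rho>0$). For every $\rho_0>0$ there is a constant $C$, depending only on $\Omega,\alpha,\gamma,k,C_p^I,\rho_0$ (so independent of the mesh, the spaces, $f$ and $\rho$), such that for all $0<\rho\le\rho_0$ $$\|\boldsymbol p_h^\tau-\boldsymbol p_h^c\|+\|u_h^\tau-u_h^c\|_{1,h}\le C\rho^{1/2}\|f\|_{-\tilde1,\rho,h}.$$ In particular, on each fixed mesh, the left-hand side tends to $0$ as $\rho\to0$.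 -/

import Mathlib

open MeasureTheory Filter Topology
open scoped ContDiff Matrix

noncomputable section

namespace HDG

/-- The Euclidean space `ℝ^d`. -/
abbrev E (d : ℕ) := EuclideanSpace ℝ (Fin d)

/-- Polynomials in the `d` coordinates of `ℝ^d`. -/
abbrev Poly (d : ℕ) := MvPolynomial (Fin d) ℝ

/-- The polynomial function of a polynomial. -/
def ev {d : ℕ} (p : Poly d) (x : E d) : ℝ := MvPolynomial.eval (fun i => x i) p

/-- The vector field of a tuple of polynomials. -/
def evVec {d : ℕ} (q : Fin d → Poly d) (x : E d) : Fin d → ℝ := fun i => ev (q i) x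

/-- `H¹₀(Ω)`, the closure of `C_c^∞(Ω)` in `H¹(Ω)`; `g` is the weak gradient of `u`. -/
def MemH10 {d : ℕ} (Ω : Set (E d)) (u : E d → ℝ) : Prop :=
  MemLp u 2 (volume.restrict Ω) ∧
  ∃ g : E d → E d, MemLp g 2 (volume.restrict Ω) ∧
  ∃ φ : ℕ → E d → ℝ,
    (∀ n, ContDiff ℝ ∞ (φ n) ∧ HasCompactSupport (φ n) ∧ tsupport (φ n) ⊆ Ω) ∧
    Tendsto (fun n => eLpNorm (fun x => φ n x - u x) 2 (volume.restrict Ω)) atTop (𝓝 0) ∧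
    Tendsto (fun n => eLpNorm (fun x => gradient (φ n) x - g x) 2 (volume.restrict Ω))
      atTop (𝓝 0)

/-- The diffusion matrix: measurable, symmetric, bounded and uniformly positive definite on `Ω`. -/
def IsDiffusion {d : ℕ} (Ω : Set (E d)) (α : E d → Matrix (Fin d) (Fin d) ℝ) : Prop :=
  (∀ i j, AEMeasurable (fun x => α x i j) (volume.restrict Ω)) ∧
  (∀ x ∈ Ω, (α x).IsSymm) ∧
  ∃ lo hi : ℝ, 0 < lo ∧ ∀ x ∈ Ω, ∀ ξ : Fin d → ℝ,
    lo * (ξ ⬝ᵥ ξ) ≤ ξ ⬝ᵥ (α x *ᵥ ξ) ∧ ξ ⬝ᵥ (α x *ᵥ ξ) ≤ hi * (ξ ⬝ᵥ ξ)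

/-- The closed simplex with the given vertices. -/
def hull {d : ℕ} (s : Finset (E d)) : Set (E d) := convexHull ℝ (s : Set (E d))

/-- The barycentre of a simplex. -/
def bary {d : ℕ} (s : Finset (E d)) : E d := (s.card : ℝ)⁻¹ • ∑ x ∈ s, x

/-- Surface measure on a `(d-1)`-dimensional simplex. -/
def facetMeasure {d : ℕ} (e : Finset (E d)) : Measure (E d) := μHE[d - 1].restrict (hull e)

/-- The unit normal to the facet `e` of `K` that points out of `K`: the normalized component,
orthogonal to `e`, of the vector from the barycentre of `K` to the barycentre of `e`. -/
def normal {d : ℕ} (K e : Finset (E d)) : E d :=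
  let w : E d := (vectorSpan ℝ (e : Set (E d)))ᗮ.starProjection (bary e - bary K)
  ‖w‖⁻¹ • w

/-- A conforming triangulation of the closure of `Ω`; a cell is given by its `d + 1` vertices. -/
structure Triangulation {d : ℕ} (Ω : Set (E d)) where
  cells : Finset (Finset (E d))
  card_eq : ∀ K ∈ cells, K.card = d + 1
  indep : ∀ K ∈ cells, AffineIndependent ℝ (fun x : K => (x : E d))
  inter : ∀ K ∈ cells, ∀ L ∈ cells,
    hull K ∩ hull L ⊆ convexHull ℝ ((K : Set (E d)) ∩ (L : Set (E d)))
  cover : ⋃ K ∈ cells, hull K = closure Ω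

namespace Triangulation

variable {d : ℕ} {Ω : Set (E d)} (T : Triangulation Ω)

open Classical in
/-- All facets (edges, faces) of the cells, given by their `d` vertices. -/
def facets : Finset (Finset (E d)) := T.cells.biUnion fun K => K.powersetCard d

/-- Interior facets are those shared by two cells; the others are the boundary facets. -/
def IsInterior (e : T.facets) : Prop :=
  ∃ K L : T.cells, K ≠ L ∧ e.1 ⊆ K.1 ∧ e.1 ⊆ L.1

/-- `h_K`. -/
def hCell (K : T.cells) : ℝ := Metric.diam (hull K.1)

open Classical in
/-- `h_e`: the diameter of `e`. In dimension one, where `e` is a point, it is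
the length of the longest interval that ends in `e`. -/
def hFacet (e : T.facets) : ℝ :=
  if d = 1 then ⨆ K : {K : T.cells // e.1 ⊆ K.1}, T.hCell K.1 else Metric.diam (hull e.1)

/-- Shape regularity (minimal angle condition) with constant `γ`:
every cell contains a ball of radius `γ h_K`. -/
def ShapeRegular (γ : ℝ) : Prop :=
  ∀ K : T.cells, ∃ x : E d, Metric.closedBall x (γ * T.hCell K) ⊆ hull K.1

/-- Piecewise polynomial scalar functions. -/
abbrev Scal := T.cells → Poly d

/-- Piecewise polynomial vector fields. -/
abbrev Vect := T.cells → Fin d → Poly d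

/-- Single-valued square integrable functions on the skeleton. -/
abbrev Skel := ∀ e : T.facets, Lp ℝ 2 (facetMeasure e.1)

variable {T}

open Classical in
/-- A piecewise polynomial as a function on `ℝ^d`, zero outside the cells; on the common
boundaries of cells, a null set, the values of the cells add up. -/
def toFun (v : T.Scal) (x : E d) : ℝ := ∑ K : T.cells, (hull K.1).indicator (ev (v K)) x

/-- The piecewise gradient `∇_h`. -/
def gradh (v : T.Scal) : T.Vect := fun K i => MvPolynomial.pderiv i (v K)

/-- The piecewise divergence. -/
def divh (q : T.Vect) : T.Scal := fun K => ∑ i, MvPolynomial.pderiv i (q K i)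

/-- `(v, w)_{T_h}` for scalar functions. -/
def inS (v w : T.Scal) : ℝ := ∑ K : T.cells, ∫ x in hull K.1, ev (v K) x * ev (w K) x

/-- `(q, r)_{T_h}` for vector fields. -/
def inV (q r : T.Vect) : ℝ := ∑ K : T.cells, ∫ x in hull K.1, evVec (q K) x ⬝ᵥ evVec (r K) x

/-- `(f, v)_{T_h}`. -/
def load (f : E d → ℝ) (v : T.Scal) : ℝ := ∑ K : T.cells, ∫ x in hull K.1, f x * ev (v K) x

/-- `a_h(p, q) = (c p, q)_{T_h}` with `c = α⁻¹`. -/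
def aForm (α : E d → Matrix (Fin d) (Fin d) ℝ) (p q : T.Vect) : ℝ :=
  ∑ K : T.cells, ∫ x in hull K.1, ((α x)⁻¹ *ᵥ evVec (p K) x) ⬝ᵥ evVec (q K) x

open Classical in
/-- `b_h(q, (u, û)) = -(u, div q)_{T_h} + ⟨û, q · n⟩_{∂T_h}`. -/
def bForm (q : T.Vect) (u : T.Scal) (uh : T.Skel) : ℝ :=
  - inS u (divh q) +
    ∑ K : T.cells, ∑ e : T.facets with e.1 ⊆ K.1,
      ∫ x, uh e x * (evVec (q K) x ⬝ᵥ (fun i => normal K.1 e.1 i)) ∂(facetMeasure e.1)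

open Classical in
/-- `∑_K τ_K ⟨u - û, v - v̂⟩_{∂K}`. -/
def stab (τ : T.cells → ℝ) (u : T.Scal) (uh : T.Skel) (v : T.Scal) (vh : T.Skel) : ℝ :=
  ∑ K : T.cells, τ K * ∑ e : T.facets with e.1 ⊆ K.1,
    ∫ x, (ev (u K) x - uh e x) * (ev (v K) x - vh e x) ∂(facetMeasure e.1)

/-- `c_h((u, û), (v, v̂)) = -τ ⟨u - û, v - v̂⟩_{∂T_h}`. -/
def cForm (τ : T.cells → ℝ) (u : T.Scal) (uh : T.Skel) (v : T.Scal) (vh : T.Skel) : ℝ :=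
  - stab τ u uh v vh

/-- The stabilization parameter `τ = ρ⁻¹ h_K⁻¹`. -/
def tau (T : Triangulation Ω) (ρ : ℝ) : T.cells → ℝ := fun K => ρ⁻¹ * (T.hCell K)⁻¹

open Classical in
/-- The jump `⟦v⟧`: `v⁺ n⁺ + v⁻ n⁻` on interior facets and `v n` on boundary facets. -/
def jump (v : T.Scal) (e : T.facets) (x : E d) : E d :=
  ∑ K : T.cells with e.1 ⊆ K.1, ev (v K) x • normal K.1 e.1

/-- `(∑_e h_e⁻¹ ‖⟦v⟧‖²_{0,e})^{1/2}`. -/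
def jumpNorm (v : T.Scal) : ℝ :=
  √(∑ e : T.facets, (T.hFacet e)⁻¹ * ∫ x, ‖jump v e x‖ ^ 2 ∂(facetMeasure e.1))

/-- `‖v‖` in `L²`. -/
def normS (v : T.Scal) : ℝ := √(inS v v)

/-- `‖q‖` in `L²`. -/
def normV (q : T.Vect) : ℝ := √(inV q q)

/-- The norm `(c q, q)_{T_h}^{1/2}` of fluxes. -/
def normC (α : E d → Matrix (Fin d) (Fin d) ℝ) (q : T.Vect) : ℝ := √(aForm α q q)

/-- The broken `H¹` norm `‖v‖_{1,h}`. -/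
def norm1h (v : T.Scal) : ℝ := √(inS v v + inV (gradh v) (gradh v))

/-- The norm of `(v, v̂)` with square
`‖∇_h v‖² + ρ⁻¹ ∑_K h_K⁻¹ ⟨v - v̂, v - v̂⟩_{∂K}`. -/
def normTilde (ρ : ℝ) (v : T.Scal) (vh : T.Skel) : ℝ :=
  √(inV (gradh v) (gradh v) + stab (tau T ρ) v vh v vh)

/-- Finite element spaces: piecewise polynomials of degree at most `k` for the potential and the
flux, and a finite-dimensional space `V̂(e) ⊆ L²(e)` on each facet. -/
structure Spaces (T : Triangulation Ω) (k : ℕ) where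
  Q : Submodule ℝ T.Vect
  V : Submodule ℝ T.Scal
  Vhat : ∀ e : T.facets, Submodule ℝ (Lp ℝ 2 (facetMeasure e.1))
  degQ : ∀ q ∈ Q, ∀ K i, (q K i).totalDegree ≤ k
  degV : ∀ v ∈ V, ∀ K, (v K).totalDegree ≤ k
  finVhat : ∀ e, FiniteDimensional ℝ (Vhat e)

namespace Spaces

variable {k : ℕ} (S : T.Spaces k)

/-- `V̂_h`: in `V̂(e)` on interior facets and zero on boundary facets. -/
def MemVhat (vh : T.Skel) : Prop :=
  ∀ e, (T.IsInterior e → vh e ∈ S.Vhat e) ∧ (¬ T.IsInterior e → vh e = 0)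

/-- `V_h^c = V_h ∩ H¹₀(Ω)`. -/
def Vc : Set T.Scal := {v | v ∈ S.V ∧ MemH10 Ω (toFun v)}

/-- The assumption on the spaces: `∇_h V_h ⊆ Q_h`, the averages of `V_h` on interior facets lie in
`V̂(e)`, and elements of `V_h` are approximated from `V_h^c` up to a multiple of their jumps. -/
def Compatible (CI : ℝ) : Prop :=
  (∀ v ∈ S.V, gradh v ∈ S.Q) ∧
  (∀ v ∈ S.V, ∀ e : T.facets, ∀ K L : T.cells, K ≠ L → e.1 ⊆ K.1 → e.1 ⊆ L.1 →
    ∃ w ∈ S.Vhat e, w =ᵐ[facetMeasure e.1] fun x => (ev (v K) x + ev (v L) x) / 2) ∧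
  (∀ u ∈ S.V, (⨅ w : S.Vc, (normS (w.1 - u) + normV (gradh (w.1 - u)))) ≤ CI * jumpNorm u)

/-- `(p, u, û)` solves the HDG equations with stabilization parameter `τ`. -/
def IsHDG (α : E d → Matrix (Fin d) (Fin d) ℝ) (τ : T.cells → ℝ) (f : E d → ℝ)
    (s : T.Vect × T.Scal × T.Skel) : Prop :=
  s.1 ∈ S.Q ∧ s.2.1 ∈ S.V ∧ S.MemVhat s.2.2 ∧
  (∀ q ∈ S.Q, aForm α s.1 q + bForm q s.2.1 s.2.2 = 0) ∧
  (∀ v ∈ S.V, ∀ vh, S.MemVhat vh →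
    bForm s.1 v vh + cForm τ s.2.1 s.2.2 v vh = - load f v)

/-- `(p, u)` solves the primal conforming equations. -/
def IsPrimal (α : E d → Matrix (Fin d) (Fin d) ℝ) (f : E d → ℝ) (s : T.Vect × T.Scal) : Prop :=
  s.1 ∈ S.Q ∧ s.2 ∈ S.Vc ∧
  (∀ q ∈ S.Q, aForm α s.1 q + inV (gradh s.2) q = 0) ∧
  (∀ v ∈ S.Vc, - inV s.1 (gradh v) = load f v)

/-- The dual norm of `f`: the supremum over `V_h × V̂_h` of `(f, v)_{T_h}` divided by the norm
`normTilde` of `(v, v̂)`. The zero element contributes `0 / 0 = 0`. -/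
def dualNorm (ρ : ℝ) (f : E d → ℝ) : ℝ :=
  sSup {r | ∃ v ∈ S.V, ∃ vh, S.MemVhat vh ∧ r = load f v / normTilde ρ v vh}

end Spaces

end Triangulation

end HDG

end

/-! Integration by parts on each cell turns b(q, (u, û)) into (∇_h u, q) − ⟨u − û, q·n⟩. Let D(u, û)
be u − û on the cell boundaries scaled by h_K^{-1/2}, and N q the normal trace scaled by h_K^{1/2}.
The boundary term is then (D, N q), the stabilization is ρ⁻¹‖D‖², and the discrete trace inequality
gives ‖N q‖ ≤ C‖q‖ on Q_h.

Two estimates carry the theorem. First, testing the HDG equations with their own solution gives (cp,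
p) + ρ⁻¹‖D‖² = (f, u). The first equation tested with ∇_h u bounds ∇_h u by the flux and D, so the
energy controls the norm of (u, û), and the dual norm of f yields ‖D‖ ≤ Cρ^{1/2}‖f‖ (`norm_D_le`).
Second, a conforming potential has a single-valued trace, which lies in V̂_h because averages do;
paired with that trace it has D = 0. Conforming test functions therefore do not see the
stabilization, and the flux error e is orthogonal to the gradients of V_h^c. When the difference of
the two first equations is tested with e, the potential error may thus be replaced by the distance
of u^τ to V_h^c, which assumption 3 bounds by the jumps and hence by D. The gradient error follows
from the first equation again, the L² error from a discrete Poincaré inequality, and the whole error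
is at most C‖D‖ (`error_le`).

Both methods are square finite-dimensional systems, so unique solvability reduces to the same tests
with f = 0.

All this needs only the facts collected in `DiscreteSetting`; the instance `setting` supplies them.
Behind it stand the divergence theorem on a simplex (`setIntegral_hull_derivative`), the trace
inequality (`exists_trace_inequality`), the opposite normals of neighbouring cells
(`normal_eq_neg`), the absence of jumps (`jump_ae_eq_zero`) and the Poincaré inequality on V_h^c
(`inS_self_le_of_memH10`). -/

namespace HDG

/-! ### Polynomial functions: calculus and identity principle -/

section Polynomials

variable {d : ℕ}

@[simp] lemma ev_zero (x : E d) : ev (0 : Poly d) x = 0 := by simp [ev]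
@[simp] lemma ev_add (p q : Poly d) (x : E d) : ev (p + q) x = ev p x + ev q x := by simp [ev]
@[simp] lemma ev_mul (p q : Poly d) (x : E d) : ev (p * q) x = ev p x * ev q x := by simp [ev]
@[simp] lemma ev_smul (c : ℝ) (p : Poly d) (x : E d) : ev (c • p) x = c * ev p x := by simp [ev]
@[simp] lemma ev_one (x : E d) : ev (1 : Poly d) x = 1 := by simp [ev]
@[simp] lemma ev_C (c : ℝ) (x : E d) : ev (MvPolynomial.C c : Poly d) x = c := by simp [ev]
@[simp] lemma ev_X (i : Fin d) (x : E d) : ev (MvPolynomial.X i : Poly d) x = x i := by simp [ev]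
@[simp] lemma ev_sum {ι : Type*} (s : Finset ι) (p : ι → Poly d) (x : E d) :
    ev (∑ i ∈ s, p i) x = ∑ i ∈ s, ev (p i) x := by simp [ev]

lemma evVec_add (p q : Fin d → Poly d) (x : E d) : evVec (p + q) x = evVec p x + evVec q x := by
  ext i; simp [evVec]
lemma evVec_smul (c : ℝ) (p : Fin d → Poly d) (x : E d) : evVec (c • p) x = c • evVec p x := by
  ext i; simp [evVec]

lemma contDiff_ev (p : Poly d) : ContDiff ℝ ∞ (ev p) := by
  induction p using MvPolynomial.induction_on with
  | C a => simpa [funext (ev_C (d := d) a)] using contDiff_const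
  | add p q hp hq => simpa [funext (ev_add p q)] using hp.add hq
  | mul_X p i hp =>
    have : ev (p * MvPolynomial.X i) = fun x => ev p x * x i := by ext x; simp
    rw [this]
    exact hp.mul (by fun_prop)

lemma continuous_ev (p : Poly d) : Continuous (ev p) := (contDiff_ev p).continuous

lemma hasFDerivAt_ev (p : Poly d) (x : E d) :
    HasFDerivAt (ev p)
      (∑ i, ev (MvPolynomial.pderiv i p) x • (EuclideanSpace.proj i : E d →L[ℝ] ℝ)) x := by
  induction p using MvPolynomial.induction_on with
  | C a => simpa [funext (ev_C (d := d) a)] using hasFDerivAt_const a x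
  | add p q hp hq =>
    have : ev (p + q) = fun x => ev p x + ev q x := by ext x; simp
    rw [this]
    refine (hp.add hq).congr_fderiv ?_
    simp [add_smul, Finset.sum_add_distrib]
  | mul_X p i hp =>
    have : ev (p * MvPolynomial.X i) = fun x => ev p x * x i := by ext x; simp
    rw [this]
    refine (hp.mul (EuclideanSpace.proj i : E d →L[ℝ] ℝ).hasFDerivAt).congr_fderiv ?_
    ext v
    simp only [Derivation.leibniz, MvPolynomial.pderiv_X, ev_add, smul_eq_mul, ev_mul, ev_X,
      add_smul, Finset.sum_add_distrib, PiLp.proj_apply, add_apply, _root_.smul_apply,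
      FunLike.coe_sum, Finset.sum_apply, Finset.mul_sum]
    congr 1
    · rw [Finset.sum_eq_single i]
      · simp
      · intro j _ hj; simp [Pi.single_eq_of_ne hj.symm]
      · simp
    · exact Finset.sum_congr rfl fun j _ => by ring

lemma fderiv_ev (p : Poly d) (x v : E d) :
    fderiv ℝ (ev p) x v = ∑ i, v i * ev (MvPolynomial.pderiv i p) x := by
  rw [(hasFDerivAt_ev p x).fderiv]
  simp [mul_comm]

/-- A polynomial that vanishes on a nonempty open set is zero. -/
lemma eq_zero_of_ev_eq_zero {p : Poly d} {U : Set (E d)} (hU : IsOpen U) (hne : U.Nonempty)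
    (h : ∀ x ∈ U, ev p x = 0) : p = 0 := by
  obtain ⟨x, hx⟩ := hne
  have hc : Continuous (fun y : Fin d → ℝ => (WithLp.toLp 2 y : E d)) := PiLp.continuous_toLp 2 _
  have hV : IsOpen ((fun y : Fin d → ℝ => (WithLp.toLp 2 y : E d)) ⁻¹' U) := hU.preimage hc
  -- The identity principle for several variables wants a product of infinite sets, hence a sup-norm
  -- ball instead of a Euclidean one.
  obtain ⟨ε, hε, hb⟩ := Metric.isOpen_iff.1 hV (fun i => x i) (by simpa using hx)
  refine MvPolynomial.funext_set (fun i => Metric.ball (x i) ε)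
    (fun i => ?_) fun y hy => ?_
  · rw [Real.ball_eq_Ioo]; exact Set.Ioo_infinite (by linarith)
  · have := h _ (hb (a := y) (by rw [ball_pi _ hε]; exact hy))
    simpa [ev] using this

/-- A polynomial that vanishes almost everywhere on a set with nonempty interior is zero. -/
lemma eq_zero_of_ae_ev_eq_zero {p : Poly d} {s : Set (E d)} (hs : (interior s).Nonempty)
    (h : ∀ᵐ x ∂volume.restrict s, ev p x = 0) : p = 0 := by
  refine eq_zero_of_ev_eq_zero isOpen_interior hs ?_
  have h1 : ev p =ᵐ[volume.restrict (interior s)] fun _ => (0 : ℝ) :=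
    ae_restrict_of_ae_restrict_of_subset interior_subset h
  exact Measure.eqOn_open_of_ae_eq h1 isOpen_interior (continuous_ev p).continuousOn
    continuousOn_const

end Polynomials

/-! ### A simplex as a cone over a facet -/

section Cone

variable {d : ℕ} {a z : E d} {e : Finset (E d)}

lemma isCompact_hull (s : Finset (E d)) : IsCompact (hull s) :=
  s.finite_toSet.isCompact_convexHull ℝ

lemma measurableSet_hull (s : Finset (E d)) : MeasurableSet (hull s) :=
  (isCompact_hull s).isClosed.measurableSet

lemma convex_hull (s : Finset (E d)) : Convex ℝ (hull s) := convex_convexHull ℝ _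

lemma hull_mono {s t : Finset (E d)} (h : s ⊆ t) : hull s ⊆ hull t :=
  convexHull_mono (by exact_mod_cast h)

/-- Hyperplanes are convex. In this section `a` is the apex and `z` the vector from `a` to its foot
on the plane of `e`; the hypothesis on `z` encodes exactly this. -/
lemma inner_sub_eq_of_mem_hull (hz : ∀ y ∈ e, inner ℝ z (y - a) = ‖z‖ ^ 2) {y : E d}
    (hy : y ∈ hull e) : inner ℝ z (y - a) = ‖z‖ ^ 2 := by
  have hc : Convex ℝ {y : E d | inner ℝ z (y - a) = ‖z‖ ^ 2} := by
    have : {y : E d | inner ℝ z (y - a) = ‖z‖ ^ 2} =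
        {y : E d | innerₛₗ ℝ z y = ‖z‖ ^ 2 + inner ℝ z a} := by
      ext y; simp [inner_sub_right, sub_eq_iff_eq_add]
    rw [this]
    exact convex_hyperplane (innerₛₗ ℝ z).isLinear _
  exact convexHull_min (fun y hy => hz y (by exact_mod_cast hy)) hc hy

open Classical in
lemma mem_hull_insert (he : e.Nonempty) {x : E d} :
    x ∈ hull (insert a e) ↔ ∃ t ∈ Set.Icc (0 : ℝ) 1, ∃ y ∈ hull e, x = a + t • (y - a) := by
  have : ((insert a e : Finset (E d)) : Set (E d)) = insert a (e : Set (E d)) := by simp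
  rw [hull, this, convexHull_insert (by exact_mod_cast he), mem_convexJoin]
  simp only [Set.mem_singleton_iff, exists_eq_left]
  constructor
  · rintro ⟨y, hy, hx⟩
    rw [segment_eq_image'] at hx
    obtain ⟨t, ht, rfl⟩ := hx
    exact ⟨t, ht, y, hy, rfl⟩
  · rintro ⟨t, ht, y, hy, rfl⟩
    refine ⟨y, hy, ?_⟩
    rw [segment_eq_image']
    exact ⟨t, ht, rfl⟩

open Classical in
/-- Integration over a simplex by slices parallel to a facet. -/
lemma volume_inter_hull_insert (he : e.Nonempty) (hz0 : z ≠ 0)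
    (hz : ∀ y ∈ e, inner ℝ z (y - a) = ‖z‖ ^ 2) {t : Set (E d)} (ht : MeasurableSet t) :
    volume (t ∩ hull (insert a e)) =
      ‖z‖ₑ * ∫⁻ x in Set.Ioc (0 : ℝ) 1, ENNReal.ofReal (x ^ (d - 1)) *
        facetMeasure e ((fun y => a + x • (y - a)) ⁻¹' t) := by
  have hzz : ‖z‖ ^ 2 ≠ 0 := by simpa using hz0
  -- Cavalieri's principle along the line spanned by `z`: the parameter `x` is the relative height
  -- above the apex.
  have h1 := EuclideanGeometry.euclideanHausdorffMeasure_eq_lintegral (V := E d) a hz0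
    (ht.inter (measurableSet_hull (insert a e)))
  rw [finrank_euclideanSpace_fin, EuclideanSpace.euclideanHausdorffMeasure_eq_volume] at h1
  rw [h1]
  congr 1
  rw [← lintegral_indicator measurableSet_Ioc]
  refine lintegral_congr_ae ?_
  -- The slice through the apex is discarded, because the scaling of measure under a homothety needs
  -- a nonzero ratio.
  filter_upwards [compl_mem_ae_iff.2 (measure_singleton (0 : ℝ))] with x hx
  have hx0 : x ≠ 0 := by simpa using hx
  have hmem : ∀ y : E d, y ∈ AffineSubspace.mk' (x • z +ᵥ a) (ℝ ∙ z)ᗮ ↔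
      inner ℝ z (y - a) = x * ‖z‖ ^ 2 := by
    intro y
    rw [AffineSubspace.mem_mk', Submodule.mem_orthogonal_singleton_iff_inner_right]
    simp only [vsub_eq_sub, vadd_eq_add, inner_sub_right, inner_add_right, inner_smul_right,
      real_inner_self_eq_norm_sq]
    constructor <;> intro h <;> linarith
  by_cases hxI : x ∈ Set.Ioc (0 : ℝ) 1
  · rw [Set.indicator_of_mem hxI]
    -- The slice at relative height `x` is the facet shrunk towards the apex by the factor `x`; this
    -- produces the weight `x ^ (d - 1)`.
    have hset : t ∩ hull (insert a e) ∩ (AffineSubspace.mk' (x • z +ᵥ a) (ℝ ∙ z)ᗮ : Set (E d)) =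
        AffineMap.homothety a x '' (((fun y => a + x • (y - a)) ⁻¹' t) ∩ hull e) := by
      ext y
      simp only [Set.mem_inter_iff, Set.mem_image, Set.mem_preimage, AffineMap.homothety_apply,
        vsub_eq_sub, vadd_eq_add, SetLike.mem_coe, mem_hull_insert he]
      constructor
      · rintro ⟨⟨hyt, s, hs, w, hw, rfl⟩, h⟩
        have : s = x := by
          replace h := (hmem _).1 h
          rw [add_sub_cancel_left, inner_smul_right, inner_sub_eq_of_mem_hull hz hw] at h
          exact mul_right_cancel₀ hzz h
        subst this
        exact ⟨w, ⟨hyt, hw⟩, by rw [add_comm]⟩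
      · rintro ⟨w, ⟨hyt, hw⟩, rfl⟩
        rw [add_comm]
        refine ⟨⟨hyt, x, ⟨hxI.1.le, hxI.2⟩, w, hw, rfl⟩, (hmem _).2 ?_⟩
        rw [add_sub_cancel_left, inner_smul_right, inner_sub_eq_of_mem_hull hz hw]
    have hm : MeasurableSet ((fun y : E d => a + x • (y - a)) ⁻¹' t) :=
      ht.preimage (by fun_prop)
    rw [hset, euclideanHausdorffMeasure_homothety_image _ _ hx0, facetMeasure,
      Measure.restrict_apply hm, ENNReal.smul_def, smul_eq_mul]
    congr 1
    rw [ENNReal.coe_pow, ENNReal.ofReal_pow hxI.1.le]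
    congr 1
    rw [← enorm_eq_nnnorm, ← ofReal_norm, Real.norm_of_nonneg hxI.1.le]
  · rw [Set.indicator_of_notMem hxI]
    have : t ∩ hull (insert a e) ∩ (AffineSubspace.mk' (x • z +ᵥ a) (ℝ ∙ z)ᗮ : Set (E d)) = ∅ := by
      rw [Set.eq_empty_iff_forall_notMem]
      rintro y ⟨⟨_, hy⟩, h⟩
      rw [SetLike.mem_coe, hmem] at h
      obtain ⟨s, hs, w, hw, rfl⟩ := (mem_hull_insert he).1 hy
      rw [add_sub_cancel_left, inner_smul_right, inner_sub_eq_of_mem_hull hz hw] at h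
      have : s = x := mul_right_cancel₀ hzz h
      subst this
      exact hxI ⟨lt_of_le_of_ne hs.1 (Ne.symm hx0), hs.2⟩
    rw [this, measure_empty]

open Classical in
-- Slicing the whole simplex writes its finite volume as a positive constant times the area of the
-- facet.
lemma isFiniteMeasure_facetMeasure (he : e.Nonempty) (hz0 : z ≠ 0)
    (hz : ∀ y ∈ e, inner ℝ z (y - a) = ‖z‖ ^ 2) : IsFiniteMeasure (facetMeasure e) := by
  refine ⟨?_⟩
  have h := volume_inter_hull_insert he hz0 hz MeasurableSet.univ
  simp only [Set.univ_inter, Set.preimage_univ] at h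
  rw [lintegral_mul_const _ (by fun_prop)] at h
  have hfin : volume (hull (insert a e)) ≠ ⊤ := (isCompact_hull _).measure_lt_top.ne
  by_contra hcon
  have htop : facetMeasure e Set.univ = ⊤ := not_lt_top_iff.1 hcon
  have hI : ∫⁻ x in Set.Ioc (0 : ℝ) 1, ENNReal.ofReal (x ^ (d - 1)) ≠ 0 := by
    intro h0
    rw [lintegral_eq_zero_iff (by fun_prop)] at h0
    have h2 : ∀ᵐ x ∂volume.restrict (Set.Ioc (0 : ℝ) 1), False := by
      filter_upwards [h0, ae_restrict_mem measurableSet_Ioc] with x hx hx'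
      have : 0 < x ^ (d - 1) := pow_pos hx'.1 _
      simp only [Pi.zero_apply, ENNReal.ofReal_eq_zero] at hx
      linarith
    rw [ae_iff] at h2
    simp at h2
  rw [htop, ENNReal.mul_top hI, ENNReal.mul_top (by simpa using hz0)] at h
  exact hfin h

open Classical in
-- The slicing formula read as a change of variables to cone coordinates, so that Fubini applies to
-- integrals of functions.
lemma restrict_hull_insert_eq_map (he : e.Nonempty) (hz0 : z ≠ 0)
    (hz : ∀ y ∈ e, inner ℝ z (y - a) = ‖z‖ ^ 2) :
    volume.restrict (hull (insert a e)) = ‖z‖ₑ • Measure.map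
      (fun p : E d × ℝ => a + p.2 • (p.1 - a))
      ((facetMeasure e).prod ((volume.restrict (Set.Ioc (0 : ℝ) 1)).withDensity
        fun x => ENNReal.ofReal (x ^ (d - 1)))) := by
  have := isFiniteMeasure_facetMeasure he hz0 hz
  ext t ht
  rw [Measure.restrict_apply ht, volume_inter_hull_insert he hz0 hz ht, Measure.smul_apply,
    Measure.map_apply (by fun_prop) ht,
    Measure.prod_apply_symm (ht.preimage (by fun_prop)),
    lintegral_withDensity_eq_lintegral_mul _ (by fun_prop)
      (measurable_measure_prodMk_right (ht.preimage (by fun_prop)))]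
  rfl

open Classical in
lemma setIntegral_hull_insert (he : e.Nonempty) (hz0 : z ≠ 0)
    (hz : ∀ y ∈ e, inner ℝ z (y - a) = ‖z‖ ^ 2) {F : E d → ℝ} (hF : Continuous F) :
    ∫ x in hull (insert a e), F x = ‖z‖ * ∫ y, (∫ t in (0 : ℝ)..1,
      t ^ (d - 1) * F (a + t • (y - a))) ∂(facetMeasure e) := by
  have := isFiniteMeasure_facetMeasure he hz0 hz
  have hd : Measurable fun x : ℝ => (x ^ (d - 1)).toNNReal := by fun_prop
  have hm : Measurable (fun p : E d × ℝ => a + p.2 • (p.1 - a)) := by fun_prop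
  set ν := (volume.restrict (Set.Ioc (0 : ℝ) 1)).withDensity
        fun x => ENNReal.ofReal (x ^ (d - 1)) with hν
  have hcomp : AEStronglyMeasurable (fun p : E d × ℝ => F (a + p.2 • (p.1 - a)))
      ((facetMeasure e).prod ν) := Continuous.aestronglyMeasurable (by fun_prop)
  have hFint : Integrable F (volume.restrict (hull (insert a e))) :=
    hF.continuousOn.integrableOn_compact (isCompact_hull _)
  have hFmap : Integrable (fun p : E d × ℝ => F (a + p.2 • (p.1 - a)))
      ((facetMeasure e).prod ν) := by
    rw [restrict_hull_insert_eq_map he hz0 hz, integrable_smul_measure (by simpa using hz0)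
      (by simp)] at hFint
    exact (integrable_map_measure hF.aestronglyMeasurable hm.aemeasurable).1 hFint
  rw [restrict_hull_insert_eq_map he hz0 hz, integral_smul_measure, ← hν,
    integral_map hm.aemeasurable hF.aestronglyMeasurable, integral_prod _ hFmap]
  simp only [toReal_enorm, smul_eq_mul]
  congr 2
  ext y
  rw [intervalIntegral.integral_of_le zero_le_one, hν]
  have h3 : (fun x : ℝ => ENNReal.ofReal (x ^ (d - 1))) =
      fun x => (((x ^ (d - 1)).toNNReal : NNReal) : ENNReal) := rfl
  rw [h3, integral_withDensity_eq_integral_smul hd]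
  refine setIntegral_congr_fun measurableSet_Ioc fun x hx => ?_
  simp only [NNReal.smul_def, smul_eq_mul]
  rw [Real.coe_toNNReal _ (pow_nonneg hx.1.le _)]

open Classical in
/-- The divergence theorem on a simplex for radial fields centred at a vertex. -/
lemma setIntegral_radial_divergence (hd : 1 ≤ d) (he : e.Nonempty) (hz0 : z ≠ 0)
    (hz : ∀ y ∈ e, inner ℝ z (y - a) = ‖z‖ ^ 2) (g : Poly d) :
    ∫ x in hull (insert a e), (d * ev g x + ∑ i, (x i - a i) * ev (MvPolynomial.pderiv i g) x) =
      ‖z‖ * ∫ y, ev g y ∂(facetMeasure e) := by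
  have hev := fun p : Poly d => continuous_ev p
  rw [setIntegral_hull_insert he hz0 hz (by fun_prop)]
  congr 2
  ext y
  -- Along each ray the weighted integrand is the exact derivative of `t ^ d * g`, so only the facet
  -- value at `t = 1` survives; the apex term vanishes as `d ≥ 1`.
  have hder : ∀ t : ℝ, HasDerivAt (fun t : ℝ => t ^ d * ev g (a + t • (y - a)))
      (t ^ (d - 1) * (d * ev g (a + t • (y - a)) + ∑ i, ((a + t • (y - a)) i - a i) *
        ev (MvPolynomial.pderiv i g) (a + t • (y - a)))) t := by
    intro t
    have h1 : HasDerivAt (fun t : ℝ => a + t • (y - a)) (y - a) t := by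
      simpa using ((hasDerivAt_id t).smul_const (y - a)).const_add a
    have h2 := (hasFDerivAt_ev g (a + t • (y - a))).comp_hasDerivAt t h1
    refine ((hasDerivAt_pow d t).mul h2).congr_deriv ?_
    simp only [FunLike.coe_sum, Finset.sum_apply, _root_.smul_apply, PiLp.proj_apply, smul_eq_mul,
      PiLp.add_apply, PiLp.smul_apply, PiLp.sub_apply, Function.comp_apply]
    have : t ^ d = t ^ (d - 1) * t := by rw [← pow_succ, Nat.sub_add_cancel hd]
    rw [mul_add, this, mul_assoc (t ^ (d - 1)) t, Finset.mul_sum]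
    congr 1
    · ring
    · congr 1
      exact Finset.sum_congr rfl fun i _ => by ring
  rw [intervalIntegral.integral_eq_sub_of_hasDerivAt (fun t _ => hder t)
    (Continuous.intervalIntegrable (by fun_prop) _ _)]
  simp [show d ≠ 0 by omega]

end Cone

/-! ### Heights, outward normals and the divergence theorem on a simplex -/

section Simplex

variable {d : ℕ}

/-- The vector from `a` to its orthogonal projection onto the affine span of `e`. -/
noncomputable def height (a : E d) (e : Finset (E d)) : E d :=
  (vectorSpan ℝ (e : Set (E d)))ᗮ.starProjection (bary e - a)

lemma bary_mem_hull {e : Finset (E d)} (he : e.Nonempty) : bary e ∈ hull e := by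
  have hc : (e.card : ℝ) ≠ 0 := by exact_mod_cast he.card_pos.ne'
  rw [bary, Finset.smul_sum]
  refine (convex_hull e).sum_mem (fun _ _ => by positivity) ?_
    fun y hy => subset_convexHull ℝ _ (by exact_mod_cast hy)
  simp [hc]

lemma sub_mem_vectorSpan_of_mem_hull {e : Finset (E d)} {x y : E d} (hx : x ∈ hull e)
    (hy : y ∈ hull e) : x - y ∈ vectorSpan ℝ (e : Set (E d)) := by
  have := AffineSubspace.vsub_mem_direction (convexHull_subset_affineSpan (𝕜 := ℝ) _ hx)
    (convexHull_subset_affineSpan (𝕜 := ℝ) _ hy)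
  rwa [direction_affineSpan] at this

/-- Points of the hull of `e` differ by vectors tangent to `e`, which the projection kills; the
barycentre in the definition is an arbitrary choice. -/
lemma height_eq {a : E d} {e : Finset (E d)} (he : e.Nonempty) {y : E d} (hy : y ∈ hull e) :
    height a e = (vectorSpan ℝ (e : Set (E d)))ᗮ.starProjection (y - a) := by
  have h : bary e - a = (bary e - y) + (y - a) := by abel
  rw [height, h, map_add, Submodule.starProjection_orthogonal_apply_eq_zero
    (sub_mem_vectorSpan_of_mem_hull (bary_mem_hull he) hy), zero_add]

/-- This is the hypothesis on `z` in the cone lemmas, for `z` the height vector. -/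
lemma inner_height {a : E d} {e : Finset (E d)} {y : E d} (hy : y ∈ e) :
    inner ℝ (height a e) (y - a) = ‖height a e‖ ^ 2 := by
  rw [height_eq ⟨y, hy⟩ (subset_convexHull ℝ _ (by exact_mod_cast hy)),
    ← real_inner_self_eq_norm_sq, Submodule.inner_starProjection_left_eq_right,
    Submodule.inner_starProjection_left_eq_right,
    Submodule.starProjection_eq_self_iff.2 (Submodule.starProjection_apply_mem _ _)]

lemma height_ne_zero {a : E d} {e : Finset (E d)} (he : e.Nonempty)
    (ha : a ∉ affineSpan ℝ (e : Set (E d))) : height a e ≠ 0 := by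
  intro h
  replace h : bary e - a ∈ vectorSpan ℝ (e : Set (E d)) := by
    have h' : bary e - a ∈ LinearMap.ker ((vectorSpan ℝ (e : Set (E d)))ᗮ.starProjection :
      E d →ₗ[ℝ] E d) := h
    rwa [Submodule.ker_starProjection, Submodule.orthogonal_orthogonal] at h'
  apply ha
  have h2 := bary_mem_hull he
  have := AffineSubspace.vadd_mem_of_mem_direction (s := affineSpan ℝ (e : Set (E d)))
    (v := -(bary e - a)) (by rw [direction_affineSpan]; exact neg_mem h)
    (convexHull_subset_affineSpan (𝕜 := ℝ) _ h2)
  simpa using this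

variable {K : Finset (E d)}

open Classical in
lemma erase_nonempty (hd : 1 ≤ d) (hc : K.card = d + 1) {a : E d} (ha : a ∈ K) :
    (K.erase a).Nonempty := by
  rw [← Finset.card_pos, Finset.card_erase_of_mem ha, hc]; omega

open Classical in
lemma height_erase_ne_zero (hd : 1 ≤ d) (hc : K.card = d + 1)
    (hi : AffineIndependent ℝ (fun x : K => (x : E d))) {a : E d} (ha : a ∈ K) :
    height a (K.erase a) ≠ 0 := by
  refine height_ne_zero (erase_nonempty hd hc ha) ?_
  have := hi.notMem_affineSpan_sdiff ⟨a, ha⟩ Set.univ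
  convert this using 3
  ext x
  simp only [Finset.coe_erase, Set.mem_sdiff, Finset.mem_coe, Set.mem_singleton_iff,
    Set.mem_image, Set.mem_univ, true_and, Subtype.exists, exists_and_right, exists_eq_right,
    Subtype.mk.injEq]
  tauto

open Classical in
-- The barycentres of facet and cell differ by 1/(d+1) times the vector from the opposite vertex to
-- the facet's barycentre. The normal is therefore a positive multiple of the height vector, which
-- settles its sign.
lemma normal_erase (hd : 1 ≤ d) (hc : K.card = d + 1) {a : E d} (ha : a ∈ K) :
    normal K (K.erase a) = ‖height a (K.erase a)‖⁻¹ • height a (K.erase a) := by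
  have hd' : (d : ℝ) ≠ 0 := by positivity
  have hce : (K.erase a).card = d := by rw [Finset.card_erase_of_mem ha, hc]; omega
  have hb : bary (K.erase a) - bary K = ((d : ℝ) + 1)⁻¹ • (bary (K.erase a) - a) := by
    have hs : ∑ x ∈ K.erase a, x = (d : ℝ) • bary (K.erase a) := by
      rw [bary, hce, smul_smul, mul_inv_cancel₀ hd', one_smul]
    rw [bary.eq_def K, ← Finset.add_sum_erase K _ ha, hs, hc]
    have h1 : bary (K.erase a) = ((d : ℝ) + 1)⁻¹ • (((d : ℝ) + 1) • bary (K.erase a)) := by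
      rw [smul_smul, inv_mul_cancel₀ (by positivity), one_smul]
    nth_rewrite 1 [h1]
    push_cast
    rw [← smul_sub]
    congr 1
    rw [add_smul, one_smul]; abel
  have h2 : (vectorSpan ℝ (K.erase a : Set (E d)))ᗮ.starProjection (bary (K.erase a) - bary K) =
      ((d : ℝ) + 1)⁻¹ • height a (K.erase a) := by
    rw [hb, map_smul, height]
  simp only [normal, h2]
  have h3 : (0 : ℝ) < (d : ℝ) + 1 := by positivity
  rw [norm_smul, Real.norm_of_nonneg (by positivity), smul_smul, mul_inv, inv_inv]
  congr 1
  field_simp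

open Classical in
lemma norm_normal_erase (hd : 1 ≤ d) (hc : K.card = d + 1)
    (hi : AffineIndependent ℝ (fun x : K => (x : E d))) {a : E d} (ha : a ∈ K) :
    ‖normal K (K.erase a)‖ = 1 := by
  rw [normal_erase hd hc ha, norm_smul, norm_inv, norm_norm, inv_mul_cancel₀]
  simpa using height_erase_ne_zero hd hc hi ha

open Classical in
lemma isFiniteMeasure_facetMeasure_erase (hd : 1 ≤ d) (hc : K.card = d + 1)
    (hi : AffineIndependent ℝ (fun x : K => (x : E d))) {a : E d} (ha : a ∈ K) :
    IsFiniteMeasure (facetMeasure (K.erase a)) :=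
  isFiniteMeasure_facetMeasure (erase_nonempty hd hc ha) (height_erase_ne_zero hd hc hi ha)
    fun _ hy => inner_height hy

lemma Continuous.integrableOn_hull {F : E d → ℝ} (hF : Continuous F) (s : Finset (E d)) :
    IntegrableOn F (hull s) :=
  hF.continuousOn.integrableOn_compact (isCompact_hull s)

open Classical in
lemma setIntegral_radial_divergence_erase (hd : 1 ≤ d) (hc : K.card = d + 1)
    (hi : AffineIndependent ℝ (fun x : K => (x : E d))) {a : E d} (ha : a ∈ K) (g : Poly d) :
    ∫ x in hull K, (d * ev g x + ∑ i, (x i - a i) * ev (MvPolynomial.pderiv i g) x) =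
      ‖height a (K.erase a)‖ * ∫ y, ev g y ∂(facetMeasure (K.erase a)) := by
  have := setIntegral_radial_divergence hd (erase_nonempty hd hc ha)
    (height_erase_ne_zero hd hc hi ha) (fun _ hy => inner_height hy) g
  rwa [Finset.insert_erase ha] at this

open Classical in
/-- The divergence theorem on a simplex, for the field `g w` with a constant vector `w`. -/
theorem setIntegral_hull_derivative (hd : 1 ≤ d) (hc : K.card = d + 1)
    (hi : AffineIndependent ℝ (fun x : K => (x : E d))) (g : Poly d) (w : E d) :
    ∫ x in hull K, ∑ i, w i * ev (MvPolynomial.pderiv i g) x =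
      ∑ a ∈ K, inner ℝ (normal K (K.erase a)) w * ∫ y, ev g y ∂(facetMeasure (K.erase a)) := by
  have hev := fun p : Poly d => continuous_ev p
  have hspan : vectorSpan ℝ (K : Set (E d)) = ⊤ := by
    have := hi.vectorSpan_eq_top_of_card_eq_finrank_add_one (by simp [hc])
    simpa using this
  have hw : w ∈ vectorSpan ℝ (K : Set (E d)) := hspan ▸ Submodule.mem_top
  rw [vectorSpan_def] at hw
  -- Both sides are linear in `w`, and the edge vectors span the space. For an edge `b - a` the
  -- radial identities centred at `a` and `b` are subtracted: (x − a) − (x − b) = b − a, and the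
  -- terms `d * g` cancel.
  induction hw using Submodule.span_induction with
  | mem x hx =>
    obtain ⟨b, hb, a, ha, rfl⟩ := hx
    simp only [vsub_eq_sub]
    rw [Finset.mem_coe] at ha hb
    have h1 := setIntegral_radial_divergence_erase hd hc hi ha g
    have h2 := setIntegral_radial_divergence_erase hd hc hi hb g
    have h3 : ∫ x in hull K, ∑ i, (b - a) i * ev (MvPolynomial.pderiv i g) x =
        ‖height a (K.erase a)‖ * (∫ y, ev g y ∂(facetMeasure (K.erase a))) -
        ‖height b (K.erase b)‖ * ∫ y, ev g y ∂(facetMeasure (K.erase b)) := by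
      rw [← h1, ← h2, ← integral_sub (Continuous.integrableOn_hull (by fun_prop) K)
        (Continuous.integrableOn_hull (by fun_prop) K)]
      congr 1
      ext x
      rw [add_sub_add_left_eq_sub, ← Finset.sum_sub_distrib]
      exact Finset.sum_congr rfl fun i _ => by rw [PiLp.sub_apply]; ring
    rw [h3]
    by_cases hab : a = b
    · subst hab; simp
    -- Only the facets opposite `a` and `b` contribute; the edge is tangent to every other facet.
    rw [← Finset.add_sum_erase K _ ha,
      ← Finset.add_sum_erase (K.erase a) _ (Finset.mem_erase.2 ⟨Ne.symm hab, hb⟩),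
      Finset.sum_eq_zero, add_zero, sub_eq_add_neg]
    · congr 1
      · rw [normal_erase hd hc ha, inner_smul_left,
          inner_height (Finset.mem_erase.2 ⟨Ne.symm hab, hb⟩)]
        have := norm_ne_zero_iff.2 (height_erase_ne_zero hd hc hi ha)
        simp only [map_inv₀, conj_trivial]
        field_simp
      · rw [normal_erase hd hc hb, inner_smul_left, ← neg_sub a b, inner_neg_right,
          inner_height (Finset.mem_erase.2 ⟨hab, ha⟩)]
        have := norm_ne_zero_iff.2 (height_erase_ne_zero hd hc hi hb)
        simp only [map_inv₀, conj_trivial]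
        field_simp
    · intro c hcK
      simp only [Finset.mem_erase] at hcK
      have e1 := inner_height (a := c) (e := K.erase c) (Finset.mem_erase.2 ⟨hcK.2.1.symm, ha⟩)
      have e2 := inner_height (a := c) (e := K.erase c) (Finset.mem_erase.2 ⟨hcK.1.symm, hb⟩)
      have : b - a = (b - c) - (a - c) := by abel
      rw [normal_erase hd hc hcK.2.2, this, inner_smul_left, inner_sub_right, e1, e2, sub_self,
        mul_zero, zero_mul]
  | zero => simp
  | add x y _ _ hx hy =>
    simp only [inner_add_right, add_mul, Finset.sum_add_distrib, ← hx, ← hy, PiLp.add_apply]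
    exact integral_add (Continuous.integrableOn_hull (by fun_prop) K)
      (Continuous.integrableOn_hull (by fun_prop) K)
  | smul c x _ hx =>
    simp only [inner_smul_right, mul_assoc, ← Finset.mul_sum, ← hx, PiLp.smul_apply, smul_eq_mul]
    exact integral_const_mul _ _

end Simplex

/-! ### The discrete trace inequality -/

section Trace

variable {d : ℕ}

lemma totalDegree_bind₁_le {p : Poly d} {f : Fin d → Poly d} {k : ℕ} (hp : p.totalDegree ≤ k)
    (hf : ∀ i, (f i).totalDegree ≤ 1) : (MvPolynomial.bind₁ f p).totalDegree ≤ k := by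
  rw [MvPolynomial.as_sum p, map_sum]
  refine MvPolynomial.totalDegree_finsetSum_le fun s hs => ?_
  rw [MvPolynomial.bind₁_monomial]
  refine (MvPolynomial.totalDegree_mul _ _).trans ?_
  rw [MvPolynomial.totalDegree_C, zero_add]
  refine (MvPolynomial.totalDegree_finsetProd _ _).trans ?_
  refine le_trans (Finset.sum_le_sum fun i _ => (MvPolynomial.totalDegree_pow _ _).trans
    (Nat.mul_le_mul_left (s i) (hf i))) ?_
  simp only [mul_one]
  exact (MvPolynomial.le_totalDegree hs).trans hp

lemma ev_bind₁ (p : Poly d) (f : Fin d → Poly d) (x : E d) :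
    ev (MvPolynomial.bind₁ f p) x = ev p (WithLp.toLp 2 fun i => ev (f i) x) := by
  induction p using MvPolynomial.induction_on with
  | C a => simp
  | add p q hp hq => simp [hp, hq]
  | mul_X p i hp => simp [hp]

lemma memLp_ev_restrict {s : Set (E d)} (hs : IsCompact s) (p : Poly d) :
    MemLp (ev p) 2 (volume.restrict s) :=
  (memLp_two_iff_integrable_sq (continuous_ev p).aestronglyMeasurable).2
    (((continuous_ev p).pow 2).continuousOn.integrableOn_compact hs)

/-- Equivalence of norms on polynomials of bounded degree. -/
lemma exists_sq_ev_le_integral (k : ℕ) {γ : ℝ} (hγ : 0 < γ) :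
    ∃ C : ℝ, 0 ≤ C ∧ ∀ p : Poly d, p.totalDegree ≤ k → ∀ x ∈ Metric.closedBall (0 : E d) 1,
      ev p x ^ 2 ≤ C * ∫ y in Metric.closedBall (0 : E d) γ, ev p y ^ 2 := by
  set B := Metric.closedBall (0 : E d) γ
  have hB : IsCompact B := isCompact_closedBall _ _
  let V := MvPolynomial.restrictTotalDegree (Fin d) ℝ k
  let L : V →ₗ[ℝ] Lp ℝ 2 (volume.restrict B) :=
    { toFun := fun p => (memLp_ev_restrict hB p.1).toLp _
      map_add' := fun p q => by
        rw [← MemLp.toLp_add]; congr 1; ext x; simp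
      map_smul' := fun c p => by
        rw [RingHom.id_apply, ← MemLp.toLp_const_smul]; congr 1; ext x; simp }
  have hL : Function.Injective L := by
    rw [← LinearMap.ker_eq_bot, LinearMap.ker_eq_bot']
    intro p hp
    have h1 : ev p.1 =ᵐ[volume.restrict B] 0 :=
      (MemLp.coeFn_toLp (memLp_ev_restrict hB p.1)).symm.trans
        ((Lp.ext_iff.1 hp).trans (Lp.coeFn_zero _ _ _))
    refine Subtype.ext (eq_zero_of_ae_ev_eq_zero ?_ h1)
    rw [interior_closedBall _ hγ.ne']
    exact Metric.nonempty_ball.2 hγ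
  let G : V →ₗ[ℝ] C(Metric.closedBall (0 : E d) 1, ℝ) :=
    { toFun := fun p => ⟨fun x => ev p.1 x.1, (continuous_ev p.1).comp continuous_subtype_val⟩
      map_add' := fun p q => by ext x; simp
      map_smul' := fun c p => by ext x; simp }
  -- `H` takes a polynomial from its L² class on the small ball to its restriction to the unit ball.
  -- Its domain is finite-dimensional, so it is bounded.
  let H := (G ∘ₗ (LinearEquiv.ofInjective L hL).symm.toLinearMap).toContinuousLinearMap
  refine ⟨‖H‖ ^ 2, by positivity, fun p hp x hx => ?_⟩
  let p' : V := ⟨p, (MvPolynomial.mem_restrictTotalDegree _ _ _).2 hp⟩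
  have h1 : H (LinearEquiv.ofInjective L hL p') = G p' := by simp [H]
  have h2 : |ev p x| ≤ ‖H‖ * ‖L p'‖ :=
    ((G p').norm_coe_le_norm ⟨x, hx⟩).trans (h1 ▸ H.le_opNorm _)
  have h3 : ‖L p'‖ ^ 2 = ∫ y in B, ev p y ^ 2 := by
    rw [← real_inner_self_eq_norm_sq, L2.inner_def]
    refine integral_congr_ae ?_
    filter_upwards [MemLp.coeFn_toLp (memLp_ev_restrict hB p)] with y hy
    change inner ℝ ((memLp_ev_restrict hB p).toLp _ y) ((memLp_ev_restrict hB p).toLp _ y) = _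
    rw [hy]; simp [sq]
  rw [← h3, ← mul_pow, ← sq_abs]
  exact pow_le_pow_left₀ (abs_nonneg _) h2 2

/-- The substitution `y ↦ x₀ + h • y` preserves the degree bound and reduces to the unit ball; `h ^
d` is its Jacobian. -/
lemma exists_sq_ev_le_integral_ball (k : ℕ) {γ : ℝ} (hγ : 0 < γ) :
    ∃ C : ℝ, 0 ≤ C ∧ ∀ p : Poly d, p.totalDegree ≤ k → ∀ (x₀ : E d) (h : ℝ), 0 < h →
      ∀ x ∈ Metric.closedBall x₀ h,
      ev p x ^ 2 * h ^ d ≤ C * ∫ y in Metric.closedBall x₀ (γ * h), ev p y ^ 2 := by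
  obtain ⟨C, hC, hCp⟩ := exists_sq_ev_le_integral (d := d) k hγ
  refine ⟨C, hC, fun p hp x₀ h hh x hx => ?_⟩
  set f : Fin d → Poly d := fun i => MvPolynomial.C (x₀ i) + h • MvPolynomial.X i
  have hf : ∀ y : E d, ev (MvPolynomial.bind₁ f p) y = ev p (x₀ + h • y) := by
    intro y
    rw [ev_bind₁]
    congr 1
    ext i
    simp [f]
  have hdeg : (MvPolynomial.bind₁ f p).totalDegree ≤ k := by
    refine totalDegree_bind₁_le hp fun i => (MvPolynomial.totalDegree_add _ _).trans ?_
    simp only [MvPolynomial.totalDegree_C, zero_le, sup_of_le_right]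
    exact (MvPolynomial.totalDegree_smul_le _ _).trans (MvPolynomial.totalDegree_X i).le
  have hx' : h⁻¹ • (x - x₀) ∈ Metric.closedBall (0 : E d) 1 := by
    rw [mem_closedBall_zero_iff, norm_smul, norm_inv, Real.norm_of_nonneg hh.le,
      inv_mul_le_iff₀ hh, mul_one]
    rwa [Metric.mem_closedBall, dist_eq_norm] at hx
  have := hCp _ hdeg _ hx'
  simp only [hf] at this
  rw [smul_smul, mul_inv_cancel₀ hh.ne', one_smul, add_sub_cancel] at this
  have hFint : ∫ y in Metric.closedBall x₀ (γ * h), ev p y ^ 2 =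
      h ^ d * ∫ y in Metric.closedBall (0 : E d) γ, ev p (x₀ + h • y) ^ 2 := by
    rw [← integral_indicator measurableSet_closedBall,
      ← integral_indicator measurableSet_closedBall]
    have h1 := Measure.integral_comp_smul (volume : Measure (E d))
      (fun y => (Metric.closedBall x₀ (γ * h)).indicator (fun y => ev p y ^ 2) (x₀ + y)) h
    rw [integral_add_left_eq_self (μ := (volume : Measure (E d)))
      (fun y => (Metric.closedBall x₀ (γ * h)).indicator (fun y => ev p y ^ 2) y) x₀] at h1
    simp only [finrank_euclideanSpace_fin, smul_eq_mul] at h1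
    rw [abs_of_pos (by positivity)] at h1
    have h2 : ∀ y : E d, (Metric.closedBall x₀ (γ * h)).indicator (fun y => ev p y ^ 2)
        (x₀ + h • y) = (Metric.closedBall (0 : E d) γ).indicator
          (fun y => ev p (x₀ + h • y) ^ 2) y := by
      intro y
      have : x₀ + h • y ∈ Metric.closedBall x₀ (γ * h) ↔ y ∈ Metric.closedBall (0 : E d) γ := by
        rw [mem_closedBall_zero_iff, Metric.mem_closedBall, dist_self_add_left, norm_smul,
          Real.norm_of_nonneg hh.le, mul_comm, mul_le_mul_iff_left₀ hh]
      by_cases hy : y ∈ Metric.closedBall (0 : E d) γ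
      · rw [Set.indicator_of_mem hy, Set.indicator_of_mem (this.2 hy)]
      · rw [Set.indicator_of_notMem hy, Set.indicator_of_notMem (mt this.1 hy)]
    simp only [h2] at h1
    rw [h1]
    field_simp
  rw [hFint]
  calc ev p x ^ 2 * h ^ d ≤ (C * ∫ y in Metric.closedBall (0 : E d) γ, ev p (x₀ + h • y) ^ 2)
        * h ^ d := by gcongr
    _ = _ := by ring

variable {K : Finset (E d)}

open Classical in
-- The radial divergence identity for the constant function 1.
lemma height_mul_area (hd : 1 ≤ d) (hc : K.card = d + 1)
    (hi : AffineIndependent ℝ (fun x : K => (x : E d))) {a : E d} (ha : a ∈ K) :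
    ‖height a (K.erase a)‖ * (facetMeasure (K.erase a)).real Set.univ =
      d * volume.real (hull K) := by
  have := setIntegral_radial_divergence_erase hd hc hi ha 1
  simpa [mul_comm] using this.symm

open Classical in
-- On the cell the linear function ⟨z, x − a⟩ stays between 0 and ‖z‖², while on a ball of radius
-- `r` it varies by `2 * r * ‖z‖`.
lemma two_mul_radius_le_height (hd : 1 ≤ d) (hc : K.card = d + 1)
    (hi : AffineIndependent ℝ (fun x : K => (x : E d))) {a : E d} (ha : a ∈ K) {x₀ : E d} {r : ℝ}
    (hr : 0 ≤ r) (hb : Metric.closedBall x₀ r ⊆ hull K) : 2 * r ≤ ‖height a (K.erase a)‖ := by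
  set z := height a (K.erase a) with hz
  have hz0 : 0 < ‖z‖ := norm_pos_iff.2 (height_erase_ne_zero hd hc hi ha)
  have hrange : ∀ x ∈ hull K, 0 ≤ inner ℝ z (x - a) ∧ inner ℝ z (x - a) ≤ ‖z‖ ^ 2 := by
    intro x hx
    rw [← Finset.insert_erase ha, mem_hull_insert (erase_nonempty hd hc ha)] at hx
    obtain ⟨t, ht, y, hy, rfl⟩ := hx
    rw [add_sub_cancel_left, inner_smul_right,
      inner_sub_eq_of_mem_hull (fun _ hy => inner_height hy) hy]
    exact ⟨mul_nonneg ht.1 (by positivity), mul_le_of_le_one_left (by positivity) ht.2⟩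
  have hn : ‖(r * ‖z‖⁻¹) • z‖ ≤ r := by
    rw [norm_smul, norm_mul, norm_inv, norm_norm, Real.norm_of_nonneg hr, mul_assoc,
      inv_mul_cancel₀ hz0.ne', mul_one]
  have h1 := (hrange (x₀ + (r * ‖z‖⁻¹) • z) (hb (by simpa using hn))).2
  have h2 := (hrange (x₀ - (r * ‖z‖⁻¹) • z) (hb (by simpa using hn))).1
  rw [add_sub_right_comm, inner_add_right, inner_smul_right, real_inner_self_eq_norm_sq] at h1
  rw [sub_right_comm, inner_sub_right, inner_smul_right, real_inner_self_eq_norm_sq] at h2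
  have h3 : r * ‖z‖⁻¹ * ‖z‖ ^ 2 = r * ‖z‖ := by field_simp
  nlinarith

open Classical in
/-- The discrete trace inequality on a shape regular simplex. -/
theorem exists_trace_inequality (hd : 1 ≤ d) (k : ℕ) {γ : ℝ} (hγ : 0 < γ) :
    ∃ C : ℝ, 0 ≤ C ∧ ∀ K : Finset (E d), K.card = d + 1 →
      AffineIndependent ℝ (fun x : K => (x : E d)) → 0 < Metric.diam (hull K) →
      (∃ x₀ : E d, Metric.closedBall x₀ (γ * Metric.diam (hull K)) ⊆ hull K) →
      ∀ a ∈ K, ∀ p : Poly d, p.totalDegree ≤ k →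
        Metric.diam (hull K) * ∫ x, ev p x ^ 2 ∂(facetMeasure (K.erase a)) ≤
          C * ∫ x in hull K, ev p x ^ 2 := by
  obtain ⟨C, hC, hCp⟩ := exists_sq_ev_le_integral_ball (d := d) k hγ
  set κ := volume.real (Metric.closedBall (0 : E d) 1) with hκ
  -- On the facet `p ^ 2` is at most `C * I / h ^ d`. The facet area is `d` times the volume, at
  -- most `d * κ * h ^ d`, over a height of at least `2 * γ * h`. The powers of `h` cancel.
  refine ⟨d * κ * C / (2 * γ), by positivity, fun K hc hi hpos ⟨x₀, hb⟩ a ha p hp => ?_⟩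
  set h := Metric.diam (hull K) with hh
  have := isFiniteMeasure_facetMeasure_erase hd hc hi ha
  have hx₀ : x₀ ∈ hull K := hb (Metric.mem_closedBall_self (by positivity))
  have hsub : hull K ⊆ Metric.closedBall x₀ h := fun x hx =>
    Metric.dist_le_diam_of_mem (isCompact_hull K).isBounded hx hx₀
  set I := ∫ x in hull K, ev p x ^ 2 with hI
  have hI0 : 0 ≤ I := integral_nonneg fun x => sq_nonneg _
  have hcont : Continuous fun x => ev p x ^ 2 := (continuous_ev p).pow 2
  have hball : ∫ y in Metric.closedBall x₀ (γ * h), ev p y ^ 2 ≤ I :=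
    setIntegral_mono_set (Continuous.integrableOn_hull hcont K)
      (Eventually.of_forall fun x => sq_nonneg _) (Eventually.of_forall hb)
  have hsup : ∀ x ∈ hull (K.erase a), ev p x ^ 2 ≤ C * I / h ^ d := by
    intro x hx
    rw [le_div_iff₀ (by positivity)]
    exact (hCp p hp x₀ h hpos x (hsub (hull_mono (Finset.erase_subset a K) hx))).trans
      (mul_le_mul_of_nonneg_left hball hC)
  have hfacet : ∫ x, ev p x ^ 2 ∂(facetMeasure (K.erase a)) ≤
      (facetMeasure (K.erase a)).real Set.univ * (C * I / h ^ d) := by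
    have hae : ∀ᵐ x ∂(facetMeasure (K.erase a)), ev p x ^ 2 ≤ C * I / h ^ d := by
      filter_upwards [ae_restrict_mem (measurableSet_hull (K.erase a))] with x hx
      exact hsup x hx
    have := integral_mono_of_nonneg (Eventually.of_forall fun x => sq_nonneg _)
      (integrable_const _) hae
    simpa using this
  have hvol : volume.real (hull K) ≤ h ^ d * κ := by
    refine (measureReal_mono hsub measure_closedBall_lt_top.ne).trans_eq ?_
    rw [hκ, Measure.real, Measure.addHaar_closedBall' _ _ hpos.le, ENNReal.toReal_mul,
      finrank_euclideanSpace_fin, ENNReal.toReal_ofReal (by positivity)]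
    rfl
  have harea := height_mul_area hd hc hi ha
  have hheight := two_mul_radius_le_height hd hc hi ha (by positivity) hb
  set σ := (facetMeasure (K.erase a)).real Set.univ
  have hσ : 0 ≤ σ := measureReal_nonneg
  have hσ' : 2 * (γ * h) * σ ≤ d * (h ^ d * κ) :=
    (mul_le_mul_of_nonneg_right hheight hσ).trans (harea.le.trans (by gcongr))
  calc h * ∫ x, ev p x ^ 2 ∂(facetMeasure (K.erase a)) ≤ h * (σ * (C * I / h ^ d)) := by gcongr
    _ = (2 * (γ * h) * σ) * (C * I / h ^ d) / (2 * γ) := by field_simp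
    _ ≤ (d * (h ^ d * κ)) * (C * I / h ^ d) / (2 * γ) := by gcongr
    _ = _ := by field_simp

end Trace

/-! ### Null sets among convex hulls -/

section Null

variable {d : ℕ}

/-- The hull of `n` points has vanishing `n`-dimensional measure. -/
lemma euclideanHausdorffMeasure_convexHull {n : ℕ} {s : Finset (E d)} (hs : s.card ≤ n) :
    μHE[n] (convexHull ℝ (s : Set (E d))) = 0 := by
  classical
  rcases s.eq_empty_or_nonempty with rfl | hne
  · simp
  obtain ⟨p, hp⟩ := hne
  set W := vectorSpan ℝ (s : Set (E d))
  have hrank : Module.finrank ℝ W < n := by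
    obtain ⟨m, hm⟩ : ∃ m, s.card = m + 1 :=
      ⟨s.card - 1, by have := Finset.card_pos.2 ⟨p, hp⟩; omega⟩
    have h := finrank_vectorSpan_image_finset_le ℝ (id : E d → E d) s hm
    rw [Finset.image_id] at h
    change Module.finrank ℝ W ≤ m at h
    omega
  have hiso : Isometry (fun w : W => p + (w : E d)) :=
    Isometry.of_dist_eq fun x y => by simp [dist_eq_norm]
  have hsub : convexHull ℝ (s : Set (E d)) ⊆ (fun w : W => p + (w : E d)) '' Set.univ := by
    intro x hx
    exact ⟨⟨x - p, sub_mem_vectorSpan_of_mem_hull hx (subset_convexHull ℝ _ (by exact_mod_cast hp))⟩,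
      trivial, by simp⟩
  refine measure_mono_null hsub ?_
  rw [hiso.euclideanHausdorffMeasure_image, Measure.euclideanHausdorffMeasure_def,
    Measure.smul_apply]
  have h0 : (μH[(n : ℝ)] : Measure W) = 0 :=
    Real.hausdorffMeasure_of_finrank_lt (by exact_mod_cast hrank)
  have h1 : (μH[(n : ℝ)] : Measure W) Set.univ = 0 := by simp [h0]
  rw [h1, smul_zero]

end Null

/-! ### The side of a facet on which a simplex lies -/

section Side

variable {d : ℕ}

/-- The barycentre gives every vertex the same positive weight, so a small shift of weight between
two vertices keeps all weights nonnegative. General tangent vectors follow by linear combination. -/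
lemma exists_bary_add_smul_mem_hull {e : Finset (E d)} (he : e.Nonempty) {w : E d}
    (hw : w ∈ vectorSpan ℝ (e : Set (E d))) :
    ∃ δ > 0, ∀ t : ℝ, |t| ≤ δ → bary e + t • w ∈ hull e := by
  classical
  rw [vectorSpan_def] at hw
  have hcard : (0 : ℝ) < e.card := by exact_mod_cast he.card_pos
  induction hw using Submodule.span_induction with
  | mem x hx =>
    obtain ⟨y, hy, y', hy', rfl⟩ := hx
    rw [Finset.mem_coe] at hy hy'
    refine ⟨(e.card : ℝ)⁻¹, by positivity, fun t ht => ?_⟩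
    rw [abs_le] at ht
    have hy'h : y' ∈ hull e := subset_convexHull ℝ _ (by exact_mod_cast hy')
    by_cases hyy : y = y'
    · subst hyy; simpa using bary_mem_hull he
    set c : E d → ℝ := fun x => (e.card : ℝ)⁻¹ + ((if x = y then t else 0) -
      (if x = y' then t else 0)) with hc
    have hsum : bary e + t • (y -ᵥ y') = ∑ x ∈ e, c x • x := by
      simp [hc, add_smul, sub_smul, Finset.sum_add_distrib, Finset.smul_sum, bary, hy, hy',
        smul_sub]
    rw [hsum]
    refine (convex_hull e).sum_mem (fun x _ => ?_) ?_
      fun x hx => subset_convexHull ℝ _ (by exact_mod_cast hx)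
    · simp only [hc]
      by_cases h1 : x = y
      · subst h1; simp [hyy]; linarith
      · by_cases h2 : x = y'
        · subst h2; simp [h1]; linarith
        · simp [h1, h2]
    · simp [hc, Finset.sum_add_distrib, hy, hy', hcard.ne']
  | zero => exact ⟨1, one_pos, fun t _ => by simpa using bary_mem_hull he⟩
  | add x y _ _ hx hy =>
    obtain ⟨δ, hδ, h1⟩ := hx
    obtain ⟨δ', hδ', h2⟩ := hy
    refine ⟨min δ δ' / 2, by positivity, fun t ht => ?_⟩
    have e1 : |2 * t| ≤ δ := by
      rw [abs_mul, abs_two]; linarith [min_le_left δ δ']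
    have e2 : |2 * t| ≤ δ' := by
      rw [abs_mul, abs_two]; linarith [min_le_right δ δ']
    have := convex_hull e (h1 _ e1) (h2 _ e2) (a := 1 / 2) (b := 1 / 2) (by norm_num)
      (by norm_num) (by norm_num)
    convert this using 1
    module
  | smul c x _ hx =>
    obtain ⟨δ, hδ, h1⟩ := hx
    refine ⟨δ / (|c| + 1), by positivity, fun t ht => ?_⟩
    rw [smul_smul]
    refine h1 _ ?_
    rw [le_div_iff₀ (by positivity)] at ht
    rw [abs_mul]
    nlinarith [abs_nonneg t]

open Classical in
lemma exists_bary_sub_smul_height_mem_hull {e : Finset (E d)} (he : e.Nonempty) (a : E d) :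
    ∃ δ > 0, ∀ t : ℝ, 0 ≤ t → t ≤ δ → bary e - t • height a e ∈ hull (insert a e) := by
  have hw : bary e - a - height a e ∈ vectorSpan ℝ (e : Set (E d)) := by
    rw [height, Submodule.starProjection_orthogonal']
    simpa using Submodule.starProjection_apply_mem (vectorSpan ℝ (e : Set (E d))) (bary e - a)
  obtain ⟨δ, hδ, h⟩ := exists_bary_add_smul_mem_hull he hw
  refine ⟨min (1 / 2) (δ / 2), by positivity, fun t ht0 ht => ?_⟩
  have ht1 : t ≤ 1 / 2 := ht.trans (min_le_left _ _)
  have ht2 : t ≤ δ / 2 := ht.trans (min_le_right _ _)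
  have h1t : 0 < 1 - t := by linarith
  have hs : |t / (1 - t)| ≤ δ := by
    rw [abs_of_nonneg (by positivity), div_le_iff₀ h1t]
    nlinarith
  rw [mem_hull_insert he]
  -- In cone coordinates the point lies at height `1 - t` over the barycentre moved by `t / (1 - t)`
  -- times the tangential part of `bary e - a`.
  refine ⟨1 - t, ⟨h1t.le, by linarith⟩, _, h _ hs, ?_⟩
  rw [smul_sub, smul_add, smul_smul, mul_div_cancel₀ _ h1t.ne']
  module

end Side

/-! ### Facets, normals and overlaps in a triangulation -/

namespace Triangulation

variable {d : ℕ} {Ω : Set (E d)} {T : Triangulation Ω}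

lemma card_facet (e : T.facets) : e.1.card = d := by
  classical
  obtain ⟨K, _, h⟩ := Finset.mem_biUnion.1 e.2
  exact (Finset.mem_powersetCard.1 h).2

lemma exists_cell (e : T.facets) : ∃ K : T.cells, e.1 ⊆ K.1 := by
  classical
  obtain ⟨K, hK, h⟩ := Finset.mem_biUnion.1 e.2
  exact ⟨⟨K, hK⟩, (Finset.mem_powersetCard.1 h).1⟩

open Classical in
lemma exists_eq_erase {K : T.cells} {e : T.facets} (h : e.1 ⊆ K.1) :
    ∃ a ∈ K.1, e.1 = K.1.erase a := by
  have hc : (K.1 \ e.1).card = 1 := by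
    rw [Finset.card_sdiff_of_subset h, T.card_eq K.1 K.2, card_facet]; omega
  obtain ⟨a, ha⟩ := Finset.card_eq_one.1 hc
  have haK : a ∈ K.1 \ e.1 := by rw [ha]; simp
  refine ⟨a, (Finset.mem_sdiff.1 haK).1, ?_⟩
  rw [Finset.erase_eq, ← ha, Finset.sdiff_sdiff_eq_self h]

open Classical in
lemma erase_mem_facets (K : T.cells) {a : E d} (ha : a ∈ K.1) : K.1.erase a ∈ T.facets := by
  refine Finset.mem_biUnion.2 ⟨K.1, K.2, Finset.mem_powersetCard.2 ⟨Finset.erase_subset _ _, ?_⟩⟩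
  rw [Finset.card_erase_of_mem ha, T.card_eq K.1 K.2]; omega

open Classical in
lemma sum_facets_of_cell (K : T.cells) (F : Finset (E d) → ℝ) :
    ∑ e : T.facets with e.1 ⊆ K.1, F e.1 = ∑ a ∈ K.1, F (K.1.erase a) := by
  symm
  refine Finset.sum_bij (fun a ha => ⟨K.1.erase a, erase_mem_facets K ha⟩) ?_ ?_ ?_ ?_
  · intro a ha; simp [Finset.erase_subset]
  · intro a ha b hb h
    exact (Finset.erase_inj _ ha).1 (Subtype.ext_iff.1 h)
  · intro e he
    obtain ⟨a, ha, h⟩ := exists_eq_erase (Finset.mem_filter.1 he).2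
    exact ⟨a, ha, Subtype.ext h.symm⟩
  · intros; rfl

lemma isFiniteMeasure_facet (hd : 1 ≤ d) (e : T.facets) : IsFiniteMeasure (facetMeasure e.1) := by
  classical
  obtain ⟨K, hK⟩ := exists_cell e
  obtain ⟨a, ha, h⟩ := exists_eq_erase hK
  rw [h]
  exact isFiniteMeasure_facetMeasure_erase hd (T.card_eq K.1 K.2) (T.indep K.1 K.2) ha

lemma norm_normal (hd : 1 ≤ d) {K : T.cells} {e : T.facets} (h : e.1 ⊆ K.1) :
    ‖normal K.1 e.1‖ = 1 := by
  classical
  obtain ⟨a, ha, h⟩ := exists_eq_erase h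
  rw [h]
  exact norm_normal_erase hd (T.card_eq K.1 K.2) (T.indep K.1 K.2) ha

lemma hCell_pos (hd : 1 ≤ d) (K : T.cells) : 0 < T.hCell K := by
  have hc := T.card_eq K.1 K.2
  obtain ⟨x, hx, y, hy, hxy⟩ := Finset.one_lt_card.1 (by omega : 1 < K.1.card)
  exact (dist_pos.2 hxy).trans_le (Metric.dist_le_diam_of_mem (isCompact_hull K.1).isBounded
    (subset_convexHull ℝ _ (by exact_mod_cast hx)) (subset_convexHull ℝ _ (by exact_mod_cast hy)))

/-- In a shape regular mesh, the diameter of a cell is bounded by that of its facets. -/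
lemma hCell_le_hFacet (hd : 1 ≤ d) {γ : ℝ} (hγ : 0 < γ) (hT : T.ShapeRegular γ) {K : T.cells}
    {e : T.facets} (h : e.1 ⊆ K.1) : T.hCell K ≤ max 1 γ⁻¹ * T.hFacet e := by
  classical
  have hpos := hCell_pos hd K
  rw [hFacet]
  split_ifs with hd1
  · have h1 : T.hCell K ≤ ⨆ K : {K : T.cells // e.1 ⊆ K.1}, T.hCell K.1 :=
      le_ciSup (f := fun K : {K : T.cells // e.1 ⊆ K.1} => T.hCell K.1)
        (Set.finite_range _).bddAbove ⟨K, h⟩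
    calc T.hCell K ≤ 1 * ⨆ K : {K : T.cells // e.1 ⊆ K.1}, T.hCell K.1 := by rwa [one_mul]
      _ ≤ _ := mul_le_mul_of_nonneg_right (le_max_left _ _) (hpos.le.trans h1)
  · obtain ⟨a, ha, hea⟩ := exists_eq_erase h
    obtain ⟨x₀, hx₀⟩ := hT K
    have hene : e.1.Nonempty := by rw [← Finset.card_pos, card_facet]; omega
    set m := bary e.1
    have hm : m ∈ hull e.1 := bary_mem_hull hene
    -- Here `d ≥ 2`, so some direction `w` is orthogonal to the segment from the apex to the facet's
    -- barycentre. Seen along `w`, the cell extends no further from `m` than the facet does, while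
    -- the inscribed ball has width `2 * r`.
    obtain ⟨w, hw0, hw⟩ : ∃ w : E d, w ≠ 0 ∧ inner ℝ (a - m) w = 0 := by
      have h1 : (ℝ ∙ (a - m))ᗮ ≠ ⊥ := by
        intro h0
        have h2 := (ℝ ∙ (a - m)).finrank_add_finrank_orthogonal
        rw [h0, finrank_bot, finrank_euclideanSpace_fin] at h2
        have : Module.finrank ℝ (ℝ ∙ (a - m)) ≤ 1 := by
          simpa using finrank_span_le_card (R := ℝ) ({a - m} : Set (E d))
        omega
      obtain ⟨w, hw, hw0⟩ := Submodule.exists_mem_ne_zero_of_ne_bot h1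
      exact ⟨w, hw0, Submodule.mem_orthogonal_singleton_iff_inner_right.1 hw⟩
    have hwn : 0 < ‖w‖ := norm_pos_iff.2 hw0
    have hbd : ∀ x ∈ hull K.1, |inner ℝ (x - m) w| ≤ Metric.diam (hull e.1) * ‖w‖ := by
      intro x hx
      rw [← Finset.insert_erase ha, ← hea, mem_hull_insert hene] at hx
      obtain ⟨t, ht, y, hy, rfl⟩ := hx
      have : a + t • (y - a) - m = (1 - t) • (a - m) + t • (y - m) := by module
      rw [this, inner_add_left, inner_smul_left, inner_smul_left, hw, mul_zero, zero_add]
      simp only [conj_trivial]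
      rw [abs_mul, abs_of_nonneg ht.1]
      have h1 : |inner ℝ (y - m) w| ≤ Metric.diam (hull e.1) * ‖w‖ := by
        refine (abs_real_inner_le_norm _ _).trans ?_
        gcongr
        rw [← dist_eq_norm]
        exact Metric.dist_le_diam_of_mem (isCompact_hull _).isBounded hy hm
      nlinarith [abs_nonneg (inner ℝ (y - m) w), ht.2]
    set r := γ * T.hCell K with hr
    have hr0 : 0 ≤ r := by positivity
    have hn : ‖(r * ‖w‖⁻¹) • w‖ ≤ r := by
      rw [norm_smul, norm_mul, norm_inv, norm_norm, Real.norm_of_nonneg hr0, mul_assoc,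
        inv_mul_cancel₀ hwn.ne', mul_one]
    have h1 := hbd (x₀ + (r * ‖w‖⁻¹) • w) (hx₀ (by simpa using hn))
    have h2 := hbd (x₀ - (r * ‖w‖⁻¹) • w) (hx₀ (by simpa using hn))
    rw [add_sub_right_comm, inner_add_left, inner_smul_left, real_inner_self_eq_norm_sq,
      abs_le] at h1
    rw [sub_right_comm, inner_sub_left, inner_smul_left, real_inner_self_eq_norm_sq, abs_le] at h2
    simp only [conj_trivial] at h1 h2
    have h3 : r * ‖w‖⁻¹ * ‖w‖ ^ 2 = r * ‖w‖ := by field_simp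
    have h4 : r ≤ Metric.diam (hull e.1) := by
      refine le_of_mul_le_mul_right ?_ hwn
      linarith [h1.2, h2.1]
    calc T.hCell K = γ⁻¹ * r := by rw [hr]; field_simp
      _ ≤ γ⁻¹ * Metric.diam (hull e.1) := by gcongr
      _ ≤ _ := mul_le_mul_of_nonneg_right (le_max_right _ _) Metric.diam_nonneg

/-- Distinct cells cannot share all `d + 1` vertices, so the `d` vertices of a common facet are all
they share. -/
lemma inter_eq_of_ne {K L : T.cells} {e : T.facets} (hKL : K ≠ L) (hK : e.1 ⊆ K.1)
    (hL : e.1 ⊆ L.1) : (K.1 : Set (E d)) ∩ L.1 = e.1 := by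
  classical
  rw [← Finset.coe_inter]
  congr 1
  symm
  refine Finset.eq_of_subset_of_card_le (Finset.subset_inter hK hL) ?_
  rw [card_facet]
  by_contra hcon
  push Not at hcon
  have h1 : K.1 ∩ L.1 = K.1 := Finset.eq_of_subset_of_card_le Finset.inter_subset_left
    (by rw [T.card_eq K.1 K.2]; omega)
  have h2 : K.1 ∩ L.1 = L.1 := Finset.eq_of_subset_of_card_le Finset.inter_subset_right
    (by rw [T.card_eq L.1 L.2]; omega)
  exact hKL (Subtype.ext (h1.symm.trans h2))

/-- The outer normals of two cells on a common facet are opposite. -/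
lemma normal_eq_neg (hd : 1 ≤ d) {K L : T.cells} {e : T.facets} (hKL : K ≠ L) (hK : e.1 ⊆ K.1)
    (hL : e.1 ⊆ L.1) : normal L.1 e.1 = -normal K.1 e.1 := by
  classical
  obtain ⟨a, ha, hea⟩ := exists_eq_erase hK
  obtain ⟨b, hb, heb⟩ := exists_eq_erase hL
  have hene : e.1.Nonempty := by rw [← Finset.card_pos, card_facet]; omega
  have hnK : normal K.1 e.1 = ‖height a e.1‖⁻¹ • height a e.1 := by
    rw [hea]; exact normal_erase hd (T.card_eq K.1 K.2) ha
  have hnL : normal L.1 e.1 = ‖height b e.1‖⁻¹ • height b e.1 := by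
    rw [heb]; exact normal_erase hd (T.card_eq L.1 L.2) hb
  have hzK : 0 < ‖height a e.1‖ := by
    rw [hea]; exact norm_pos_iff.2 (height_erase_ne_zero hd (T.card_eq K.1 K.2) (T.indep K.1 K.2) ha)
  have hzL : 0 < ‖height b e.1‖ := by
    rw [heb]; exact norm_pos_iff.2 (height_erase_ne_zero hd (T.card_eq L.1 L.2) (T.indep L.1 L.2) hb)
  set W := vectorSpan ℝ (e.1 : Set (E d)) with hW
  have hmK : normal K.1 e.1 ∈ Wᗮ := by
    rw [hnK]; exact Submodule.smul_mem _ _ (Submodule.starProjection_apply_mem _ _)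
  have hmL : normal L.1 e.1 ∈ Wᗮ := by
    rw [hnL]; exact Submodule.smul_mem _ _ (Submodule.starProjection_apply_mem _ _)
  -- The orthogonal complement of a facet is a line, so two unit normals agree up to sign.
  have hrank : Module.finrank ℝ Wᗮ = 1 := by
    have hie : AffineIndependent ℝ (fun x : e.1 => (x : E d)) :=
      (T.indep K.1 K.2).mono (s := (e.1 : Set (E d))) (t := (K.1 : Set (E d)))
        (by exact_mod_cast hK)
    have h1 : Module.finrank ℝ W = d - 1 := by
      have := hie.finrank_vectorSpan (n := d - 1) (by simp [card_facet]; omega)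
      have hr : Set.range (fun x : e.1 => (x : E d)) = e.1 := Subtype.range_coe
      rwa [hr] at this
    have h2 := W.finrank_add_finrank_orthogonal
    rw [finrank_euclideanSpace_fin, h1] at h2
    omega
  have hne : (⟨normal K.1 e.1, hmK⟩ : Wᗮ) ≠ 0 := by
    intro h
    have := norm_normal hd hK
    rw [show normal K.1 e.1 = 0 from Subtype.ext_iff.1 h] at this
    simp at this
  obtain ⟨c, hc⟩ := (finrank_eq_one_iff_of_nonzero' _ hne).1 hrank ⟨normal L.1 e.1, hmL⟩
  have hc' : c • normal K.1 e.1 = normal L.1 e.1 := Subtype.ext_iff.1 hc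
  have hc1 : |c| = 1 := by
    have := congrArg norm hc'
    rwa [norm_smul, norm_normal hd hK, norm_normal hd hL, mul_one, Real.norm_eq_abs] at this
  rcases (abs_eq zero_le_one).1 hc1 with h1 | h1
  -- If the normals agreed, a short step from the barycentre of `e` against the normal would stay in
  -- both cells. Conformity would put that point in the hull of `e`, but it has left the plane of
  -- `e`.
  · exfalso
    rw [h1, one_smul, hnK, hnL] at hc'
    obtain ⟨δ, hδ, hd1⟩ := exists_bary_sub_smul_height_mem_hull hene a
    obtain ⟨δ', hδ', hd2⟩ := exists_bary_sub_smul_height_mem_hull hene b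
    rw [hea, Finset.insert_erase ha, ← hea] at hd1
    rw [heb, Finset.insert_erase hb, ← heb] at hd2
    set s := min (δ * ‖height a e.1‖) (δ' * ‖height b e.1‖) with hs
    have hs0 : 0 < s := by positivity
    have m1 := hd1 (s * ‖height a e.1‖⁻¹) (by positivity) (by
      rw [← div_eq_mul_inv, div_le_iff₀ hzK]; exact min_le_left _ _)
    have m2 := hd2 (s * ‖height b e.1‖⁻¹) (by positivity) (by
      rw [← div_eq_mul_inv, div_le_iff₀ hzL]; exact min_le_right _ _)
    rw [mul_smul] at m1 m2
    rw [← hc'] at m2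
    have m3 := T.inter K.1 K.2 L.1 L.2 ⟨m1, m2⟩
    rw [inter_eq_of_ne hKL hK hL] at m3
    have i1 := inner_sub_eq_of_mem_hull (fun _ hy => inner_height hy) m3 (z := height a e.1)
      (a := a)
    have i2 := inner_sub_eq_of_mem_hull (fun _ hy => inner_height hy) (bary_mem_hull hene)
      (z := height a e.1) (a := a)
    rw [sub_right_comm, inner_sub_right, i2, inner_smul_right, inner_smul_right,
      real_inner_self_eq_norm_sq] at i1
    have : 0 < s * (‖height a e.1‖⁻¹ * ‖height a e.1‖ ^ 2) := by positivity
    linarith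
  · rw [← hc', h1, neg_one_smul]

open Classical in
/-- An interior facet belongs to exactly two cells, on opposite sides. -/
lemma filter_eq_pair (hd : 1 ≤ d) {K L : T.cells} {e : T.facets} (hKL : K ≠ L) (hK : e.1 ⊆ K.1)
    (hL : e.1 ⊆ L.1) : (Finset.univ.filter fun M : T.cells => e.1 ⊆ M.1) = {K, L} := by
  ext M
  simp only [Finset.mem_filter, Finset.mem_univ, true_and, Finset.mem_insert,
    Finset.mem_singleton]
  constructor
  · intro hM
    by_contra hcon
    push Not at hcon
    -- With a third cell there would be three pairwise opposite unit vectors.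
    have h1 := normal_eq_neg hd hcon.1 hM hK
    have h2 := normal_eq_neg hd hcon.2 hM hL
    have h3 := normal_eq_neg hd hKL hK hL
    have h4 : normal K.1 e.1 = 0 := by
      rw [h2, ← h1] at h3
      simpa using (two_smul ℝ _).trans (eq_neg_iff_add_eq_zero.1 h3)
    have := norm_normal hd hK
    rw [h4] at this
    simp at this
  · rintro (rfl | rfl) <;> assumption

open Classical in
lemma filter_eq_singleton {K : T.cells} {e : T.facets} (he : ¬ T.IsInterior e) (hK : e.1 ⊆ K.1) :
    (Finset.univ.filter fun M : T.cells => e.1 ⊆ M.1) = {K} := by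
  ext M
  simp only [Finset.mem_filter, Finset.mem_univ, true_and, Finset.mem_singleton]
  constructor
  · intro hM
    by_contra hcon
    exact he ⟨M, K, hcon, hM, hK⟩
  · rintro rfl; assumption

/-- Distinct facets overlap in a null set. -/
lemma facetMeasure_hull_eq_zero {e e' : T.facets} (h : e ≠ e') :
    facetMeasure e.1 (hull e'.1) = 0 := by
  classical
  obtain ⟨K, hK⟩ := exists_cell e
  obtain ⟨L, hL⟩ := exists_cell e'
  -- Conformity handles the passage between the two cells, affine independence the intersection of
  -- faces inside one cell. What remains is the hull of at most `d - 1` points.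
  have hsub : hull e.1 ∩ hull e'.1 ⊆ hull (e.1 ∩ e'.1) := by
    rintro x ⟨hx, hx'⟩
    have h1 := T.inter K.1 K.2 L.1 L.2 ⟨hull_mono hK hx, hull_mono hL hx'⟩
    rw [← Finset.coe_inter] at h1
    have h2 : x ∈ hull (e.1 ∩ L.1) := by
      have h3 := (T.indep K.1 K.2).convexHull_inter (t₁ := e.1) (t₂ := K.1 ∩ L.1) hK
        Finset.inter_subset_left
      have h4 : (e.1 : Set (E d)) ∩ (K.1 ∩ L.1 : Finset (E d)) = (e.1 ∩ L.1 : Finset (E d)) := by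
        rw [← Finset.coe_inter, ← Finset.inter_assoc, Finset.inter_eq_left.2 hK]
      rw [h4] at h3
      rw [hull, h3]; exact ⟨hx, h1⟩
    have h3 := (T.indep L.1 L.2).convexHull_inter (t₁ := e.1 ∩ L.1) (t₂ := e'.1)
      Finset.inter_subset_right hL
    have h4 : ((e.1 ∩ L.1 : Finset (E d)) : Set (E d)) ∩ e'.1 = (e.1 ∩ e'.1 : Finset (E d)) := by
      rw [← Finset.coe_inter, Finset.inter_assoc, Finset.inter_eq_right.2 hL]
    rw [h4] at h3
    rw [hull, h3]; exact ⟨h2, hx'⟩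
  rw [facetMeasure, Measure.restrict_apply (measurableSet_hull _), Set.inter_comm]
  refine measure_mono_null hsub (euclideanHausdorffMeasure_convexHull ?_)
  have hlt : (e.1 ∩ e'.1).card < e.1.card := by
    refine Finset.card_lt_card (Finset.ssubset_iff_subset_ne.2 ⟨Finset.inter_subset_left, ?_⟩)
    intro heq
    apply h
    have hs : e.1 ⊆ e'.1 := Finset.inter_eq_left.1 heq
    exact Subtype.ext (Finset.eq_of_subset_of_card_le hs (by rw [card_facet, card_facet]))
  rw [card_facet] at hlt
  omega

/-- Distinct cells overlap in a null set. -/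
lemma volume_hull_inter_hull {K L : T.cells} (h : K ≠ L) : volume (hull K.1 ∩ hull L.1) = 0 := by
  classical
  refine measure_mono_null (T.inter K.1 K.2 L.1 L.2) ?_
  rw [← EuclideanSpace.euclideanHausdorffMeasure_eq_volume, ← Finset.coe_inter]
  refine euclideanHausdorffMeasure_convexHull ?_
  have hlt : (K.1 ∩ L.1).card < K.1.card := by
    refine Finset.card_lt_card (Finset.ssubset_iff_subset_ne.2 ⟨Finset.inter_subset_left, ?_⟩)
    intro heq
    apply h
    have hs : K.1 ⊆ L.1 := Finset.inter_eq_left.1 heq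
    exact Subtype.ext (Finset.eq_of_subset_of_card_le hs
      (by rw [T.card_eq K.1 K.2, T.card_eq L.1 L.2]))
  rw [T.card_eq K.1 K.2] at hlt
  omega

lemma interior_hull_nonempty (K : T.cells) : (interior (hull K.1)).Nonempty := by
  rw [(convex_hull K.1).interior_nonempty_iff_affineSpan_eq_top, hull, affineSpan_convexHull]
  have := (T.indep K.1 K.2).affineSpan_eq_top_iff_card_eq_finrank_add_one.2
    (by simp [T.card_eq K.1 K.2])
  simpa using this

lemma hull_subset_closure (K : T.cells) : hull K.1 ⊆ closure Ω := by
  rw [← T.cover]; exact Set.subset_biUnion_of_mem (u := fun K => hull K) K.2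

/-- The condition on `Ω` excludes slits and removed points, so that an open set inside the closure
lies in `Ω` itself. -/
lemma interior_hull_subset (hreg : interior (closure Ω) = Ω) (K : T.cells) :
    interior (hull K.1) ⊆ Ω :=
  (interior_mono (hull_subset_closure K)).trans hreg.subset

/-- Up to a null set, the cells are contained in `Ω`. -/
lemma ae_mem_of_mem_hull (hreg : interior (closure Ω) = Ω) (K : T.cells) :
    ∀ᵐ x ∂volume.restrict (hull K.1), x ∈ Ω := by
  rw [ae_restrict_iff' (measurableSet_hull _)]
  -- The boundary of a convex set is null, and interior points of a cell lie in `Ω`.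
  have h0 : volume (frontier (hull K.1)) = 0 := (convex_hull K.1).addHaar_frontier volume
  filter_upwards [compl_mem_ae_iff.2 h0] with x hx hxK
  refine interior_hull_subset hreg K ?_
  by_contra hcon
  exact hx ⟨subset_closure hxK, hcon⟩

lemma isBounded_domain (T : Triangulation Ω) : Bornology.IsBounded Ω := by
  refine Bornology.IsBounded.subset ?_ subset_closure
  rw [← T.cover]
  exact (Bornology.isBounded_biUnion T.cells.finite_toSet).2
    fun K _ => (isCompact_hull K).isBounded

end Triangulation

/-! ### H¹₀: weak gradients and the Poincaré inequality -/

section Sobolev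

variable {d : ℕ} {Ω : Set (E d)}

/-- Continuity of the L² inner product. -/
lemma tendsto_integral_mul_of_tendsto_eLpNorm {α : Type*} [MeasurableSpace α] {μ : Measure α}
    {f h : ℕ → α → ℝ} {f₀ h₀ : α → ℝ} (hf : ∀ n, MemLp (f n) 2 μ) (hh : ∀ n, MemLp (h n) 2 μ)
    (hf₀ : MemLp f₀ 2 μ) (hh₀ : MemLp h₀ 2 μ)
    (hft : Tendsto (fun n => eLpNorm (fun x => f n x - f₀ x) 2 μ) atTop (𝓝 0))
    (hht : Tendsto (fun n => eLpNorm (fun x => h n x - h₀ x) 2 μ) atTop (𝓝 0)) :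
    Tendsto (fun n => ∫ x, f n x * h n x ∂μ) atTop (𝓝 (∫ x, f₀ x * h₀ x ∂μ)) := by
  have h1 : Tendsto (fun n => (hf n).toLp (f n)) atTop (𝓝 (hf₀.toLp f₀)) :=
    (Lp.tendsto_Lp_iff_tendsto_eLpNorm'' _ hf _ hf₀).2 hft
  have h2 : Tendsto (fun n => (hh n).toLp (h n)) atTop (𝓝 (hh₀.toLp h₀)) :=
    (Lp.tendsto_Lp_iff_tendsto_eLpNorm'' _ hh _ hh₀).2 hht
  have key : ∀ {a b : α → ℝ} (ha : MemLp a 2 μ) (hb : MemLp b 2 μ),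
      inner ℝ (ha.toLp a) (hb.toLp b) = ∫ x, a x * b x ∂μ := by
    intro a b ha hb
    rw [L2.inner_def]
    refine integral_congr_ae ?_
    filter_upwards [ha.coeFn_toLp, hb.coeFn_toLp] with x hx hy
    rw [hx, hy]
    simp [mul_comm]
  simpa only [key] using h1.inner (𝕜 := ℝ) h2

lemma memLp_restrict_of_continuous (hΩb : Bornology.IsBounded Ω) {F : E d → ℝ}
    (hF : Continuous F) : MemLp F 2 (volume.restrict Ω) := by
  have h : IsCompact (closure Ω) := hΩb.isCompact_closure
  have h1 : MemLp F 2 (volume.restrict (closure Ω)) :=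
    (memLp_two_iff_integrable_sq hF.aestronglyMeasurable).2
      ((hF.pow 2).continuousOn.integrableOn_compact h)
  exact h1.mono_measure (Measure.restrict_mono subset_closure le_rfl)

lemma gradient_apply (f : E d → ℝ) (x : E d) (i : Fin d) :
    gradient f x i = fderiv ℝ f x (EuclideanSpace.single i 1) := by
  have : inner ℝ (gradient f x) (EuclideanSpace.single i (1 : ℝ)) = gradient f x i := by
    rw [EuclideanSpace.inner_single_right]
    simp
  rw [← this, gradient, InnerProductSpace.toDual_symm_apply]

lemma MemLp.apply_two {g : E d → E d} {μ : Measure (E d)} (hg : MemLp g 2 μ) (i : Fin d) :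
    MemLp (fun x => g x i) 2 μ :=
  hg.mono ((EuclideanSpace.proj i : E d →L[ℝ] ℝ).continuous.comp_aestronglyMeasurable hg.1)
    (Eventually.of_forall fun x => PiLp.norm_apply_le (g x) i)

/-- Integration by parts against a compactly supported function. -/
lemma integral_mul_fderiv_eq_neg {φ r : E d → ℝ} (hφ : ContDiff ℝ ∞ φ)
    (hs : HasCompactSupport φ) (hr : ContDiff ℝ ∞ r) (v : E d) :
    ∫ x, φ x * fderiv ℝ r x v = -∫ x, fderiv ℝ φ x v * r x := by
  have hφ' : Continuous fun x => fderiv ℝ φ x v :=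
    (hφ.continuous_fderiv (by simp)).clm_apply continuous_const
  have hr' : Continuous fun x => fderiv ℝ r x v :=
    (hr.continuous_fderiv (by simp)).clm_apply continuous_const
  have hs' : HasCompactSupport fun x => fderiv ℝ φ x v := hs.fderiv_apply (𝕜 := ℝ) v
  refine integral_mul_fderiv_eq_neg_fderiv_mul_of_integrable
    ((hφ'.mul hr.continuous).integrable_of_hasCompactSupport hs'.mul_right)
    ((hφ.continuous.mul hr').integrable_of_hasCompactSupport hs.mul_right)
    ((hφ.continuous.mul hr.continuous).integrable_of_hasCompactSupport hs.mul_right)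
    (fun x _ => (hφ.differentiable (by simp)) x) (fun x _ => (hr.differentiable (by simp)) x)

/-- Integration by parts of φ against ∂_i(x_i φ) gives ∫φ² = −2∫ x_i φ ∂_iφ. Young's inequality with
|x_i| ≤ R then absorbs half of the left side. -/
lemma poincare_of_hasCompactSupport {φ : E d → ℝ} (hφ : ContDiff ℝ ∞ φ)
    (hs : HasCompactSupport φ) {R : ℝ} (hR : ∀ x, φ x ≠ 0 → ‖x‖ ≤ R) (i : Fin d) :
    ∫ x, φ x * φ x ≤ 4 * R ^ 2 *
      ∫ x, fderiv ℝ φ x (EuclideanSpace.single i 1) * fderiv ℝ φ x (EuclideanSpace.single i 1) := by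
  set v : E d := EuclideanSpace.single i 1
  have hx : ContDiff ℝ ∞ (fun x : E d => x i) := by fun_prop
  have hφ' : Continuous fun x => fderiv ℝ φ x v :=
    (hφ.continuous_fderiv (by simp)).clm_apply continuous_const
  have hs' : HasCompactSupport fun x => fderiv ℝ φ x v := hs.fderiv_apply (𝕜 := ℝ) v
  have hder : ∀ x, fderiv ℝ (fun x : E d => x i * φ x) x v = x i * fderiv ℝ φ x v + φ x := by
    intro x
    have h1 : HasFDerivAt (fun x : E d => x i) (EuclideanSpace.proj i : E d →L[ℝ] ℝ) x :=
      (EuclideanSpace.proj i : E d →L[ℝ] ℝ).hasFDerivAt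
    rw [(h1.fun_mul (hφ.differentiable (by simp) x).hasFDerivAt).fderiv]
    simp [v]
  have hibp := integral_mul_fderiv_eq_neg hφ hs (hx.mul hφ) v
  simp only [hder] at hibp
  have hci : Continuous fun x : E d => x i := hx.continuous
  have i1 : Integrable (fun x => φ x * (x i * fderiv ℝ φ x v)) :=
    (hφ.continuous.mul (hci.mul hφ')).integrable_of_hasCompactSupport hs.mul_right
  have i2 : Integrable (fun x => φ x * φ x) :=
    (hφ.continuous.mul hφ.continuous).integrable_of_hasCompactSupport hs.mul_right
  have i3 : Integrable (fun x => fderiv ℝ φ x v * fderiv ℝ φ x v) :=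
    (hφ'.mul hφ').integrable_of_hasCompactSupport hs'.mul_right
  have e1 : ∫ x, φ x * (x i * fderiv ℝ φ x v + φ x) =
      (∫ x, φ x * (x i * fderiv ℝ φ x v)) + ∫ x, φ x * φ x := by
    rw [← integral_add i1 i2]; congr 1; ext x; ring
  have e2 : ∫ x, fderiv ℝ φ x v * (x i * φ x) = ∫ x, φ x * (x i * fderiv ℝ φ x v) := by
    congr 1; ext x; ring
  rw [e1, e2] at hibp
  have hle : ∫ x, -2 * (φ x * (x i * fderiv ℝ φ x v)) ≤
      ∫ x, ((1 / 2) * (φ x * φ x) + 2 * R ^ 2 * (fderiv ℝ φ x v * fderiv ℝ φ x v)) := by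
    refine integral_mono (i1.const_mul _) ((i2.const_mul _).add (i3.const_mul _)) fun x => ?_
    by_cases h0 : φ x = 0
    · simp only [h0]
      nlinarith [mul_nonneg (sq_nonneg R) (mul_self_nonneg (fderiv ℝ φ x v))]
    · have h1 : |x i| ≤ R := (PiLp.norm_apply_le x i).trans (hR x h0)
      have h2 : (x i) ^ 2 ≤ R ^ 2 := by
        rw [← sq_abs]; exact pow_le_pow_left₀ (abs_nonneg _) h1 2
      nlinarith [sq_nonneg (φ x + 2 * (x i * fderiv ℝ φ x v)),
        mul_nonneg (sub_nonneg.2 h2) (mul_self_nonneg (fderiv ℝ φ x v))]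
  rw [integral_const_mul, integral_add (i2.const_mul _) (i3.const_mul _), integral_const_mul,
    integral_const_mul] at hle
  linarith

lemma setIntegral_eq_integral_of_tsupport_subset {φ F : E d → ℝ} (h : tsupport φ ⊆ Ω)
    (hF : ∀ x, φ x = 0 → F x = 0) : ∫ x in Ω, F x = ∫ x, F x :=
  setIntegral_eq_integral_of_forall_compl_eq_zero fun x hx =>
    hF x (by by_contra h0; exact hx (h (subset_tsupport _ h0)))

/-- The weak gradient of a function in `H¹₀`, integration by parts and the Poincaré inequality. -/
lemma MemH10.exists_weakGradient (hd : 1 ≤ d) {R : ℝ} (hR : ∀ x ∈ Ω, ‖x‖ ≤ R)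
    {u : E d → ℝ} (hu : MemH10 Ω u) :
    ∃ g : E d → E d, MemLp g 2 (volume.restrict Ω) ∧
      (∀ r : E d → ℝ, ContDiff ℝ ∞ r → ∀ i, ∫ x in Ω, g x i * r x =
        -∫ x in Ω, u x * fderiv ℝ r x (EuclideanSpace.single i 1)) ∧
      ∫ x in Ω, u x * u x ≤ 4 * R ^ 2 * ∑ i, ∫ x in Ω, g x i * g x i := by
  have hΩb : Bornology.IsBounded Ω := isBounded_iff_forall_norm_le.2 ⟨R, hR⟩
  obtain ⟨hu2, g, hg, φ, hφ, hφu, hφg⟩ := hu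
  have hφc : ∀ n, Continuous (φ n) := fun n => (hφ n).1.continuous
  have hφ'c : ∀ n (v : E d), Continuous fun x => fderiv ℝ (φ n) x v := fun n v =>
    ((hφ n).1.continuous_fderiv (by simp)).clm_apply continuous_const
  have hgrad : ∀ i, Tendsto (fun n => eLpNorm (fun x =>
      fderiv ℝ (φ n) x (EuclideanSpace.single i 1) - g x i) 2 (volume.restrict Ω))
      atTop (𝓝 0) := by
    intro i
    refine tendsto_of_tendsto_of_tendsto_of_le_of_le tendsto_const_nhds hφg
      (fun _ => bot_le) fun n => eLpNorm_mono fun x => ?_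
    rw [← gradient_apply, ← PiLp.sub_apply]
    exact PiLp.norm_apply_le _ i
  have hmφ : ∀ n, MemLp (φ n) 2 (volume.restrict Ω) := fun n =>
    memLp_restrict_of_continuous hΩb (hφc n)
  have hmφ' : ∀ (i : Fin d) n, MemLp (fun x => fderiv ℝ (φ n) x (EuclideanSpace.single i 1)) 2
      (volume.restrict Ω) := fun i n => memLp_restrict_of_continuous hΩb (hφ'c n _)
  have hmg := fun i : Fin d => MemLp.apply_two hg i
  have hsupp' : ∀ n (v : E d), tsupport (fun x => fderiv ℝ (φ n) x v) ⊆ Ω := fun n v =>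
    (tsupport_fderiv_apply_subset ℝ v).trans (hφ n).2.2
  refine ⟨g, hg, fun r hr i => ?_, ?_⟩
  · have hmr := memLp_restrict_of_continuous hΩb hr.continuous
    have hmr' := memLp_restrict_of_continuous hΩb
      ((hr.continuous_fderiv (by simp)).clm_apply
        (continuous_const (y := (EuclideanSpace.single i 1 : E d))))
    have hc : ∀ f : E d → ℝ, Tendsto (fun _ : ℕ => eLpNorm (fun x => f x - f x) 2
        (volume.restrict Ω)) atTop (𝓝 0) := fun f => by simp
    have t1 := tendsto_integral_mul_of_tendsto_eLpNorm (hmφ' i) (fun _ => hmr) (hmg i) hmr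
      (hgrad i) (hc r)
    have t2 := tendsto_integral_mul_of_tendsto_eLpNorm hmφ (fun _ => hmr') hu2 hmr' hφu (hc _)
    -- The formula holds for each approximant, even though `r` need not vanish on the boundary,
    -- because the approximants have compact support in `Ω`. Both sides pass to the L² limit.
    refine tendsto_nhds_unique (t1.congr fun n => ?_) t2.neg
    rw [setIntegral_eq_integral_of_tsupport_subset (hsupp' n _) (fun x hx => by rw [hx, zero_mul]),
      setIntegral_eq_integral_of_tsupport_subset (hφ n).2.2 (fun x hx => by rw [hx, zero_mul]),
      integral_mul_fderiv_eq_neg (hφ n).1 (hφ n).2.1 hr, neg_neg]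
  · have t1 := tendsto_integral_mul_of_tendsto_eLpNorm hmφ hmφ hu2 hu2 hφu hφu
    have t2 := fun i => tendsto_integral_mul_of_tendsto_eLpNorm (hmφ' i) (hmφ' i) (hmg i) (hmg i)
      (hgrad i) (hgrad i)
    have t3 := (tendsto_finsetSum Finset.univ fun i _ => t2 i).const_mul (4 * R ^ 2)
    refine le_of_tendsto_of_tendsto' t1 t3 fun n => ?_
    rw [setIntegral_eq_integral_of_tsupport_subset (hφ n).2.2 (fun x hx => by rw [hx, zero_mul])]
    -- One coordinate direction suffices; it exists because `d ≥ 1`.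
    have hp := poincare_of_hasCompactSupport (hφ n).1 (hφ n).2.1 (R := R)
      (fun x hx => hR x ((hφ n).2.2 (subset_tsupport _ hx))) ⟨0, hd⟩
    refine hp.trans (mul_le_mul_of_nonneg_left ?_ (by positivity))
    rw [← setIntegral_eq_integral_of_tsupport_subset (hsupp' n _)
      (fun x hx => by rw [hx, zero_mul])]
    exact Finset.single_le_sum (f := fun i => ∫ x in Ω,
      fderiv ℝ (φ n) x (EuclideanSpace.single i 1) * fderiv ℝ (φ n) x (EuclideanSpace.single i 1))
      (fun i _ => integral_nonneg fun x => mul_self_nonneg _) (Finset.mem_univ (⟨0, hd⟩ : Fin d))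

lemma memH10_zero : MemH10 Ω (fun _ => (0 : ℝ)) := by
  refine ⟨MemLp.zero, fun _ => 0, MemLp.zero, fun _ _ => 0,
    fun n => ⟨contDiff_const, HasCompactSupport.zero, by simp [tsupport]⟩, by simp, ?_⟩
  have : gradient (fun _ : E d => (0 : ℝ)) = fun _ => 0 := by
    ext x; simp [gradient]
  simp [this]

lemma MemH10.add {u v : E d → ℝ} (hu : MemH10 Ω u) (hv : MemH10 Ω v) :
    MemH10 Ω (fun x => u x + v x) := by
  obtain ⟨hu2, g, hg, φ, hφ, hφu, hφg⟩ := hu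
  obtain ⟨hv2, g', hg', φ', hφ', hφu', hφg'⟩ := hv
  have hm : ∀ (φ : E d → ℝ), ContDiff ℝ ∞ φ → Continuous (gradient φ) := fun φ h =>
    (LinearIsometryEquiv.continuous _).comp (h.continuous_fderiv (by simp))
  refine ⟨hu2.add hv2, fun x => g x + g' x, hg.add hg', fun n x => φ n x + φ' n x,
    fun n => ⟨(hφ n).1.add (hφ' n).1, (hφ n).2.1.add (hφ' n).2.1,
      (tsupport_add _ _).trans (Set.union_subset (hφ n).2.2 (hφ' n).2.2)⟩, ?_, ?_⟩
  · refine tendsto_of_tendsto_of_tendsto_of_le_of_le tendsto_const_nhds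
      (by simpa using hφu.add hφu') (fun _ => bot_le) fun n => ?_
    have : (fun x => φ n x + φ' n x - (u x + v x)) =
      (fun x => φ n x - u x) + fun x => φ' n x - v x := by ext x; simp; ring
    rw [this]
    exact eLpNorm_add_le ((hφ n).1.continuous.aestronglyMeasurable.sub hu2.1)
      ((hφ' n).1.continuous.aestronglyMeasurable.sub hv2.1) (by norm_num)
  · refine tendsto_of_tendsto_of_tendsto_of_le_of_le tendsto_const_nhds
      (by simpa using hφg.add hφg') (fun _ => bot_le) fun n => ?_
    have : (fun x => gradient (fun x => φ n x + φ' n x) x - (g x + g' x)) =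
        (fun x => gradient (φ n) x - g x) + fun x => gradient (φ' n) x - g' x := by
      ext1 x
      have h1 : gradient (fun x => φ n x + φ' n x) x = gradient (φ n) x + gradient (φ' n) x := by
        rw [gradient, fderiv_fun_add ((hφ n).1.differentiable (by simp) x)
          ((hφ' n).1.differentiable (by simp) x), map_add]
        rfl
      rw [h1, Pi.add_apply]; abel
    rw [this]
    exact eLpNorm_add_le ((hm _ (hφ n).1).aestronglyMeasurable.sub hg.1)
      ((hm _ (hφ' n).1).aestronglyMeasurable.sub hg'.1) (by norm_num)

lemma MemH10.const_mul {u : E d → ℝ} (hu : MemH10 Ω u) (c : ℝ) :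
    MemH10 Ω (fun x => c * u x) := by
  obtain ⟨hu2, g, hg, φ, hφ, hφu, hφg⟩ := hu
  refine ⟨hu2.const_mul c, fun x => c • g x, hg.const_smul c, fun n x => c * φ n x,
    fun n => ⟨contDiff_const.mul (hφ n).1, (hφ n).2.1.mul_left,
      (tsupport_mul_subset_right).trans (hφ n).2.2⟩, ?_, ?_⟩
  · have h : ∀ n, eLpNorm (fun x => c * φ n x - c * u x) 2 (volume.restrict Ω) =
        ‖c‖ₑ * eLpNorm (fun x => φ n x - u x) 2 (volume.restrict Ω) := fun n => by
      rw [← eLpNorm_const_smul]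
      congr 1; ext x; simp [mul_sub]
    simp only [h]
    simpa using ENNReal.Tendsto.const_mul hφu (Or.inr (by simp))
  · have h : ∀ n, eLpNorm (fun x => gradient (fun x => c * φ n x) x - c • g x) 2
        (volume.restrict Ω) =
        ‖c‖ₑ * eLpNorm (fun x => gradient (φ n) x - g x) 2 (volume.restrict Ω) := fun n => by
      rw [← eLpNorm_const_smul]
      congr 1; ext1 x
      have h1 : gradient (fun x => c * φ n x) x = c • gradient (φ n) x := by
        rw [gradient, fderiv_const_mul ((hφ n).1.differentiable (by simp) x), map_smulₛₗ]
        rfl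
      rw [h1, ← smul_sub]; rfl
    simp only [h]
    simpa using ENNReal.Tendsto.const_mul hφg (Or.inr (by simp))

end Sobolev

/-- Stone–Weierstrass: the coordinates separate points. It carries the vanishing of jumps from
polynomial to continuous test functions. -/
lemma exists_ev_approx {d : ℕ} {s : Set (E d)} (hs : IsCompact s) {F : E d → ℝ}
    (hF : Continuous F) {ε : ℝ} (hε : 0 < ε) : ∃ p : Poly d, ∀ x ∈ s, |ev p x - F x| < ε := by
  have : CompactSpace s := isCompact_iff_compactSpace.1 hs
  let A : Poly d →ₐ[ℝ] C(s, ℝ) := MvPolynomial.aeval fun i => ⟨fun x => x.1 i, by fun_prop⟩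
  have hA : ∀ p x, A p x = ev p x.1 := by
    intro p x
    induction p using MvPolynomial.induction_on with
    | C a => simp [A]
    | add p q hp hq => simp [hp, hq]
    | mul_X p i hp => simp only [map_mul, ContinuousMap.mul_apply, hp, ev_mul, ev_X]; simp [A]
  have hsep : A.range.SeparatesPoints := by
    intro x y hxy
    obtain ⟨i, hi⟩ : ∃ i, x.1 i ≠ y.1 i := by
      by_contra hcon
      push Not at hcon
      exact hxy (Subtype.ext (PiLp.ext hcon))
    exact ⟨A (MvPolynomial.X i), ⟨A (MvPolynomial.X i), ⟨_, rfl⟩, rfl⟩, by simpa [hA] using hi⟩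
  obtain ⟨⟨_, p, rfl⟩, hg⟩ := ContinuousMap.exists_mem_subalgebra_near_continuous_of_separatesPoints
    A.range hsep (fun x : s => F x.1) (by fun_prop) ε hε
  refine ⟨p, fun x hx => ?_⟩
  have := hg ⟨x, hx⟩
  rw [← hA p ⟨x, hx⟩]
  exact this

lemma integrable_mul_of_memLp {α : Type*} [MeasurableSpace α] {μ : Measure α} {f g : α → ℝ}
    (hf : MemLp f 2 μ) (hg : MemLp g 2 μ) : Integrable (fun x => f x * g x) μ :=
  hf.integrable_mul hg

/-! ### Conforming piecewise polynomials have no jumps -/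

namespace Triangulation

variable {d : ℕ} {Ω : Set (E d)} {T : Triangulation Ω}

lemma memLp_facet (hd : 1 ≤ d) (e : T.facets) {F : E d → ℝ} (hF : Continuous F) :
    MemLp F 2 (facetMeasure e.1) := by
  have := isFiniteMeasure_facet hd e
  obtain ⟨M, hM⟩ := (isCompact_hull e.1).exists_bound_of_continuousOn hF.continuousOn
  refine MemLp.of_bound hF.aestronglyMeasurable M ?_
  filter_upwards [ae_restrict_mem (measurableSet_hull e.1)] with x hx using hM x hx

lemma integrable_facet (hd : 1 ≤ d) (e : T.facets) {F : E d → ℝ} (hF : Continuous F) :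
    Integrable F (facetMeasure e.1) := by
  have := isFiniteMeasure_facet hd e
  exact (memLp_facet hd e hF).integrable (by norm_num)

/-- The values of several cells add up only on overlaps, which are null. -/
lemma toFun_ae_eq (v : T.Scal) (K : T.cells) :
    toFun v =ᵐ[volume.restrict (hull K.1)] ev (v K) := by
  classical
  have h : ∀ L : T.cells, L ≠ K → ∀ᵐ x ∂volume.restrict (hull K.1), x ∉ hull L.1 := by
    intro L hL
    have h0 : volume.restrict (hull K.1) (hull L.1) = 0 := by
      rw [Measure.restrict_apply (measurableSet_hull _)]
      exact volume_hull_inter_hull hL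
    exact compl_mem_ae_iff.2 h0
  have h' : ∀ᵐ x ∂volume.restrict (hull K.1), ∀ L : T.cells, L ≠ K → x ∉ hull L.1 := by
    rw [ae_all_iff]
    intro L
    by_cases hL : L = K
    · simp [hL]
    · filter_upwards [h L hL] with x hx _ using hx
  filter_upwards [h', ae_restrict_mem (measurableSet_hull K.1)] with x hx hxK
  rw [toFun, Finset.sum_eq_single K]
  · rw [Set.indicator_of_mem hxK]
  · intro L _ hL
    rw [Set.indicator_of_notMem (hx L hL)]
  · simp

lemma restrict_domain_eq (T : Triangulation Ω) (hreg : interior (closure Ω) = Ω) :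
    volume.restrict Ω = volume.restrict (⋃ K : T.cells, hull K.1) := by
  have hU : (⋃ K : T.cells, hull K.1) = closure Ω := by
    rw [← T.cover, Set.iUnion_subtype]
  have hopen : IsOpen Ω := hreg ▸ isOpen_interior
  refine Measure.restrict_congr_set ?_
  refine (LE.le.eventuallyLE (hU ▸ subset_closure)).antisymm ?_
  have h : ∀ᵐ x, ∀ K : T.cells, x ∈ hull K.1 → x ∈ Ω := by
    rw [ae_all_iff]
    intro K
    rw [← ae_restrict_iff' (measurableSet_hull _)]
    exact ae_mem_of_mem_hull hreg K
  filter_upwards [h] with x hx hxU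
  obtain ⟨K, hK⟩ := Set.mem_iUnion.1 hxU
  exact hx K hK

lemma restrict_hull_le (hreg : interior (closure Ω) = Ω) (K : T.cells) :
    volume.restrict (hull K.1) ≤ volume.restrict Ω := by
  rw [restrict_domain_eq T hreg]
  exact Measure.restrict_mono (Set.subset_iUnion (fun K : T.cells => hull K.1) K) le_rfl

lemma integral_domain_eq_sum (T : Triangulation Ω) (hreg : interior (closure Ω) = Ω)
    {F : E d → ℝ} (hF : IntegrableOn F Ω) :
    ∫ x in Ω, F x = ∑ K : T.cells, ∫ x in hull K.1, F x := by
  rw [IntegrableOn, restrict_domain_eq T hreg] at hF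
  have hm : ∀ K : T.cells, NullMeasurableSet (hull K.1) :=
    fun K => (measurableSet_hull K.1).nullMeasurableSet
  have hdis : Pairwise fun K L : T.cells => AEDisjoint volume (hull K.1) (hull L.1) :=
    fun K L h => volume_hull_inter_hull h
  rw [restrict_domain_eq T hreg, integral_iUnion_ae hm hdis hF, tsum_fintype]

/-- On each cell, the weak gradient of a conforming piecewise polynomial is the classical one. -/
lemma weakGradient_ae_eq (hreg : interior (closure Ω) = Ω) {v : T.Scal} {g : E d → E d}
    (hg : MemLp g 2 (volume.restrict Ω))
    (hibp : ∀ r : E d → ℝ, ContDiff ℝ ∞ r → ∀ i, ∫ x in Ω, g x i * r x =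
        -∫ x in Ω, toFun v x * fderiv ℝ r x (EuclideanSpace.single i 1)) (K : T.cells) (i : Fin d) :
    (fun x => g x i) =ᵐ[volume.restrict (hull K.1)] ev (MvPolynomial.pderiv i (v K)) := by
  set U := interior (hull K.1) with hU
  have hUΩ : U ⊆ Ω := interior_hull_subset hreg K
  have hfin : IsFiniteMeasure (volume.restrict Ω) :=
    ⟨by simpa using T.isBounded_domain.measure_lt_top⟩
  have hgi : Integrable (fun x => g x i) (volume.restrict Ω) :=
    (MemLp.apply_two hg i).integrable (by norm_num)
  have hgU : IntegrableOn (fun x => g x i) U := hgi.mono_measure (Measure.restrict_mono hUΩ le_rfl)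
  have hpU : IntegrableOn (ev (MvPolynomial.pderiv i (v K))) U :=
    (Continuous.integrableOn_hull (continuous_ev _) K.1).mono_set interior_subset
  -- Test functions supported inside one cell see only its polynomial, so weak and classical
  -- derivatives have the same integrals against them. The fundamental lemma of the calculus of
  -- variations concludes.
  have key : ∀ᵐ x, x ∈ U → g x i - ev (MvPolynomial.pderiv i (v K)) x = 0 := by
    refine isOpen_interior.ae_eq_zero_of_integral_contDiff_smul_eq_zero
      (hgU.sub hpU).locallyIntegrableOn fun ψ hψ hψs hψU => ?_
    set w : E d := EuclideanSpace.single i 1 with hw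
    have hψ0 : ∀ x, x ∉ U → ψ x = 0 := fun x hx => by
      by_contra h0; exact hx (hψU (subset_tsupport _ h0))
    have hψ'0 : ∀ x, x ∉ U → fderiv ℝ ψ x w = 0 := fun x hx => by
      by_contra h0
      exact hx (hψU (tsupport_fderiv_apply_subset ℝ w (subset_tsupport _ h0)))
    obtain ⟨M, hM⟩ := hψs.exists_bound_of_continuous hψ.continuous
    have i1 : IntegrableOn (fun x => ψ x * g x i) U :=
      hgU.bdd_mul hψ.continuous.aestronglyMeasurable (Eventually.of_forall hM)
    have i2 : IntegrableOn (fun x => ψ x * ev (MvPolynomial.pderiv i (v K)) x) U :=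
      (Continuous.integrableOn_hull (hψ.continuous.mul (continuous_ev _)) K.1).mono_set
        interior_subset
    have e1 : ∫ x, ψ x • (g x i - ev (MvPolynomial.pderiv i (v K)) x) =
        ∫ x in U, ψ x • (g x i - ev (MvPolynomial.pderiv i (v K)) x) :=
      (setIntegral_eq_integral_of_forall_compl_eq_zero
        fun x hx => by rw [hψ0 x hx, zero_smul]).symm
    have e2 : ∫ x in U, ψ x • (g x i - ev (MvPolynomial.pderiv i (v K)) x) =
        (∫ x in U, ψ x * g x i) - ∫ x in U, ψ x * ev (MvPolynomial.pderiv i (v K)) x := by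
      rw [← integral_sub i1 i2]
      simp only [smul_eq_mul, mul_sub]
    have e3 : ∫ x in U, ψ x * g x i = ∫ x in Ω, g x i * ψ x := by
      rw [setIntegral_eq_integral_of_forall_compl_eq_zero
          fun x hx => by rw [hψ0 x hx, zero_mul],
        setIntegral_eq_integral_of_forall_compl_eq_zero
          fun x hx => by rw [hψ0 x fun h => hx (hUΩ h), mul_zero]]
      simp only [mul_comm]
    have e4 : ∫ x in Ω, toFun v x * fderiv ℝ ψ x w = ∫ x in U, toFun v x * fderiv ℝ ψ x w := by
      rw [setIntegral_eq_integral_of_forall_compl_eq_zero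
          fun x hx => by rw [hψ'0 x fun h => hx (hUΩ h), mul_zero],
        setIntegral_eq_integral_of_forall_compl_eq_zero
          fun x hx => by rw [hψ'0 x hx, mul_zero]]
    have e5 : ∫ x in U, toFun v x * fderiv ℝ ψ x w = ∫ x in U, ev (v K) x * fderiv ℝ ψ x w := by
      refine integral_congr_ae ?_
      filter_upwards [ae_restrict_of_ae_restrict_of_subset interior_subset (toFun_ae_eq v K)]
        with x hx
      rw [hx]
    have e6 : ∫ x in U, ev (v K) x * fderiv ℝ ψ x w =
        -∫ x in U, ψ x * ev (MvPolynomial.pderiv i (v K)) x := by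
      rw [setIntegral_eq_integral_of_forall_compl_eq_zero
          fun x hx => by rw [hψ'0 x hx, mul_zero],
        setIntegral_eq_integral_of_forall_compl_eq_zero
          fun x hx => by rw [hψ0 x hx, zero_mul]]
      have := integral_mul_fderiv_eq_neg hψ hψs (contDiff_ev (v K)) w
      have hfd : ∀ x, fderiv ℝ (ev (v K)) x w = ev (MvPolynomial.pderiv i (v K)) x := by
        intro x
        rw [fderiv_ev, hw, Finset.sum_eq_single i]
        · simp
        · intro j _ hj; simp [hj]
        · simp
      simp only [hfd] at this
      rw [this, neg_neg]
      simp only [mul_comm]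
    rw [e1, e2, e3, hibp ψ hψ i, e4, e5, e6, neg_neg, sub_self]
  have h0 : volume (frontier (hull K.1)) = 0 := (convex_hull K.1).addHaar_frontier volume
  rw [EventuallyEq, ae_restrict_iff' (measurableSet_hull _)]
  filter_upwards [key, compl_mem_ae_iff.2 h0] with x hx hxf hxK
  refine sub_eq_zero.1 (hx ?_)
  by_contra hcon
  exact hxf ⟨subset_closure hxK, hcon⟩

lemma inS_self_le_of_memH10 (hd : 1 ≤ d) (hreg : interior (closure Ω) = Ω) {R : ℝ}
    (hR : ∀ x ∈ Ω, ‖x‖ ≤ R) {v : T.Scal} (hv : MemH10 Ω (toFun v)) :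
    inS v v ≤ 4 * R ^ 2 * inV (gradh v) (gradh v) := by
  obtain ⟨g, hg, hibp, hp⟩ := hv.exists_weakGradient hd hR
  have hgK := fun K i => weakGradient_ae_eq hreg hg hibp K i
  have h1 : ∫ x in Ω, toFun v x * toFun v x = inS v v := by
    rw [integral_domain_eq_sum T hreg (integrable_mul_of_memLp hv.1 hv.1)]
    refine Finset.sum_congr rfl fun K _ => integral_congr_ae ?_
    filter_upwards [toFun_ae_eq v K] with x hx
    rw [hx]
  have h2 : ∑ i, ∫ x in Ω, g x i * g x i = inV (gradh v) (gradh v) := by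
    have : ∀ i, ∫ x in Ω, g x i * g x i = ∑ K : T.cells, ∫ x in hull K.1,
        ev (gradh v K i) x * ev (gradh v K i) x := by
      intro i
      rw [integral_domain_eq_sum T hreg
        (integrable_mul_of_memLp (MemLp.apply_two hg i) (MemLp.apply_two hg i))]
      refine Finset.sum_congr rfl fun K _ => integral_congr_ae ?_
      filter_upwards [hgK K i] with x hx
      rw [hx]; rfl
    simp only [this]
    rw [Finset.sum_comm]
    refine Finset.sum_congr rfl fun K _ => ?_
    rw [← integral_finsetSum]
    · rfl
    · intro i _
      exact Continuous.integrableOn_hull ((continuous_ev _).mul (continuous_ev _)) K.1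
  rwa [h1, h2] at hp

open Classical in
-- Integration by parts over `Ω` has no boundary term for a function in H¹₀, whereas cell by cell it
-- leaves the facet terms. These must therefore sum to zero, and regrouped by facet they form the
-- jump.
lemma sum_integral_jump_mul (hd : 1 ≤ d) (hreg : interior (closure Ω) = Ω) {v : T.Scal}
    (hv : MemH10 Ω (toFun v)) (i : Fin d) (r : Poly d) :
    ∑ e : T.facets, ∫ x, jump v e x i * ev r x ∂(facetMeasure e.1) = 0 := by
  have hev := fun p : Poly d => continuous_ev p
  obtain ⟨R, hR⟩ := isBounded_iff_forall_norm_le.1 T.isBounded_domain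
  obtain ⟨g, hg, hibp, -⟩ := hv.exists_weakGradient hd hR
  have hgK := fun K => weakGradient_ae_eq hreg hg hibp K i
  have hr := memLp_restrict_of_continuous T.isBounded_domain (continuous_ev r)
  have hr' := memLp_restrict_of_continuous T.isBounded_domain
    (continuous_ev (MvPolynomial.pderiv i r))
  have h := hibp (ev r) (contDiff_ev r) i
  have hfd : ∀ x, fderiv ℝ (ev r) x (EuclideanSpace.single i 1) =
      ev (MvPolynomial.pderiv i r) x := by
    intro x
    rw [fderiv_ev, Finset.sum_eq_single i]
    · simp
    · intro j _ hj; simp [hj]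
    · simp
  simp only [hfd] at h
  rw [integral_domain_eq_sum T hreg (integrable_mul_of_memLp (MemLp.apply_two hg i) hr),
    integral_domain_eq_sum T hreg (integrable_mul_of_memLp hv.1 hr'), ← add_eq_zero_iff_eq_neg,
    ← Finset.sum_add_distrib] at h
  have hcell : ∀ K : T.cells, (∫ x in hull K.1, g x i * ev r x) +
      (∫ x in hull K.1, toFun v x * ev (MvPolynomial.pderiv i r) x) =
      ∑ e : T.facets with e.1 ⊆ K.1, ∫ x, normal K.1 e.1 i * ev (v K) x * ev r x
        ∂(facetMeasure e.1) := by
    intro K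
    have e1 : ∫ x in hull K.1, g x i * ev r x =
        ∫ x in hull K.1, ev (MvPolynomial.pderiv i (v K)) x * ev r x := by
      refine integral_congr_ae ?_
      filter_upwards [hgK K] with x hx
      rw [hx]
    have e2 : ∫ x in hull K.1, toFun v x * ev (MvPolynomial.pderiv i r) x =
        ∫ x in hull K.1, ev (v K) x * ev (MvPolynomial.pderiv i r) x := by
      refine integral_congr_ae ?_
      filter_upwards [toFun_ae_eq v K] with x hx
      rw [hx]
    have hdiv := setIntegral_hull_derivative hd (T.card_eq K.1 K.2) (T.indep K.1 K.2) (v K * r)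
      (EuclideanSpace.single i 1)
    rw [e1, e2, ← integral_add (Continuous.integrableOn_hull (by fun_prop) K.1)
      (Continuous.integrableOn_hull (by fun_prop) K.1),
      sum_facets_of_cell K fun e => ∫ x, normal K.1 e i * ev (v K) x * ev r x ∂(facetMeasure e)]
    convert hdiv using 1
    · congr 1
      ext x
      rw [Finset.sum_eq_single i]
      · simp [Derivation.leibniz]; ring
      · intro j _ hj; simp [hj]
      · simp
    · refine Finset.sum_congr rfl fun a _ => ?_
      rw [EuclideanSpace.inner_single_right, ← integral_const_mul]
      simp [mul_assoc]
  simp only [hcell] at h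
  rw [← h]
  simp only [Finset.sum_filter]
  rw [Finset.sum_comm]
  refine Finset.sum_congr rfl fun e _ => ?_
  have := isFiniteMeasure_facet hd e
  rw [← Finset.sum_filter, ← integral_finsetSum]
  · congr 1
    ext x
    simp only [jump, WithLp.ofLp_sum, Finset.sum_apply, PiLp.smul_apply, smul_eq_mul, Finset.sum_mul]
    exact Finset.sum_congr rfl fun K _ => by ring
  · intro K _
    exact integrable_facet hd e (by fun_prop)

lemma continuous_jump (v : T.Scal) (e : T.facets) (i : Fin d) :
    Continuous fun x => jump v e x i := by
  have hev := fun p : Poly d => continuous_ev p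
  simp only [jump, WithLp.ofLp_sum, Finset.sum_apply, PiLp.smul_apply, smul_eq_mul]
  fun_prop

lemma sum_integral_jump_mul_of_continuous (hd : 1 ≤ d) (hreg : interior (closure Ω) = Ω)
    {v : T.Scal} (hv : MemH10 Ω (toFun v)) (i : Fin d) {F : E d → ℝ} (hF : Continuous F) :
    ∑ e : T.facets, ∫ x, jump v e x i * F x ∂(facetMeasure e.1) = 0 := by
  have hJ := fun e => continuous_jump v e i
  set M := ∑ e : T.facets, ∫ x, |jump v e x i| ∂(facetMeasure e.1) with hM
  have hM0 : 0 ≤ M := Finset.sum_nonneg fun e _ => integral_nonneg fun x => abs_nonneg _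
  have key : ∀ ε > 0, |∑ e : T.facets, ∫ x, jump v e x i * F x ∂(facetMeasure e.1)| ≤ ε * M := by
    intro ε hε
    obtain ⟨p, hp⟩ := exists_ev_approx T.isBounded_domain.isCompact_closure hF hε
    have hpc := continuous_ev p
    rw [← sub_zero (∑ e : T.facets, _), ← sum_integral_jump_mul hd hreg hv i p,
      ← Finset.sum_sub_distrib, hM, Finset.mul_sum]
    refine (Finset.abs_sum_le_sum_abs _ _).trans (Finset.sum_le_sum fun e _ => ?_)
    have i1 : Integrable (fun x => jump v e x i * F x) (facetMeasure e.1) :=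
      integrable_facet hd e ((hJ e).mul hF)
    have i2 : Integrable (fun x => jump v e x i * ev p x) (facetMeasure e.1) :=
      integrable_facet hd e ((hJ e).mul hpc)
    have i3 : Integrable (fun x => ε * |jump v e x i|) (facetMeasure e.1) :=
      (integrable_facet hd e (hJ e)).abs.const_mul ε
    rw [← integral_sub i1 i2, ← integral_const_mul]
    refine abs_integral_le_integral_abs.trans (integral_mono_ae (i1.sub i2).abs i3 ?_)
    filter_upwards [ae_restrict_mem (measurableSet_hull e.1)] with x hx
    obtain ⟨K, hK⟩ := exists_cell e
    have h1 := hp x (hull_subset_closure K (hull_mono hK hx))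
    rw [← mul_sub, abs_mul, mul_comm, abs_sub_comm]
    exact mul_le_mul_of_nonneg_right h1.le (abs_nonneg _)
  by_contra hne
  have hpos := abs_pos.2 hne
  -- With this ε the bound says that the absolute value is at most half of itself; the `+ 1` covers
  -- `M = 0`.
  have := key (|∑ e : T.facets, ∫ x, jump v e x i * F x ∂(facetMeasure e.1)| / (2 * (M + 1)))
    (by positivity)
  rw [div_mul_eq_mul_div, le_div_iff₀ (by positivity)] at this
  nlinarith

/-- Conforming functions have no jumps. -/
lemma jump_ae_eq_zero (hd : 1 ≤ d) (hreg : interior (closure Ω) = Ω)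
    {v : T.Scal} (hv : MemH10 Ω (toFun v)) (e : T.facets) :
    ∀ᵐ x ∂(facetMeasure e.1), jump v e x = 0 := by
  classical
  have hJ := fun e i => continuous_jump v e i
  -- `G` vanishes on every other facet and is positive off them. The test function `G` times a
  -- component of the jump isolates `e` and leaves the integral of a nonnegative function.
  set G : E d → ℝ := fun x => ∏ e' ∈ Finset.univ.erase e, Metric.infDist x (hull e'.1) with hG
  have hGc : Continuous G := continuous_finsetProd _ fun e' _ => Metric.continuous_infDist_pt _
  have hcomp : ∀ i, ∀ᵐ x ∂(facetMeasure e.1), G x * (jump v e x i * jump v e x i) = 0 := by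
    intro i
    have h := sum_integral_jump_mul_of_continuous hd hreg hv i (hGc.mul (hJ e i))
    rw [Finset.sum_eq_single e] at h
    · have h2 : ∫ x, G x * (jump v e x i * jump v e x i) ∂(facetMeasure e.1) = 0 := by
        rw [← h]; congr 1; ext x; rw [Pi.mul_apply]; ring
      refine (integral_eq_zero_iff_of_nonneg (fun x => mul_nonneg
        (Finset.prod_nonneg fun _ _ => Metric.infDist_nonneg) (mul_self_nonneg _))
        (integrable_facet hd e (hGc.mul ((hJ e i).mul (hJ e i))))).1 h2
    · intro e' _ he'
      refine integral_eq_zero_of_ae ?_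
      filter_upwards [ae_restrict_mem (measurableSet_hull e'.1)] with x hx
      have : G x = 0 := Finset.prod_eq_zero (Finset.mem_erase.2 ⟨he', Finset.mem_univ _⟩)
        (Metric.infDist_zero_of_mem hx)
      simp [this]
    · simp
  have hout : ∀ᵐ x ∂(facetMeasure e.1), ∀ e' : T.facets, e' ≠ e → x ∉ hull e'.1 := by
    rw [ae_all_iff]
    intro e'
    by_cases he' : e' = e
    · simp [he']
    · filter_upwards [compl_mem_ae_iff.2 (facetMeasure_hull_eq_zero (Ne.symm he'))] with x hx _
      exact hx
  filter_upwards [hout, ae_all_iff.2 hcomp] with x hx hx2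
  have hGx : G x ≠ 0 := by
    rw [hG]
    refine Finset.prod_ne_zero_iff.2 fun e' he' => ?_
    have hne : (hull e'.1).Nonempty := by
      have : e'.1.Nonempty := by rw [← Finset.card_pos, card_facet]; omega
      exact ⟨_, bary_mem_hull this⟩
    exact ((isCompact_hull e'.1).isClosed.notMem_iff_infDist_pos hne).1
      (hx e' (Finset.mem_erase.1 he').1) |>.ne'
  ext i
  simpa [hGx] using hx2 i

/-- A conforming function vanishes on boundary facets. -/
lemma ev_ae_eq_zero (hd : 1 ≤ d) (hreg : interior (closure Ω) = Ω)
    {v : T.Scal} (hv : MemH10 Ω (toFun v)) {e : T.facets} (he : ¬ T.IsInterior e) {K : T.cells}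
    (hK : e.1 ⊆ K.1) : ∀ᵐ x ∂(facetMeasure e.1), ev (v K) x = 0 := by
  classical
  filter_upwards [jump_ae_eq_zero hd hreg hv e] with x hx
  rw [jump, filter_eq_singleton he hK, Finset.sum_singleton] at hx
  rcases smul_eq_zero.1 hx with h | h
  · exact h
  · have := norm_normal hd hK
    rw [h] at this
    simp at this

/-- A conforming function has the same trace from both sides of a facet. -/
lemma ev_ae_eq (hd : 1 ≤ d) (hreg : interior (closure Ω) = Ω)
    {v : T.Scal} (hv : MemH10 Ω (toFun v)) {e : T.facets} {K L : T.cells}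
    (hK : e.1 ⊆ K.1) (hL : e.1 ⊆ L.1) :
    ∀ᵐ x ∂(facetMeasure e.1), ev (v K) x = ev (v L) x := by
  classical
  by_cases hKL : K = L
  · simp [hKL]
  filter_upwards [jump_ae_eq_zero hd hreg hv e] with x hx
  rw [jump, filter_eq_pair hd hKL hK hL, Finset.sum_pair hKL, normal_eq_neg hd hKL hK hL,
    smul_neg, ← sub_eq_add_neg, ← sub_smul] at hx
  rcases smul_eq_zero.1 hx with h | h
  · exact sub_eq_zero.1 h
  · have := norm_normal hd hK
    rw [h] at this
    simp at this

end Triangulation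

/-! ### The error analysis in abstract Hilbert spaces -/

/-- A nondegenerate square linear system is uniquely solvable. -/
lemma existsUnique_of_nondegenerate {M : Type*} [AddCommGroup M] [Module ℝ M]
    [FiniteDimensional ℝ M] (B : M →ₗ[ℝ] M →ₗ[ℝ] ℝ) (hB : ∀ s, (∀ t, B s t = 0) → s = 0)
    (ℓ : M →ₗ[ℝ] ℝ) : ∃! s, ∀ t, B s t = ℓ t := by
  have hinj : Function.Injective B := by
    rw [← LinearMap.ker_eq_bot, LinearMap.ker_eq_bot']
    intro s hs
    exact hB s fun t => by rw [hs]; rfl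
  have hsurj : Function.Surjective B :=
    (LinearMap.injective_iff_surjective_of_finrank_eq_finrank
      (Subspace.dual_finrank_eq (K := ℝ) (V := M)).symm).1 hinj
  obtain ⟨s, hs⟩ := hsurj ℓ
  refine ⟨s, fun t => by rw [hs], fun t ht => hinj ?_⟩
  rw [hs]
  exact LinearMap.ext ht

/-- The discrete problems in terms of Hilbert spaces: `J`, `A`, `N` map a flux `p` to the functions
`p`, `c p` and to its scaled normal traces, `I` and `D` map a potential to its function and to its
scaled difference to a trace. -/
structure DiscreteSetting (X Y Z H₁ H₀ Hₛ : Type*)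
    [AddCommGroup X] [Module ℝ X] [AddCommGroup Y] [Module ℝ Y] [AddCommGroup Z] [Module ℝ Z]
    [NormedAddCommGroup H₁] [InnerProductSpace ℝ H₁] [NormedAddCommGroup H₀]
    [InnerProductSpace ℝ H₀] [NormedAddCommGroup Hₛ] [InnerProductSpace ℝ Hₛ]
    (lo hi Ct CP CJ : ℝ) where
  J : X →ₗ[ℝ] H₁
  A : X →ₗ[ℝ] H₁
  N : X →ₗ[ℝ] Hₛ
  I : Y →ₗ[ℝ] H₀
  D : Y × Z →ₗ[ℝ] Hₛ
  grad : Y →ₗ[ℝ] X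
  Q : Submodule ℝ X
  V : Submodule ℝ Y
  Vc : Submodule ℝ Y
  Zh : Submodule ℝ Z
  finQ : FiniteDimensional ℝ Q
  finV : FiniteDimensional ℝ V
  finVc : FiniteDimensional ℝ Vc
  finZ : FiniteDimensional ℝ Zh
  Vc_le : Vc ≤ V
  J_inj : ∀ p, J p = 0 → p = 0
  I_inj : ∀ v, I v = 0 → v = 0
  D_inj : ∀ z, D (0, z) = 0 → z = 0
  lower : ∀ p, lo * ‖A p‖ ^ 2 ≤ inner ℝ (A p) (J p)
  upper : ∀ p, ‖J p‖ ^ 2 ≤ hi * inner ℝ (A p) (J p)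
  trace : ∀ q ∈ Q, ‖N q‖ ≤ Ct * ‖J q‖
  grad_mem : ∀ v ∈ V, grad v ∈ Q
  -- A conforming potential together with its own trace belongs to the HDG space and is not
  -- stabilized.
  conforming : ∀ v ∈ Vc, ∃ z ∈ Zh, D (v, z) = 0
  poincare : ∀ v ∈ Vc, ‖I v‖ ≤ CP * ‖J (grad v)‖
  -- Assumption 3 with the jumps bounded by `D`, for any choice of `z`. The ε stands in for an
  -- infimum that is not assumed to be attained.
  approx : ∀ u ∈ V, ∀ z ∈ Zh, ∀ ε > 0, ∃ w ∈ Vc,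
    ‖I (w - u)‖ + ‖J (grad (w - u))‖ ≤ CJ * ‖D (u, z)‖ + ε

namespace DiscreteSetting

variable {X Y Z H₁ H₀ Hₛ : Type*}
    [AddCommGroup X] [Module ℝ X] [AddCommGroup Y] [Module ℝ Y] [AddCommGroup Z] [Module ℝ Z]
    [NormedAddCommGroup H₁] [InnerProductSpace ℝ H₁] [NormedAddCommGroup H₀]
    [InnerProductSpace ℝ H₀] [NormedAddCommGroup Hₛ] [InnerProductSpace ℝ Hₛ]
    {lo hi Ct CP CJ : ℝ} (S : DiscreteSetting X Y Z H₁ H₀ Hₛ lo hi Ct CP CJ)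

/-- The bilinear form `b` after integration by parts. -/
noncomputable def b (q : X) (u : Y) (z : Z) : ℝ :=
  inner ℝ (S.J (S.grad u)) (S.J q) - inner ℝ (S.D (u, z)) (S.N q)

/-- The HDG equations. -/
def IsSolution (r : ℝ) (ℓ : Y →ₗ[ℝ] ℝ) (p : X) (u : Y) (z : Z) : Prop :=
  p ∈ S.Q ∧ u ∈ S.V ∧ z ∈ S.Zh ∧ (∀ q ∈ S.Q, inner ℝ (S.A p) (S.J q) + S.b q u z = 0) ∧
  ∀ v ∈ S.V, ∀ y ∈ S.Zh, S.b p v y - r * inner ℝ (S.D (u, z)) (S.D (v, y)) = -ℓ v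

/-- The primal conforming equations. -/
def IsConformingSolution (ℓ : Y →ₗ[ℝ] ℝ) (p : X) (u : Y) : Prop :=
  p ∈ S.Q ∧ u ∈ S.Vc ∧
  (∀ q ∈ S.Q, inner ℝ (S.A p) (S.J q) + inner ℝ (S.J (S.grad u)) (S.J q) = 0) ∧
  ∀ v ∈ S.Vc, -inner ℝ (S.J p) (S.J (S.grad v)) = ℓ v

lemma energy_nonneg (hlo : 0 < lo) (p : X) : 0 ≤ inner ℝ (S.A p) (S.J p) :=
  (by positivity : 0 ≤ lo * ‖S.A p‖ ^ 2).trans (S.lower p)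

lemma J_eq_zero_of_energy {p : X} (h : inner ℝ (S.A p) (S.J p) = 0) : p = 0 := by
  refine S.J_inj p ?_
  have := S.upper p
  rw [h, mul_zero] at this
  simpa using le_antisymm this (sq_nonneg _)

/-- The discrete Poincaré inequality. -/
lemma norm_I_le (hCP : 0 ≤ CP) {v : Y} (hv : v ∈ S.V) {z : Z} (hz : z ∈ S.Zh) :
    ‖S.I v‖ ≤ (1 + CP) * (CJ * ‖S.D (v, z)‖) + CP * ‖S.J (S.grad v)‖ := by
  refine le_of_forall_pos_le_add fun ε hε => ?_
  -- Poincaré holds only on `Vc`, so `v` is compared with a nearby conforming `w`; the factor `1 +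
  -- CP` collects the two uses of their distance.
  obtain ⟨w, hw, h⟩ := S.approx v hv z hz (ε / (1 + CP)) (by positivity)
  have h1 : ‖S.I v‖ ≤ ‖S.I (w - v)‖ + ‖S.I w‖ := by
    have : S.I v = S.I w - S.I (w - v) := by rw [map_sub]; abel
    rw [this, add_comm]; exact norm_sub_le _ _
  have h2 : ‖S.J (S.grad w)‖ ≤ ‖S.J (S.grad (w - v))‖ + ‖S.J (S.grad v)‖ := by
    have : S.J (S.grad w) = S.J (S.grad (w - v)) + S.J (S.grad v) := by
      rw [map_sub, map_sub]; abel
    rw [this]; exact norm_add_le _ _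
  have h3 := S.poincare w hw
  have h4 : (1 + CP) * (‖S.I (w - v)‖ + ‖S.J (S.grad (w - v))‖) ≤
      (1 + CP) * (CJ * ‖S.D (v, z)‖) + ε := by
    refine (mul_le_mul_of_nonneg_left h (by positivity)).trans_eq ?_
    field_simp
  nlinarith [norm_nonneg (S.I (w - v)), norm_nonneg (S.J (S.grad (w - v))),
    mul_le_mul_of_nonneg_left h2 hCP, mul_nonneg hCP (norm_nonneg (S.I (w - v)))]

/-- The discrete Poincaré inequality in terms of the norm with parameter `ρ`. -/
lemma norm_I_le_of_le (hCP : 0 ≤ CP) (hCJ : 0 ≤ CJ) {ρ ρ₀ : ℝ} (hρ : 0 < ρ) (hρ₀ : ρ ≤ ρ₀) {v : Y}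
    (hv : v ∈ S.V) {z : Z} (hz : z ∈ S.Zh) : ‖S.I v‖ ≤ ((1 + CP) * (CJ * √ρ₀) + CP) *
      √(‖S.J (S.grad v)‖ ^ 2 + ρ⁻¹ * ‖S.D (v, z)‖ ^ 2) := by
  set N := √(‖S.J (S.grad v)‖ ^ 2 + ρ⁻¹ * ‖S.D (v, z)‖ ^ 2)
  have hg : ‖S.J (S.grad v)‖ ≤ N := Real.le_sqrt_of_sq_le (le_add_of_nonneg_right (by positivity))
  -- The bound `ρ ≤ ρ₀` enters here and makes the constant independent of `ρ`.
  have hD : ‖S.D (v, z)‖ ≤ √ρ₀ * N := by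
    rw [← Real.sqrt_mul (hρ.le.trans hρ₀)]
    refine Real.le_sqrt_of_sq_le ?_
    calc ‖S.D (v, z)‖ ^ 2 = ρ * (ρ⁻¹ * ‖S.D (v, z)‖ ^ 2) := by field_simp
      _ ≤ ρ₀ * (‖S.J (S.grad v)‖ ^ 2 + ρ⁻¹ * ‖S.D (v, z)‖ ^ 2) :=
        mul_le_mul hρ₀ (le_add_of_nonneg_left (sq_nonneg _)) (by positivity) (hρ.le.trans hρ₀)
  calc ‖S.I v‖ ≤ (1 + CP) * (CJ * ‖S.D (v, z)‖) + CP * ‖S.J (S.grad v)‖ := S.norm_I_le hCP hv hz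
    _ ≤ (1 + CP) * (CJ * (√ρ₀ * N)) + CP * N := by gcongr
    _ = _ := by ring

lemma norm_A_le (hlo : 0 < lo) (p : X) :
    ‖S.A p‖ ≤ (√lo)⁻¹ * √(inner ℝ (S.A p) (S.J p)) := by
  rw [← Real.sqrt_inv, ← Real.sqrt_mul (by positivity)]
  refine Real.le_sqrt_of_sq_le ?_
  rw [inv_mul_eq_div, le_div_iff₀ hlo, mul_comm]
  exact S.lower p

/-- The first equation controls the broken gradient. -/
lemma norm_grad_le (hlo : 0 < lo) (hCt : 0 ≤ Ct) {p : X} {u : Y} {z : Z} (hu : u ∈ S.V)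
    (h : ∀ q ∈ S.Q, inner ℝ (S.A p) (S.J q) + S.b q u z = 0) :
    ‖S.J (S.grad u)‖ ≤ (√lo)⁻¹ * √(inner ℝ (S.A p) (S.J p)) + Ct * ‖S.D (u, z)‖ := by
  -- The broken gradient itself is an admissible flux test function; one factor of its norm is
  -- divided out at the end.
  have h1 := h _ (S.grad_mem u hu)
  rw [b, real_inner_self_eq_norm_sq] at h1
  set g := S.J (S.grad u)
  have h2 : |inner ℝ (S.A p) g| ≤ ‖S.A p‖ * ‖g‖ := abs_real_inner_le_norm _ _
  have h3 : |inner ℝ (S.D (u, z)) (S.N (S.grad u))| ≤ ‖S.D (u, z)‖ * (Ct * ‖g‖) :=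
    (abs_real_inner_le_norm _ _).trans
      (mul_le_mul_of_nonneg_left (S.trace _ (S.grad_mem u hu)) (norm_nonneg _))
  have h4 : ‖g‖ * ‖g‖ ≤ (‖S.A p‖ + Ct * ‖S.D (u, z)‖) * ‖g‖ := by
    have := neg_abs_le (inner ℝ (S.A p) g)
    have := le_abs_self (inner ℝ (S.D (u, z)) (S.N (S.grad u)))
    nlinarith
  have h5 := S.norm_A_le hlo p
  rcases (norm_nonneg g).eq_or_lt with h0 | h0
  · rw [← h0]
    positivity
  · exact (le_of_mul_le_mul_right h4 h0).trans (by linarith)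

/-- Both equations are tested with the solution, and the two occurrences of `b` cancel. -/
lemma energy_identity {r : ℝ} {ℓ : Y →ₗ[ℝ] ℝ} {p : X} {u : Y} {z : Z}
    (h : S.IsSolution r ℓ p u z) :
    inner ℝ (S.A p) (S.J p) + r * ‖S.D (u, z)‖ ^ 2 = ℓ u := by
  have h1 := h.2.2.2.1 p h.1
  have h2 := h.2.2.2.2 u h.2.1 z h.2.2.1
  rw [real_inner_self_eq_norm_sq] at h2
  linarith

/-- Stability: the energy of a discrete solution is bounded by a dual norm of the load. -/
lemma norm_D_le (hlo : 0 < lo) (hCt : 0 ≤ Ct) {ρ ρ₀ : ℝ} (hρ : 0 < ρ) (hρ₀ : ρ ≤ ρ₀)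
    {ℓ : Y →ₗ[ℝ] ℝ} {p : X} {u : Y} {z : Z} (h : S.IsSolution ρ⁻¹ ℓ p u z) {F : ℝ} (hF : 0 ≤ F)
    (hℓ : ℓ u ≤ F * √(‖S.J (S.grad u)‖ ^ 2 + ρ⁻¹ * ‖S.D (u, z)‖ ^ 2)) :
    ‖S.D (u, z)‖ ≤ √ρ * (√(2 * lo⁻¹ + 2 * Ct ^ 2 * ρ₀ + 1) * F) := by
  -- `M` bounds the squared norm of (u, û) by the energy: the first two terms come from the
  -- gradient, the 1 from the stabilization.
  set M := 2 * lo⁻¹ + 2 * Ct ^ 2 * ρ₀ + 1 with hM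
  have hρ₀' : 0 < ρ₀ := hρ.trans_le hρ₀
  set a := inner ℝ (S.A p) (S.J p) with ha
  set s := ‖S.D (u, z)‖ with hs
  have ha0 : 0 ≤ a := S.energy_nonneg hlo p
  have hid : a + ρ⁻¹ * s ^ 2 = ℓ u := S.energy_identity h
  set En := a + ρ⁻¹ * s ^ 2 with hEn
  have hEn0 : 0 ≤ En := by positivity
  have hg := S.norm_grad_le hlo hCt h.2.1 h.2.2.2.1
  have hg2 : ‖S.J (S.grad u)‖ ^ 2 ≤ 2 * lo⁻¹ * a + 2 * Ct ^ 2 * s ^ 2 := by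
    refine (pow_le_pow_left₀ (norm_nonneg _) hg 2).trans ?_
    have e1 : ((√lo)⁻¹ * √a) ^ 2 = lo⁻¹ * a := by
      rw [mul_pow, inv_pow, Real.sq_sqrt hlo.le, Real.sq_sqrt ha0]
    nlinarith [sq_nonneg ((√lo)⁻¹ * √a - Ct * s)]
  have hs2 : s ^ 2 ≤ ρ₀ * (ρ⁻¹ * s ^ 2) := by
    rw [← mul_assoc]
    refine le_mul_of_one_le_left (sq_nonneg _) ?_
    rwa [← div_eq_mul_inv, one_le_div hρ]
  have htot : ‖S.J (S.grad u)‖ ^ 2 + ρ⁻¹ * s ^ 2 ≤ M * En := by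
    have hr : 0 ≤ ρ⁻¹ * s ^ 2 := by positivity
    have hCt2 : 2 * Ct ^ 2 * s ^ 2 ≤ 2 * Ct ^ 2 * (ρ₀ * (ρ⁻¹ * s ^ 2)) := by gcongr
    have e1 : 0 ≤ 2 * Ct ^ 2 * ρ₀ * a := by positivity
    have e2 : 0 ≤ 2 * lo⁻¹ * (ρ⁻¹ * s ^ 2) := by positivity
    rw [hM, hEn]
    nlinarith
  have hEnF : En ≤ F * (√M * √En) := by
    rw [hid]
    refine hℓ.trans (mul_le_mul_of_nonneg_left ?_ hF)
    rw [← hid, ← Real.sqrt_mul (by positivity)]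
    exact Real.sqrt_le_sqrt htot
  have hsq : √En ≤ √M * F := by
    rcases hEn0.eq_or_lt with h0 | h0
    · rw [← h0, Real.sqrt_zero]; positivity
    · have h1 : 0 < √En := Real.sqrt_pos.2 h0
      refine le_of_mul_le_mul_right ?_ h1
      rw [Real.mul_self_sqrt hEn0]
      linarith
  -- The gain of ρ^{1/2}: the energy contains `ρ⁻¹ * s ^ 2`.
  have hss : s ≤ √ρ * √En := by
    rw [← Real.sqrt_mul hρ.le]
    refine Real.le_sqrt_of_sq_le ?_
    rw [hEn, mul_add, ← mul_assoc, mul_inv_cancel₀ hρ.ne', one_mul]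
    nlinarith [mul_nonneg hρ.le ha0]
  exact hss.trans (mul_le_mul_of_nonneg_left hsq (Real.sqrt_nonneg _))

/-- The distance of the HDG solution to the conforming one is bounded by the stabilization. -/
lemma error_le (hlo : 0 < lo) (hhi : 0 < hi) (hCt : 0 ≤ Ct) (hCP : 0 ≤ CP) (hCJ : 0 ≤ CJ)
    {r : ℝ} {ℓ : Y →ₗ[ℝ] ℝ} {p : X} {u : Y} {z : Z} (h : S.IsSolution r ℓ p u z) {pc : X} {uc : Y}
    (hc : S.IsConformingSolution ℓ pc uc) :
    √(inner ℝ (S.A (p - pc)) (S.J (p - pc))) +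
      √(‖S.I (u - uc)‖ ^ 2 + ‖S.J (S.grad (u - uc))‖ ^ 2) ≤
    (√hi * (CJ + Ct) + ((1 + CP) * CJ + (1 + CP) * ((√lo)⁻¹ * (√hi * (CJ + Ct)) + Ct))) *
      ‖S.D (u, z)‖ := by
  obtain ⟨zc, hzc, hDc⟩ := S.conforming uc hc.2.1
  -- Subtracting the conforming pair leaves `D` unchanged, so the error pair is measured by the
  -- stabilization of the HDG solution alone.
  have hD : S.D (u - uc, z - zc) = S.D (u, z) := by
    rw [← Prod.mk_sub_mk, map_sub, hDc, sub_zero]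
  have hfirst : ∀ q ∈ S.Q,
      inner ℝ (S.A (p - pc)) (S.J q) + S.b q (u - uc) (z - zc) = 0 := by
    intro q hq
    have h1 := h.2.2.2.1 q hq
    have h2 := hc.2.2.1 q hq
    rw [b] at h1 ⊢
    rw [hD, map_sub, map_sub, map_sub, inner_sub_left, inner_sub_left]
    linarith
  -- For a conforming test pair all terms with `D` drop out of the HDG equation, and subtraction of
  -- the primal equation removes the load.
  have horth : ∀ v ∈ S.Vc, inner ℝ (S.J (S.grad v)) (S.J (p - pc)) = 0 := by
    intro v hv
    obtain ⟨y, hy, hDy⟩ := S.conforming v hv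
    have h1 := h.2.2.2.2 v (S.Vc_le hv) y hy
    have h2 := hc.2.2.2 v hv
    rw [b, hDy, inner_zero_left, inner_zero_right, mul_zero, sub_zero, sub_zero] at h1
    rw [real_inner_comm] at h2
    rw [map_sub, inner_sub_right]
    linarith
  set e := p - pc with he
  have heQ : e ∈ S.Q := S.Q.sub_mem h.1 hc.1
  set s := ‖S.D (u, z)‖ with hs
  have hs0 : 0 ≤ s := norm_nonneg _
  set a := inner ℝ (S.A e) (S.J e) with ha
  have ha0 : 0 ≤ a := S.energy_nonneg hlo e
  have hJe : ‖S.J e‖ ≤ √hi * √a := by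
    rw [← Real.sqrt_mul hhi.le]
    exact Real.le_sqrt_of_sq_le (S.upper e)
  -- The error equation is tested with the flux error `e`. Since `e` is orthogonal to conforming
  -- gradients, `u - uc` may be replaced by `u - w` with `w` conforming and close to `u`.
  have hflux : √a ≤ √hi * ((CJ + Ct) * s) := by
    refine le_of_forall_pos_le_add fun ε hε => ?_
    have hhi' : 0 < √hi := Real.sqrt_pos.2 hhi
    obtain ⟨w, hw, hwε⟩ := S.approx u h.2.1 z h.2.2.1 (ε / √hi) (by positivity)
    have h1 := hfirst e heQ
    rw [b, hD] at h1
    have h2 : inner ℝ (S.J (S.grad (u - uc))) (S.J e) =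
        -inner ℝ (S.J (S.grad (w - u))) (S.J e) := by
      have h3 := horth (w - uc) (S.Vc.sub_mem hw hc.2.1)
      have : w - uc = (w - u) + (u - uc) := by abel
      rw [this, map_add, map_add, inner_add_left] at h3
      linarith
    have h3 : a ≤ ‖S.J (S.grad (w - u))‖ * ‖S.J e‖ + s * (Ct * ‖S.J e‖) := by
      have h4 := (le_abs_self _).trans (abs_real_inner_le_norm (S.J (S.grad (w - u))) (S.J e))
      have h5 := (le_abs_self _).trans ((abs_real_inner_le_norm (S.D (u, z)) (S.N e)).trans
        (mul_le_mul_of_nonneg_left (S.trace e heQ) (norm_nonneg _)))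
      linarith
    have h4 : ‖S.J (S.grad (w - u))‖ ≤ CJ * s + ε / √hi := by
      linarith [norm_nonneg (S.I (w - u))]
    have h5 : a ≤ ((CJ + Ct) * s + ε / √hi) * (√hi * √a) := by
      refine h3.trans ?_
      calc ‖S.J (S.grad (w - u))‖ * ‖S.J e‖ + s * (Ct * ‖S.J e‖)
          ≤ (CJ * s + ε / √hi) * ‖S.J e‖ + s * (Ct * ‖S.J e‖) := by gcongr
        _ = ((CJ + Ct) * s + ε / √hi) * ‖S.J e‖ := by ring
        _ ≤ _ := by gcongr
    rcases ha0.eq_or_lt with h0 | h0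
    · rw [← h0, Real.sqrt_zero]; positivity
    · have h6 : 0 < √a := Real.sqrt_pos.2 h0
      refine le_of_mul_le_mul_right ?_ h6
      rw [Real.mul_self_sqrt ha0]
      refine h5.trans_eq ?_
      field_simp
  have huV : u - uc ∈ S.V := S.V.sub_mem h.2.1 (S.Vc_le hc.2.1)
  have hzV : z - zc ∈ S.Zh := S.Zh.sub_mem h.2.2.1 hzc
  -- The error triple satisfies the first HDG equation too, so the gradient bound and the discrete
  -- Poincaré inequality apply to it.
  have hgrad := S.norm_grad_le hlo hCt huV hfirst
  have hpot := S.norm_I_le hCP huV hzV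
  rw [hD] at hgrad hpot
  rw [← hs, ← ha] at hgrad
  rw [← hs] at hpot
  have hgrad' : ‖S.J (S.grad (u - uc))‖ ≤ ((√lo)⁻¹ * (√hi * (CJ + Ct)) + Ct) * s := by
    refine hgrad.trans ?_
    have : (√lo)⁻¹ * √a ≤ (√lo)⁻¹ * (√hi * ((CJ + Ct) * s)) :=
      mul_le_mul_of_nonneg_left hflux (by positivity)
    linarith
  have hsum : √(‖S.I (u - uc)‖ ^ 2 + ‖S.J (S.grad (u - uc))‖ ^ 2) ≤
      ‖S.I (u - uc)‖ + ‖S.J (S.grad (u - uc))‖ := by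
    rw [Real.sqrt_le_left (by positivity)]
    nlinarith [norm_nonneg (S.I (u - uc)), norm_nonneg (S.J (S.grad (u - uc))),
      mul_nonneg (norm_nonneg (S.I (u - uc))) (norm_nonneg (S.J (S.grad (u - uc))))]
  have hCPg := mul_le_mul_of_nonneg_left hgrad' hCP
  linarith

lemma eq_zero_of_norm_eq_zero (hCP : 0 ≤ CP) {u : Y} (hu : u ∈ S.V) {z : Z} (hz : z ∈ S.Zh)
    (hD : S.D (u, z) = 0) (hg : S.J (S.grad u) = 0) : u = 0 ∧ z = 0 := by
  have h := S.norm_I_le hCP hu hz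
  rw [hD, hg, norm_zero, norm_zero] at h
  simp only [mul_zero, add_zero] at h
  have hu0 : u = 0 := S.I_inj u (norm_le_zero_iff.1 h)
  refine ⟨hu0, S.D_inj z ?_⟩
  rwa [hu0] at hD

/-- The HDG equations as one bilinear form. -/
noncomputable def form (r : ℝ) : (S.Q × S.V × S.Zh) →ₗ[ℝ] (S.Q × S.V × S.Zh) →ₗ[ℝ] ℝ :=
  LinearMap.mk₂ ℝ
    (fun s t => inner ℝ (S.A s.1) (S.J t.1) + S.b t.1 s.2.1 s.2.2 + S.b s.1 t.2.1 t.2.2 -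
      r * inner ℝ (S.D (s.2.1, s.2.2)) (S.D (t.2.1, t.2.2)))
    (fun s s' t => by
      simp only [b, Prod.fst_add, Prod.snd_add, Submodule.coe_add, map_add, inner_add_left,
        inner_add_right, ← Prod.mk_add_mk]; ring)
    (fun c s t => by
      simp only [b, Prod.smul_fst, Prod.smul_snd, Submodule.coe_smul, map_smul, inner_smul_left,
        inner_smul_right, ← Prod.smul_mk, conj_trivial, smul_eq_mul]; ring)
    (fun s t t' => by
      simp only [b, Prod.fst_add, Prod.snd_add, Submodule.coe_add, map_add, inner_add_left,
        inner_add_right, ← Prod.mk_add_mk]; ring)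
    (fun c s t => by
      simp only [b, Prod.smul_fst, Prod.smul_snd, Submodule.coe_smul, map_smul, inner_smul_left,
        inner_smul_right, ← Prod.smul_mk, conj_trivial, smul_eq_mul]; ring)

lemma form_apply (r : ℝ) (s t : S.Q × S.V × S.Zh) : S.form r s t =
    inner ℝ (S.A s.1) (S.J t.1) + S.b t.1 s.2.1 s.2.2 + S.b s.1 t.2.1 t.2.2 -
      r * inner ℝ (S.D (s.2.1, s.2.2)) (S.D (t.2.1, t.2.2)) := rfl

lemma b_zero_left (u : Y) (z : Z) : S.b 0 u z = 0 := by simp [b]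

lemma b_zero_right (q : X) : S.b q 0 0 = 0 := by simp [b, ← Prod.zero_eq_mk]

theorem existsUnique_isSolution (hlo : 0 < lo) (hCP : 0 ≤ CP) {r : ℝ} (hr : 0 < r)
    (ℓ : Y →ₗ[ℝ] ℝ) : ∃! s : X × Y × Z, S.IsSolution r ℓ s.1 s.2.1 s.2.2 := by
  have := S.finQ
  have := S.finV
  have := S.finZ
  have hB : ∀ s, (∀ t, S.form r s t = 0) → s = 0 := by
    rintro ⟨p, u, z⟩ h
    -- The sign change cancels the two `b` terms and makes the stabilization positive, so the energy
    -- and `D` both vanish.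
    have h1 := h (p, -u, -z)
    have hn : (-(u : Y), -(z : Z)) = -((u : Y), (z : Z)) := rfl
    simp only [form_apply, b, Submodule.coe_neg, hn] at h1
    simp only [map_neg, inner_neg_left, inner_neg_right, real_inner_self_eq_norm_sq] at h1
    have ha0 := S.energy_nonneg hlo p
    have hs0 : 0 ≤ r * ‖S.D ((u : Y), (z : Z))‖ ^ 2 := by positivity
    have ha : inner ℝ (S.A p) (S.J p) = 0 := by linarith
    have hs : r * ‖S.D ((u : Y), (z : Z))‖ ^ 2 = 0 := by linarith
    have hD : S.D ((u : Y), (z : Z)) = 0 := by simpa [hr.ne'] using hs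
    have hp := S.J_eq_zero_of_energy ha
    -- With flux and `D` gone, this test leaves the squared norm of the broken gradient.
    have h2 := h (⟨S.grad u, S.grad_mem u u.2⟩, 0, 0)
    simp only [form_apply, hp, hD, inner_zero_left, inner_zero_right, mul_zero, map_zero, zero_add,
      sub_zero, b, add_zero, inner_self_eq_zero] at h2
    obtain ⟨hu, hz⟩ := S.eq_zero_of_norm_eq_zero hCP u.2 z.2 hD h2
    exact Prod.ext (Subtype.ext hp) (Prod.ext (Subtype.ext hu) (Subtype.ext hz))
  let L : (S.Q × S.V × S.Zh) →ₗ[ℝ] ℝ :=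
    -(ℓ ∘ₗ S.V.subtype ∘ₗ LinearMap.fst ℝ S.V S.Zh ∘ₗ LinearMap.snd ℝ S.Q (S.V × S.Zh))
  have hL : ∀ t, L t = -ℓ t.2.1 := fun t => rfl
  have hiff : ∀ s : S.Q × S.V × S.Zh, (∀ t, S.form r s t = L t) ↔
      S.IsSolution r ℓ s.1 s.2.1 s.2.2 := by
    rintro ⟨p, u, z⟩
    constructor
    · intro h
      refine ⟨p.2, u.2, z.2, fun q hq => ?_, fun v hv y hy => ?_⟩
      · have := h (⟨q, hq⟩, 0, 0)
        simpa [form_apply, hL, b_zero_right, ← Prod.zero_eq_mk] using this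
      · have := h (0, ⟨v, hv⟩, ⟨y, hy⟩)
        simpa [form_apply, hL, b_zero_left] using this
    · intro h t
      have h1 := h.2.2.2.1 t.1 t.1.2
      have h2 := h.2.2.2.2 t.2.1 t.2.1.2 t.2.2 t.2.2.2
      rw [form_apply, hL]
      simp only at h1 h2 ⊢
      linarith
  obtain ⟨s, hs, huniq⟩ := existsUnique_of_nondegenerate (S.form r) hB L
  refine ⟨(s.1, s.2.1, s.2.2), (hiff s).1 hs, ?_⟩
  rintro ⟨p, u, z⟩ h
  have := huniq (⟨p, h.1⟩, ⟨u, h.2.1⟩, ⟨z, h.2.2.1⟩) ((hiff _).2 h)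
  rw [← this]

/-- The conforming equations as one bilinear form. -/
noncomputable def conformingForm : (S.Q × S.Vc) →ₗ[ℝ] (S.Q × S.Vc) →ₗ[ℝ] ℝ :=
  LinearMap.mk₂ ℝ
    (fun s t => inner ℝ (S.A s.1) (S.J t.1) + inner ℝ (S.J (S.grad s.2)) (S.J t.1) -
      inner ℝ (S.J s.1) (S.J (S.grad t.2)))
    (fun s s' t => by
      simp only [Prod.fst_add, Prod.snd_add, Submodule.coe_add, map_add, inner_add_left]; ring)
    (fun c s t => by
      simp only [Prod.smul_fst, Prod.smul_snd, Submodule.coe_smul, map_smul, inner_smul_left,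
        conj_trivial, smul_eq_mul]; ring)
    (fun s t t' => by
      simp only [Prod.fst_add, Prod.snd_add, Submodule.coe_add, map_add, inner_add_right]; ring)
    (fun c s t => by
      simp only [Prod.smul_fst, Prod.smul_snd, Submodule.coe_smul, map_smul, inner_smul_right,
        smul_eq_mul]; ring)

lemma conformingForm_apply (s t : S.Q × S.Vc) : S.conformingForm s t =
    inner ℝ (S.A s.1) (S.J t.1) + inner ℝ (S.J (S.grad s.2)) (S.J t.1) -
      inner ℝ (S.J s.1) (S.J (S.grad t.2)) := rfl

theorem existsUnique_isConformingSolution (ℓ : Y →ₗ[ℝ] ℝ) :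
    ∃! s : X × Y, S.IsConformingSolution ℓ s.1 s.2 := by
  have := S.finQ
  have := S.finVc
  have hB : ∀ s, (∀ t, S.conformingForm s t = 0) → s = 0 := by
    rintro ⟨p, u⟩ h
    -- The mixed terms cancel, so the flux vanishes. Testing with the gradient and Poincaré then
    -- give `u = 0`.
    have h1 := h (p, u)
    simp only [conformingForm_apply, real_inner_comm (S.J (p : X)) (S.J (S.grad u))] at h1
    have hp := S.J_eq_zero_of_energy (p := (p : X)) (by linarith)
    have h2 := h (⟨S.grad u, S.grad_mem u (S.Vc_le u.2)⟩, 0)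
    simp only [conformingForm_apply, hp, map_zero, inner_zero_left, zero_add, sub_zero,
      inner_self_eq_zero] at h2
    have h3 := S.poincare u u.2
    rw [h2, norm_zero, mul_zero] at h3
    exact Prod.ext (Subtype.ext hp) (Subtype.ext (S.I_inj u (norm_le_zero_iff.1 h3)))
  let L : (S.Q × S.Vc) →ₗ[ℝ] ℝ := ℓ ∘ₗ S.Vc.subtype ∘ₗ LinearMap.snd ℝ S.Q S.Vc
  have hL : ∀ t, L t = ℓ t.2 := fun t => rfl
  have hiff : ∀ s : S.Q × S.Vc, (∀ t, S.conformingForm s t = L t) ↔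
      S.IsConformingSolution ℓ s.1 s.2 := by
    rintro ⟨p, u⟩
    constructor
    · intro h
      refine ⟨p.2, u.2, fun q hq => ?_, fun v hv => ?_⟩
      · have := h (⟨q, hq⟩, 0)
        simpa [conformingForm_apply, hL] using this
      · have := h (0, ⟨v, hv⟩)
        simpa [conformingForm_apply, hL] using this
    · intro h t
      have h1 := h.2.2.1 t.1 t.1.2
      have h2 := h.2.2.2 t.2 t.2.2
      rw [conformingForm_apply, hL]
      simp only at h1 h2 ⊢
      linarith
  obtain ⟨s, hs, huniq⟩ := existsUnique_of_nondegenerate S.conformingForm hB L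
  refine ⟨(s.1, s.2), (hiff s).1 hs, ?_⟩
  rintro ⟨p, u⟩ h
  have := huniq (⟨p, h.1⟩, ⟨u, h.2.1⟩) ((hiff _).2 h)
  rw [← this]

end DiscreteSetting

/-! ### Bounds and measurability for the inverse matrix -/

section Inverse

variable {d : ℕ} {A : Matrix (Fin d) (Fin d) ℝ} {lo hi : ℝ}

lemma dotProduct_self_nonneg_real (ξ : Fin d → ℝ) : 0 ≤ ξ ⬝ᵥ ξ :=
  Finset.sum_nonneg fun _ _ => mul_self_nonneg _

lemma isUnit_det_of_lower (hlo : 0 < lo) (h : ∀ ξ : Fin d → ℝ, lo * (ξ ⬝ᵥ ξ) ≤ ξ ⬝ᵥ (A *ᵥ ξ)) :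
    IsUnit A.det := by
  rw [isUnit_iff_ne_zero]
  intro h0
  obtain ⟨ξ, hξ, hA⟩ := Matrix.exists_mulVec_eq_zero_iff.2 h0
  have h1 := h ξ
  rw [hA, dotProduct_zero] at h1
  have h2 : ξ ⬝ᵥ ξ = 0 := le_antisymm (by nlinarith) (dotProduct_self_nonneg_real ξ)
  exact hξ (dotProduct_self_eq_zero.1 h2)

/-- The lower bound for `A` evaluated at `A⁻¹ *ᵥ ξ`. -/
lemma inv_mulVec_lower (hlo : 0 < lo) (h : ∀ ξ : Fin d → ℝ, lo * (ξ ⬝ᵥ ξ) ≤ ξ ⬝ᵥ (A *ᵥ ξ))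
    (ξ : Fin d → ℝ) : lo * ((A⁻¹ *ᵥ ξ) ⬝ᵥ (A⁻¹ *ᵥ ξ)) ≤ (A⁻¹ *ᵥ ξ) ⬝ᵥ ξ := by
  have h1 := h (A⁻¹ *ᵥ ξ)
  rwa [Matrix.mulVec_mulVec, Matrix.mul_nonsing_inv _ (isUnit_det_of_lower hlo h),
    Matrix.one_mulVec] at h1

lemma inv_mulVec_upper (hlo : 0 < lo) (hhi : 0 < hi) (hs : A.IsSymm)
    (h : ∀ ξ : Fin d → ℝ, lo * (ξ ⬝ᵥ ξ) ≤ ξ ⬝ᵥ (A *ᵥ ξ))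
    (h' : ∀ ξ : Fin d → ℝ, ξ ⬝ᵥ (A *ᵥ ξ) ≤ hi * (ξ ⬝ᵥ ξ)) (ξ : Fin d → ℝ) :
    ξ ⬝ᵥ ξ ≤ hi * ((A⁻¹ *ᵥ ξ) ⬝ᵥ ξ) := by
  set η := A⁻¹ *ᵥ ξ with hη
  have hAη : A *ᵥ η = ξ := by
    rw [hη, Matrix.mulVec_mulVec, Matrix.mul_nonsing_inv _ (isUnit_det_of_lower hlo h),
      Matrix.one_mulVec]
  have hsym : η ⬝ᵥ (A *ᵥ ξ) = ξ ⬝ᵥ ξ := by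
    rw [Matrix.dotProduct_mulVec, ← Matrix.mulVec_transpose, hs.eq, hAη]
  -- Positivity of `A` at ξ − hi·η expands to 0 ≤ ξ·Aξ − 2 hi ξ·ξ + hi² η·ξ. Here ξ·Aξ ≤ hi ξ·ξ, and
  -- one factor hi cancels.
  have h0 : 0 ≤ (ξ - hi • η) ⬝ᵥ (A *ᵥ (ξ - hi • η)) :=
    (mul_nonneg hlo.le (dotProduct_self_nonneg_real _)).trans (h _)
  rw [Matrix.mulVec_sub, Matrix.mulVec_smul, hAη, sub_dotProduct, dotProduct_sub, dotProduct_sub,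
    smul_dotProduct, smul_dotProduct, dotProduct_smul, dotProduct_smul, hsym] at h0
  have h1 := h' ξ
  simp only [smul_eq_mul] at h0
  have h2 : hi * (ξ ⬝ᵥ ξ) ≤ hi * (hi * (η ⬝ᵥ ξ)) := by nlinarith
  exact le_of_mul_le_mul_left h2 hhi

lemma inv_mulVec_sq_le (hlo : 0 < lo) (h : ∀ ξ : Fin d → ℝ, lo * (ξ ⬝ᵥ ξ) ≤ ξ ⬝ᵥ (A *ᵥ ξ))
    (ξ : Fin d → ℝ) : (A⁻¹ *ᵥ ξ) ⬝ᵥ (A⁻¹ *ᵥ ξ) ≤ (lo ^ 2)⁻¹ * (ξ ⬝ᵥ ξ) := by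
  have h1 := inv_mulVec_lower hlo h ξ
  set η := A⁻¹ *ᵥ ξ
  have h2 : 0 ≤ (ξ - lo • η) ⬝ᵥ (ξ - lo • η) := dotProduct_self_nonneg_real _
  rw [sub_dotProduct, dotProduct_sub, dotProduct_sub, smul_dotProduct, smul_dotProduct,
    dotProduct_smul, dotProduct_smul, dotProduct_comm ξ η] at h2
  simp only [smul_eq_mul] at h2
  rw [inv_mul_eq_div, le_div_iff₀ (by positivity)]
  nlinarith

lemma aemeasurable_det {X : Type*} [MeasurableSpace X] {μ : Measure X}
    {B : X → Matrix (Fin d) (Fin d) ℝ} (hB : ∀ i j, AEMeasurable (fun x => B x i j) μ) :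
    AEMeasurable (fun x => (B x).det) μ := by
  simp only [Matrix.det_apply']
  exact Finset.aemeasurable_fun_sum _ fun σ _ =>
    (Finset.aemeasurable_fun_prod _ fun i _ => hB _ _).const_mul _

/-- Cramer's rule: the entries are quotients of determinants in the entries of `B`. -/
lemma aemeasurable_inv_apply {X : Type*} [MeasurableSpace X] {μ : Measure X}
    {B : X → Matrix (Fin d) (Fin d) ℝ} (hB : ∀ i j, AEMeasurable (fun x => B x i j) μ)
    (i j : Fin d) : AEMeasurable (fun x => (B x)⁻¹ i j) μ := by
  simp only [Matrix.inv_def, Matrix.smul_apply, Ring.inverse_eq_inv', smul_eq_mul,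
    Matrix.adjugate_apply]
  refine (aemeasurable_det hB).inv.mul (aemeasurable_det fun k l => ?_)
  by_cases hk : k = j
  · subst hk; simp
  · simpa [Matrix.updateRow_ne hk] using hB k l

end Inverse

/-! ### Polynomials, fluxes and traces as elements of L² -/

section Lp

variable {d : ℕ}

/-- The polynomial functions in `L²` of a compact set. -/
noncomputable def cellLp (K : Finset (E d)) : Poly d →ₗ[ℝ] Lp ℝ 2 (volume.restrict (hull K)) where
  toFun p := (memLp_ev_restrict (isCompact_hull K) p).toLp _
  map_add' p q := by rw [← MemLp.toLp_add]; congr 1; ext x; simp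
  map_smul' c p := by rw [RingHom.id_apply, ← MemLp.toLp_const_smul]; congr 1; ext x; simp

lemma cellLp_ae (K : Finset (E d)) (p : Poly d) :
    cellLp K p =ᵐ[volume.restrict (hull K)] ev p :=
  MemLp.coeFn_toLp (memLp_ev_restrict (isCompact_hull K) p)

lemma inner_eq_integral_of_ae {X : Type*} [MeasurableSpace X] {μ : Measure X} (F G : Lp ℝ 2 μ)
    {f g : X → ℝ} (hf : F =ᵐ[μ] f) (hg : G =ᵐ[μ] g) : inner ℝ F G = ∫ x, f x * g x ∂μ := by
  rw [L2.inner_def]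
  refine integral_congr_ae ?_
  filter_upwards [hf, hg] with x hx hy
  rw [hx, hy]
  simp [mul_comm]

lemma inner_cellLp (K : Finset (E d)) (p q : Poly d) :
    inner ℝ (cellLp K p) (cellLp K q) = ∫ x in hull K, ev p x * ev q x :=
  inner_eq_integral_of_ae _ _ (cellLp_ae K p) (cellLp_ae K q)

end Lp

namespace Triangulation

variable {d : ℕ} {Ω : Set (E d)} {T : Triangulation Ω}

section Flux

variable {α : E d → Matrix (Fin d) (Fin d) ℝ} {lo : ℝ}

/-- By uniform ellipticity the field `c q` is dominated almost everywhere on the cell by a multiple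
of the polynomial field `q`. -/
lemma memLp_inv_mulVec (hreg : interior (closure Ω) = Ω)
    (hm : ∀ i j, AEMeasurable (fun x => α x i j) (volume.restrict Ω)) (hlo : 0 < lo)
    (h : ∀ x ∈ Ω, ∀ ξ : Fin d → ℝ, lo * (ξ ⬝ᵥ ξ) ≤ ξ ⬝ᵥ (α x *ᵥ ξ)) (K : T.cells)
    (q : Fin d → Poly d) (i : Fin d) :
    MemLp (fun x => ((α x)⁻¹ *ᵥ evVec q x) i) 2 (volume.restrict (hull K.1)) := by
  have hev := fun p : Poly d => continuous_ev p
  have hmeas : AEStronglyMeasurable (fun x => ((α x)⁻¹ *ᵥ evVec q x) i)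
      (volume.restrict (hull K.1)) := by
    have : AEMeasurable (fun x => ((α x)⁻¹ *ᵥ evVec q x) i) (volume.restrict (hull K.1)) := by
      simp only [Matrix.mulVec, dotProduct, evVec]
      refine Finset.aemeasurable_fun_sum _ fun j _ => ?_
      exact ((aemeasurable_inv_apply hm i j).mono_measure (restrict_hull_le hreg K)).mul
        (continuous_ev _).aemeasurable
    exact this.aestronglyMeasurable
  refine (memLp_two_iff_integrable_sq hmeas).2 ?_
  have hFint : Integrable (fun x => (lo ^ 2)⁻¹ * (evVec q x ⬝ᵥ evVec q x))
      (volume.restrict (hull K.1)) := by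
    refine Continuous.integrableOn_hull ?_ K.1
    simp only [dotProduct, evVec]
    fun_prop
  refine hFint.mono' (hmeas.pow 2) ?_
  filter_upwards [ae_mem_of_mem_hull hreg K] with x hx
  rw [Real.norm_of_nonneg (sq_nonneg _)]
  refine le_trans ?_ (inv_mulVec_sq_le hlo (h x hx) _)
  rw [sq]
  exact Finset.single_le_sum (f := fun i => ((α x)⁻¹ *ᵥ evVec q x) i * ((α x)⁻¹ *ᵥ evVec q x) i)
    (fun i _ => mul_self_nonneg _) (Finset.mem_univ i)

/-- The components of `c q` on a cell as elements of `L²`. -/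
noncomputable def fluxLp (hreg : interior (closure Ω) = Ω)
    (hm : ∀ i j, AEMeasurable (fun x => α x i j) (volume.restrict Ω)) (hlo : 0 < lo)
    (h : ∀ x ∈ Ω, ∀ ξ : Fin d → ℝ, lo * (ξ ⬝ᵥ ξ) ≤ ξ ⬝ᵥ (α x *ᵥ ξ)) (K : T.cells) (i : Fin d) :
    (Fin d → Poly d) →ₗ[ℝ] Lp ℝ 2 (volume.restrict (hull K.1)) where
  toFun q := (memLp_inv_mulVec hreg hm hlo h K q i).toLp _
  map_add' p q := by
    rw [← MemLp.toLp_add]; congr 1; ext x; simp [evVec_add, Matrix.mulVec_add]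
  map_smul' c p := by
    rw [RingHom.id_apply, ← MemLp.toLp_const_smul]; congr 1; ext x
    simp [evVec_smul, Matrix.mulVec_smul]

lemma fluxLp_ae (hreg : interior (closure Ω) = Ω)
    (hm : ∀ i j, AEMeasurable (fun x => α x i j) (volume.restrict Ω)) (hlo : 0 < lo)
    (h : ∀ x ∈ Ω, ∀ ξ : Fin d → ℝ, lo * (ξ ⬝ᵥ ξ) ≤ ξ ⬝ᵥ (α x *ᵥ ξ)) (K : T.cells) (i : Fin d)
    (q : Fin d → Poly d) : fluxLp hreg hm hlo h K i q =ᵐ[volume.restrict (hull K.1)]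
      fun x => ((α x)⁻¹ *ᵥ evVec q x) i :=
  MemLp.coeFn_toLp (memLp_inv_mulVec hreg hm hlo h K q i)

end Flux

/-- The polynomial functions in `L²` of a facet. -/
noncomputable def facetLp (hd : 1 ≤ d) (e : T.facets) : Poly d →ₗ[ℝ] Lp ℝ 2 (facetMeasure e.1) where
  toFun p := (memLp_facet hd e (continuous_ev p)).toLp _
  map_add' p q := by rw [← MemLp.toLp_add]; congr 1; ext x; simp
  map_smul' c p := by rw [RingHom.id_apply, ← MemLp.toLp_const_smul]; congr 1; ext x; simp

lemma facetLp_ae (hd : 1 ≤ d) (e : T.facets) (p : Poly d) :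
    facetLp hd e p =ᵐ[facetMeasure e.1] ev p :=
  MemLp.coeFn_toLp (memLp_facet hd e (continuous_ev p))

variable (T) in
/-- Square integrable vector fields on the cells. -/
abbrev VectSpace := PiLp 2 fun Ki : T.cells × Fin d => Lp ℝ 2 (volume.restrict (hull Ki.1.1))

variable (T) in
/-- Square integrable functions on the cells. -/
abbrev ScalSpace := PiLp 2 fun K : T.cells => Lp ℝ 2 (volume.restrict (hull K.1))

variable (T) in
/-- Square integrable functions on the boundaries of the cells. -/
abbrev TraceSpace := PiLp 2 fun Ke : T.cells × T.facets => Lp ℝ 2 (facetMeasure Ke.2.1)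

/-- A linear map into a Hilbert sum, by components. -/
noncomputable def piMap {ι M : Type*} [Fintype ι] [AddCommGroup M] [Module ℝ M] {H : ι → Type*}
    [∀ i, NormedAddCommGroup (H i)] [∀ i, InnerProductSpace ℝ (H i)] (f : ∀ i, M →ₗ[ℝ] H i) :
    M →ₗ[ℝ] PiLp 2 H := (WithLp.linearEquiv 2 ℝ (∀ i, H i)).symm.toLinearMap ∘ₗ LinearMap.pi f

lemma piMap_apply {ι M : Type*} [Fintype ι] [AddCommGroup M] [Module ℝ M] {H : ι → Type*}
    [∀ i, NormedAddCommGroup (H i)] [∀ i, InnerProductSpace ℝ (H i)] (f : ∀ i, M →ₗ[ℝ] H i)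
    (m : M) (i : ι) : piMap f m i = f i m := rfl

lemma inner_piMap {ι M M' : Type*} [Fintype ι] [AddCommGroup M] [Module ℝ M] [AddCommGroup M']
    [Module ℝ M'] {H : ι → Type*} [∀ i, NormedAddCommGroup (H i)]
    [∀ i, InnerProductSpace ℝ (H i)] (f : ∀ i, M →ₗ[ℝ] H i) (g : ∀ i, M' →ₗ[ℝ] H i) (m : M)
    (m' : M') : inner ℝ (piMap f m) (piMap g m') = ∑ i, inner ℝ (f i m) (g i m') :=
  PiLp.inner_apply _ _

/-- A piecewise polynomial vector field as a square integrable field. -/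
noncomputable def vectMap : T.Vect →ₗ[ℝ] T.VectSpace :=
  piMap fun Ki => cellLp Ki.1.1 ∘ₗ LinearMap.proj Ki.2 ∘ₗ LinearMap.proj Ki.1

/-- A piecewise polynomial as a square integrable function. -/
noncomputable def scalMap : T.Scal →ₗ[ℝ] T.ScalSpace :=
  piMap fun K => cellLp K.1 ∘ₗ LinearMap.proj K

/-- The field `c q` of a piecewise polynomial field `q`. -/
noncomputable def fluxMap {α : E d → Matrix (Fin d) (Fin d) ℝ} {lo : ℝ}
    (hreg : interior (closure Ω) = Ω)
    (hm : ∀ i j, AEMeasurable (fun x => α x i j) (volume.restrict Ω)) (hlo : 0 < lo)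
    (h : ∀ x ∈ Ω, ∀ ξ : Fin d → ℝ, lo * (ξ ⬝ᵥ ξ) ≤ ξ ⬝ᵥ (α x *ᵥ ξ)) : T.Vect →ₗ[ℝ] T.VectSpace :=
  piMap fun Ki => fluxLp hreg hm hlo h Ki.1 Ki.2 ∘ₗ LinearMap.proj Ki.1

open Classical in
/-- The normal traces of a field, scaled by `h_K^{1/2}`. -/
noncomputable def normalTraceMap (hd : 1 ≤ d) : T.Vect →ₗ[ℝ] T.TraceSpace :=
  piMap fun Ke => if Ke.2.1 ⊆ Ke.1.1 then √(T.hCell Ke.1) •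
    ∑ i, normal Ke.1.1 Ke.2.1 i • (facetLp hd Ke.2 ∘ₗ LinearMap.proj i ∘ₗ LinearMap.proj Ke.1)
    else 0

open Classical in
/-- The difference between the trace of a potential and a function on the skeleton, scaled by
`h_K^{-1/2}`. -/
noncomputable def diffTraceMap (hd : 1 ≤ d) : T.Scal × T.Skel →ₗ[ℝ] T.TraceSpace :=
  piMap fun Ke => if Ke.2.1 ⊆ Ke.1.1 then (√(T.hCell Ke.1))⁻¹ •
    (facetLp hd Ke.2 ∘ₗ LinearMap.proj Ke.1 ∘ₗ LinearMap.fst ℝ T.Scal T.Skel -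
      LinearMap.proj Ke.2 ∘ₗ LinearMap.snd ℝ T.Scal T.Skel)
    else 0

/-- The piecewise gradient as a linear map. -/
noncomputable def gradMap : T.Scal →ₗ[ℝ] T.Vect where
  toFun := gradh
  map_add' u v := by ext1 K; ext1 i; simp [gradh]
  map_smul' c v := by ext1 K; ext1 i; simp [gradh]

lemma inner_vectMap (q r : T.Vect) : inner ℝ (vectMap q) (vectMap r) = inV q r := by
  rw [vectMap, inner_piMap, Fintype.sum_prod_type, inV]
  refine Finset.sum_congr rfl fun K _ => ?_
  simp only [dotProduct, evVec]
  rw [integral_finsetSum _ fun i _ => integrable_mul_of_memLp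
    (memLp_ev_restrict (isCompact_hull K.1) (q K i))
    (memLp_ev_restrict (isCompact_hull K.1) (r K i))]
  exact Finset.sum_congr rfl fun i _ => inner_cellLp _ _ _

lemma inner_scalMap (v w : T.Scal) : inner ℝ (scalMap v) (scalMap w) = inS v w := by
  rw [scalMap, inner_piMap, inS]
  exact Finset.sum_congr rfl fun K _ => inner_cellLp _ _ _

section Flux

variable {α : E d → Matrix (Fin d) (Fin d) ℝ} {lo hi : ℝ} (hreg : interior (closure Ω) = Ω)
  (hm : ∀ i j, AEMeasurable (fun x => α x i j) (volume.restrict Ω)) (hlo : 0 < lo)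
  (h : ∀ x ∈ Ω, ∀ ξ : Fin d → ℝ, lo * (ξ ⬝ᵥ ξ) ≤ ξ ⬝ᵥ (α x *ᵥ ξ))

lemma inner_fluxMap (p q : T.Vect) :
    inner ℝ (fluxMap hreg hm hlo h p) (vectMap q) = aForm α p q := by
  rw [fluxMap, vectMap, inner_piMap, Fintype.sum_prod_type, aForm]
  refine Finset.sum_congr rfl fun K _ => ?_
  simp only [dotProduct, evVec.eq_def (q K)]
  rw [integral_finsetSum _ fun i _ => integrable_mul_of_memLp
    (memLp_inv_mulVec hreg hm hlo h K (p K) i) (memLp_ev_restrict (isCompact_hull K.1) (q K i))]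
  exact Finset.sum_congr rfl fun i _ => inner_eq_integral_of_ae _ _
    (fluxLp_ae hreg hm hlo h K i (p K)) (cellLp_ae _ _)

lemma fluxMap_lower (p : T.Vect) : lo * ‖fluxMap hreg hm hlo h p‖ ^ 2 ≤
    inner ℝ (fluxMap hreg hm hlo h p) (vectMap p) := by
  rw [inner_fluxMap, ← real_inner_self_eq_norm_sq, fluxMap, inner_piMap, Fintype.sum_prod_type,
    aForm, Finset.mul_sum]
  refine Finset.sum_le_sum fun K _ => ?_
  have hL := fun i => memLp_inv_mulVec hreg hm hlo h K (p K) i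
  have e1 : ∑ i, inner ℝ (fluxLp hreg hm hlo h K i (p K)) (fluxLp hreg hm hlo h K i (p K)) =
      ∫ x in hull K.1, ((α x)⁻¹ *ᵥ evVec (p K) x) ⬝ᵥ ((α x)⁻¹ *ᵥ evVec (p K) x) := by
    simp only [dotProduct]
    rw [integral_finsetSum _ fun i _ => integrable_mul_of_memLp (hL i) (hL i)]
    exact Finset.sum_congr rfl fun i _ => inner_eq_integral_of_ae _ _
      (fluxLp_ae hreg hm hlo h K i (p K)) (fluxLp_ae hreg hm hlo h K i (p K))
  refine (congrArg (lo * ·) e1).le.trans ?_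
  rw [← integral_const_mul]
  refine integral_mono_ae ?_ ?_ ?_
  · refine Integrable.const_mul ?_ _
    simp only [dotProduct]
    exact integrable_finsetSum _ fun i _ => integrable_mul_of_memLp (hL i) (hL i)
  · simp only [dotProduct]
    exact integrable_finsetSum _ fun i _ => integrable_mul_of_memLp (hL i)
      (memLp_ev_restrict (isCompact_hull K.1) (p K i))
  · filter_upwards [ae_mem_of_mem_hull hreg K] with x hx
    exact inv_mulVec_lower hlo (h x hx) _

lemma fluxMap_upper (hhi : 0 < hi) (hs : ∀ x ∈ Ω, (α x).IsSymm)
    (h' : ∀ x ∈ Ω, ∀ ξ : Fin d → ℝ, ξ ⬝ᵥ (α x *ᵥ ξ) ≤ hi * (ξ ⬝ᵥ ξ)) (p : T.Vect) :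
    ‖vectMap p‖ ^ 2 ≤ hi * inner ℝ (fluxMap hreg hm hlo h p) (vectMap p) := by
  have hL := fun K i => memLp_inv_mulVec (T := T) hreg hm hlo h K (p K) i
  rw [inner_fluxMap, ← real_inner_self_eq_norm_sq, inner_vectMap, inV, aForm, Finset.mul_sum]
  refine Finset.sum_le_sum fun K _ => ?_
  rw [← integral_const_mul]
  refine integral_mono_ae ?_ ?_ ?_
  · simp only [dotProduct]
    exact integrable_finsetSum _ fun i _ => integrable_mul_of_memLp
      (memLp_ev_restrict (isCompact_hull K.1) (p K i))
      (memLp_ev_restrict (isCompact_hull K.1) (p K i))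
  · refine Integrable.const_mul ?_ _
    simp only [dotProduct]
    exact integrable_finsetSum _ fun i _ => integrable_mul_of_memLp (hL K i)
      (memLp_ev_restrict (isCompact_hull K.1) (p K i))
  · filter_upwards [ae_mem_of_mem_hull hreg K] with x hx
    exact inv_mulVec_upper hlo hhi (hs x hx) (h x hx) (h' x hx) _

end Flux

end Triangulation

/-! ### The bilinear forms in terms of the L² maps -/

namespace Triangulation

variable {d : ℕ} {Ω : Set (E d)} {T : Triangulation Ω}

lemma vectMap_eq_zero {p : T.Vect} (h : vectMap p = 0) : p = 0 := by
  ext1 K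
  ext1 i
  have h1 : cellLp K.1 (p K i) = 0 := congrArg (fun v : T.VectSpace => v (K, i)) h
  refine eq_zero_of_ae_ev_eq_zero (interior_hull_nonempty K)
    ((cellLp_ae K.1 (p K i)).symm.trans ?_)
  rw [h1]
  exact Lp.coeFn_zero _ _ _

lemma scalMap_eq_zero {v : T.Scal} (h : scalMap v = 0) : v = 0 := by
  ext1 K
  have h1 : cellLp K.1 (v K) = 0 := congrArg (fun v : T.ScalSpace => v K) h
  refine eq_zero_of_ae_ev_eq_zero (interior_hull_nonempty K)
    ((cellLp_ae K.1 (v K)).symm.trans ?_)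
  rw [h1]
  exact Lp.coeFn_zero _ _ _

lemma diffTraceMap_apply (hd : 1 ≤ d) (u : T.Scal) (z : T.Skel) {K : T.cells} {e : T.facets}
    (h : e.1 ⊆ K.1) : diffTraceMap hd (u, z) (K, e) =
      (√(T.hCell K))⁻¹ • (facetLp hd e (u K) - z e) := by
  rw [diffTraceMap, piMap_apply, if_pos h]
  rfl

lemma diffTraceMap_apply_of_not (hd : 1 ≤ d) (uz : T.Scal × T.Skel) {K : T.cells} {e : T.facets}
    (h : ¬ e.1 ⊆ K.1) : diffTraceMap hd uz (K, e) = 0 := by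
  rw [diffTraceMap, piMap_apply, if_neg h]
  rfl

lemma normalTraceMap_apply (hd : 1 ≤ d) (q : T.Vect) {K : T.cells} {e : T.facets}
    (h : e.1 ⊆ K.1) : normalTraceMap hd q (K, e) =
      √(T.hCell K) • ∑ i, normal K.1 e.1 i • facetLp hd e (q K i) := by
  rw [normalTraceMap, piMap_apply, if_pos h]
  simp

lemma normalTraceMap_apply_of_not (hd : 1 ≤ d) (q : T.Vect) {K : T.cells} {e : T.facets}
    (h : ¬ e.1 ⊆ K.1) : normalTraceMap hd q (K, e) = 0 := by
  rw [normalTraceMap, piMap_apply, if_neg h]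
  rfl

open Classical in
lemma sum_pairs_eq (F : T.cells → T.facets → ℝ) (G : T.cells × T.facets → ℝ)
    (h1 : ∀ K e, e.1 ⊆ K.1 → G (K, e) = F K e) (h0 : ∀ K e, ¬ e.1 ⊆ K.1 → G (K, e) = 0) :
    ∑ Ke, G Ke = ∑ K : T.cells, ∑ e : T.facets with e.1 ⊆ K.1, F K e := by
  rw [Fintype.sum_prod_type]
  refine Finset.sum_congr rfl fun K _ => ?_
  rw [Finset.sum_filter]
  refine Finset.sum_congr rfl fun e _ => ?_
  split_ifs with h
  · exact h1 K e h
  · exact h0 K e h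

lemma facetLp_sub_ae (hd : 1 ≤ d) (u : Poly d) {e : T.facets} (z : Lp ℝ 2 (facetMeasure e.1)) :
    (facetLp hd e u - z : Lp ℝ 2 (facetMeasure e.1)) =ᵐ[facetMeasure e.1]
      fun x => ev u x - z x := by
  filter_upwards [Lp.coeFn_sub (facetLp hd e u) z, facetLp_ae hd e u] with x h1 h2
  rw [h1, Pi.sub_apply, h2]

/-- Each factor carries h_K^{-1/2}; together they give the weight h_K⁻¹ of τ. -/
lemma stab_tau_eq (hd : 1 ≤ d) (ρ : ℝ) (u v : T.Scal) (z y : T.Skel) :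
    stab (tau T ρ) u z v y = ρ⁻¹ * inner ℝ (diffTraceMap hd (u, z)) (diffTraceMap hd (v, y)) := by
  classical
  rw [PiLp.inner_apply, sum_pairs_eq (fun K e => (T.hCell K)⁻¹ *
    ∫ x, (ev (u K) x - z e x) * (ev (v K) x - y e x) ∂(facetMeasure e.1)), stab, Finset.mul_sum]
  · refine Finset.sum_congr rfl fun K _ => ?_
    rw [tau, mul_assoc, Finset.mul_sum]
  · intro K e h
    simp only [diffTraceMap_apply hd _ _ h]
    rw [inner_smul_left, inner_smul_right, inner_eq_integral_of_ae _ _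
      (facetLp_sub_ae hd (u K) (z e)) (facetLp_sub_ae hd (v K) (y e)), conj_trivial, ← mul_assoc,
      ← mul_inv, Real.mul_self_sqrt (hCell_pos hd K).le]
  · intro K e h
    simp only [diffTraceMap_apply_of_not hd _ h, inner_zero_left]

lemma normalTrace_ae (hd : 1 ≤ d) (q : Fin d → Poly d) (e : T.facets) (n : E d) :
    (∑ i, n i • facetLp hd e (q i) : Lp ℝ 2 (facetMeasure e.1)) =ᵐ[facetMeasure e.1]
      fun x => evVec q x ⬝ᵥ fun i => n i := by
  have h : (∑ i, n i • facetLp hd e (q i)) = facetLp hd e (∑ i, n i • q i) := by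
    rw [map_sum]; simp only [map_smul]
  rw [h]
  filter_upwards [facetLp_ae hd e (∑ i, n i • q i)] with x hx
  rw [hx]
  simp [dotProduct, evVec, mul_comm]

open Classical in
-- The weights h_K^{-1/2} and h_K^{1/2} cancel, so the pairing is the unweighted boundary term of
-- `bForm`.
lemma inner_diffTraceMap_normalTraceMap (hd : 1 ≤ d) (u : T.Scal) (z : T.Skel) (q : T.Vect) :
    inner ℝ (diffTraceMap hd (u, z)) (normalTraceMap hd q) =
      ∑ K : T.cells, ∑ e : T.facets with e.1 ⊆ K.1, ∫ x, (ev (u K) x - z e x) *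
        (evVec (q K) x ⬝ᵥ fun i => normal K.1 e.1 i) ∂(facetMeasure e.1) := by
  rw [PiLp.inner_apply]
  refine sum_pairs_eq _ _ (fun K e h => ?_) fun K e h => ?_
  · simp only [diffTraceMap_apply hd _ _ h, normalTraceMap_apply hd _ h]
    rw [inner_smul_left, inner_smul_right, inner_eq_integral_of_ae _ _
      (facetLp_sub_ae hd (u K) (z e)) (normalTrace_ae hd (q K) e _), conj_trivial, ← mul_assoc,
      inv_mul_cancel₀ (Real.sqrt_pos.2 (hCell_pos hd K)).ne', one_mul]
  · simp only [diffTraceMap_apply_of_not hd _ h, inner_zero_left]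

open Classical in
/-- Integration by parts on a cell. -/
lemma integral_mul_div_add (hd : 1 ≤ d) (K : T.cells) (u : Poly d) (q : Fin d → Poly d) :
    (∫ x in hull K.1, evVec (fun i => MvPolynomial.pderiv i u) x ⬝ᵥ evVec q x) +
      ∫ x in hull K.1, ev u x * ev (∑ i, MvPolynomial.pderiv i (q i)) x =
    ∑ e : T.facets with e.1 ⊆ K.1, ∫ x, ev u x * (evVec q x ⬝ᵥ fun i => normal K.1 e.1 i)
      ∂(facetMeasure e.1) := by
  have hev := fun p : Poly d => continuous_ev p
  have hdiv := fun i => setIntegral_hull_derivative hd (T.card_eq K.1 K.2) (T.indep K.1 K.2)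
    (u * q i) (EuclideanSpace.single i 1)
  have hsingle : ∀ i x, ∑ j, (EuclideanSpace.single i (1 : ℝ) : E d) j *
      ev (MvPolynomial.pderiv j (u * q i)) x =
      ev (MvPolynomial.pderiv i u) x * ev (q i) x + ev u x * ev (MvPolynomial.pderiv i (q i)) x := by
    intro i x
    rw [Finset.sum_eq_single i]
    · simp [Derivation.leibniz]; ring
    · intro j _ hj; simp [hj]
    · simp
  simp only [hsingle, EuclideanSpace.inner_single_right, conj_trivial, one_mul] at hdiv
  rw [← integral_add]
  rotate_left
  · refine Continuous.integrableOn_hull ?_ K.1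
    simp only [dotProduct, evVec]; fun_prop
  · exact Continuous.integrableOn_hull (by fun_prop) K.1
  have e1 : ∀ x, evVec (fun i => MvPolynomial.pderiv i u) x ⬝ᵥ evVec q x +
      ev u x * ev (∑ i, MvPolynomial.pderiv i (q i)) x =
      ∑ i, (ev (MvPolynomial.pderiv i u) x * ev (q i) x +
        ev u x * ev (MvPolynomial.pderiv i (q i)) x) := by
    intro x
    simp [dotProduct, evVec, Finset.sum_add_distrib, Finset.mul_sum]
  simp only [e1]
  rw [integral_finsetSum _ fun i _ => Continuous.integrableOn_hull (by fun_prop) K.1]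
  simp only [hdiv]
  rw [Finset.sum_comm, ← sum_facets_of_cell K fun e => ∑ i, normal K.1 e i *
    ∫ x, ev (u * q i) x ∂(facetMeasure e)]
  refine Finset.sum_congr rfl fun e _ => ?_
  simp only [← integral_const_mul]
  rw [← integral_finsetSum]
  · congr 1
    ext x
    simp only [ev_mul, dotProduct, evVec, Finset.mul_sum]
    exact Finset.sum_congr rfl fun i _ => by ring
  · intro i _
    exact (integrable_facet hd e (continuous_ev _)).const_mul _

/-- Cellwise integration by parts moves the divergence onto `u`, and the boundary term for `u`
merges with the one for `z`. The result is the `b` of `DiscreteSetting`. -/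
lemma bForm_eq (hd : 1 ≤ d) (q : T.Vect) (u : T.Scal) (z : T.Skel) :
    bForm q u z = inner ℝ (vectMap (gradMap u)) (vectMap q) -
      inner ℝ (diffTraceMap hd (u, z)) (normalTraceMap hd q) := by
  classical
  have hev := fun p : Poly d => continuous_ev p
  have hn : ∀ (K : T.cells) (e : T.facets),
      Continuous fun x => evVec (q K) x ⬝ᵥ fun i => normal K.1 e.1 i := by
    intro K e
    simp only [dotProduct, evVec]; fun_prop
  rw [inner_vectMap, inner_diffTraceMap_normalTraceMap, bForm, inS, inV, ← Finset.sum_neg_distrib,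
    ← Finset.sum_add_distrib, ← Finset.sum_sub_distrib]
  refine Finset.sum_congr rfl fun K _ => ?_
  have h := integral_mul_div_add hd K (u K) (q K)
  have hsplit : ∀ e : T.facets, ∫ x, (ev (u K) x - z e x) *
      (evVec (q K) x ⬝ᵥ fun i => normal K.1 e.1 i) ∂(facetMeasure e.1) =
      (∫ x, ev (u K) x * (evVec (q K) x ⬝ᵥ fun i => normal K.1 e.1 i) ∂(facetMeasure e.1)) -
      ∫ x, z e x * (evVec (q K) x ⬝ᵥ fun i => normal K.1 e.1 i) ∂(facetMeasure e.1) := by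
    intro e
    rw [← integral_sub]
    · simp only [sub_mul]
    · exact integrable_facet hd e ((continuous_ev _).mul (hn K e))
    · exact integrable_mul_of_memLp (Lp.memLp (z e)) (memLp_facet hd e (hn K e))
  simp only [hsplit, Finset.sum_sub_distrib]
  rw [← h, show divh q K = ∑ i, MvPolynomial.pderiv i (q K i) from rfl,
    show gradMap u K = fun i => MvPolynomial.pderiv i (u K) from rfl]
  ring

/-- The discrete trace inequality for piecewise polynomial fields. -/
lemma exists_norm_normalTraceMap_le (hd : 1 ≤ d) (k : ℕ) {γ : ℝ} (hγ : 0 < γ) :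
    ∃ C : ℝ, 0 ≤ C ∧ ∀ (Ω : Set (E d)) (T : Triangulation Ω), T.ShapeRegular γ →
      ∀ q : T.Vect, (∀ K i, (q K i).totalDegree ≤ k) →
        ‖normalTraceMap hd q‖ ≤ C * ‖vectMap q‖ := by
  classical
  obtain ⟨C, hC, hCp⟩ := exists_trace_inequality hd k hγ
  -- The factor `d + 1` counts the facets of a cell.
  refine ⟨√((d + 1) * C), Real.sqrt_nonneg _, fun Ω T hT q hq => ?_⟩
  have hmain : ‖normalTraceMap hd q‖ ^ 2 ≤ (d + 1) * C * ‖vectMap q‖ ^ 2 := by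
    rw [← real_inner_self_eq_norm_sq, ← real_inner_self_eq_norm_sq, PiLp.inner_apply,
      PiLp.inner_apply, sum_pairs_eq (fun K e => T.hCell K *
        ‖∑ i, normal K.1 e.1 i • facetLp hd e (q K i)‖ ^ 2), Fintype.sum_prod_type,
      Finset.mul_sum]
    rotate_left
    · intro K e h
      simp only [normalTraceMap_apply hd _ h]
      rw [real_inner_self_eq_norm_sq, norm_smul, mul_pow, Real.norm_of_nonneg (Real.sqrt_nonneg _),
        Real.sq_sqrt (hCell_pos hd K).le]
    · intro K e h
      simp only [normalTraceMap_apply_of_not hd _ h, inner_zero_left]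
    refine Finset.sum_le_sum fun K _ => ?_
    have hcell : ∀ e : T.facets, e.1 ⊆ K.1 →
        T.hCell K * ‖∑ i, normal K.1 e.1 i • facetLp hd e (q K i)‖ ^ 2 ≤
        C * ∑ i, inner ℝ (vectMap q (K, i)) (vectMap q (K, i)) := by
      intro e he
      have h1 : ‖∑ i, normal K.1 e.1 i • facetLp hd e (q K i)‖ ^ 2 ≤
          ∑ i, ‖facetLp hd e (q K i)‖ ^ 2 := by
        have h2 : ‖∑ i, normal K.1 e.1 i • facetLp hd e (q K i)‖ ≤
            ∑ i, |normal K.1 e.1 i| * ‖facetLp hd e (q K i)‖ := by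
          refine (norm_sum_le _ _).trans (Finset.sum_le_sum fun i _ => ?_)
          rw [norm_smul, Real.norm_eq_abs]
        -- Cauchy–Schwarz with a unit normal, so passing to components costs no constant.
        have h3 := Finset.sum_mul_sq_le_sq_mul_sq Finset.univ (fun i => |normal K.1 e.1 i|)
          (fun i => ‖facetLp hd e (q K i)‖)
        have h4 : ∑ i, |normal K.1 e.1 i| ^ 2 = 1 := by
          have := EuclideanSpace.norm_sq_eq (normal K.1 e.1)
          rw [norm_normal hd he] at this
          simpa using this.symm
        rw [h4, one_mul] at h3
        exact (pow_le_pow_left₀ (norm_nonneg _) h2 2).trans h3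
      refine (mul_le_mul_of_nonneg_left h1 (hCell_pos hd K).le).trans ?_
      rw [Finset.mul_sum, Finset.mul_sum]
      refine Finset.sum_le_sum fun i _ => ?_
      obtain ⟨a, ha, hea⟩ := exists_eq_erase he
      have h5 := hCp K.1 (T.card_eq K.1 K.2) (T.indep K.1 K.2) (hCell_pos hd K) (hT K) a ha (q K i)
        (hq K i)
      rw [← hea] at h5
      have h6 : ‖facetLp hd e (q K i)‖ ^ 2 = ∫ x, ev (q K i) x ^ 2 ∂(facetMeasure e.1) := by
        rw [← real_inner_self_eq_norm_sq, inner_eq_integral_of_ae _ _ (facetLp_ae hd e (q K i))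
          (facetLp_ae hd e (q K i))]
        simp only [sq]
      have h7 : inner ℝ (vectMap q (K, i)) (vectMap q (K, i)) =
          ∫ x in hull K.1, ev (q K i) x ^ 2 := by
        simp only [sq]
        exact inner_cellLp _ _ _
      rw [h6, h7]
      exact h5
    refine (Finset.sum_le_sum fun e he => hcell e (Finset.mem_filter.1 he).2).trans_eq ?_
    have hcard := sum_facets_of_cell K fun _ => (1 : ℝ)
    simp only [Finset.sum_const, nsmul_eq_mul, mul_one, T.card_eq K.1 K.2] at hcard
    rw [Finset.sum_const, nsmul_eq_mul, hcard]
    push_cast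
    ring
  have := Real.sqrt_le_sqrt hmain
  rwa [Real.sqrt_sq (norm_nonneg _), Real.sqrt_mul (by positivity),
    Real.sqrt_sq (norm_nonneg _)] at this

lemma toFun_add (u v : T.Scal) : toFun (u + v) = fun x => toFun u x + toFun v x := by
  classical
  ext x
  simp only [toFun, ← Finset.sum_add_distrib]
  refine Finset.sum_congr rfl fun K _ => ?_
  simp only [Set.indicator]
  split_ifs <;> simp

lemma toFun_smul (c : ℝ) (v : T.Scal) : toFun (c • v) = fun x => c * toFun v x := by
  classical
  ext x
  simp only [toFun, Finset.mul_sum]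
  refine Finset.sum_congr rfl fun K _ => ?_
  simp only [Set.indicator]
  split_ifs <;> simp

lemma toFun_zero : toFun (0 : T.Scal) = fun _ => 0 := by
  simpa using toFun_smul 0 (0 : T.Scal)

/-- A bound for the jumps by the stabilization. -/
lemma jumpNorm_le (hd : 1 ≤ d) {γ : ℝ} (hγ : 0 < γ) (hT : T.ShapeRegular γ) (u : T.Scal)
    {z : T.Skel} (hz : ∀ e, ¬ T.IsInterior e → z e = 0) :
    jumpNorm u ≤ √(2 * max 1 γ⁻¹) * ‖diffTraceMap hd (u, z)‖ := by
  classical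
  have hM : 0 < max 1 γ⁻¹ := lt_max_of_lt_left one_pos
  have hdiff : ∀ (K : T.cells) (e : T.facets),
      Integrable (fun x => (ev (u K) x - z e x) * (ev (u K) x - z e x)) (facetMeasure e.1) := by
    intro K e
    have h := (memLp_facet hd e (continuous_ev (u K))).sub (Lp.memLp (z e))
    exact integrable_mul_of_memLp h h
  have hjump : ∀ e : T.facets, ∫ x, ‖jump u e x‖ ^ 2 ∂(facetMeasure e.1) ≤
      2 * ∑ K : T.cells with e.1 ⊆ K.1,
        ∫ x, (ev (u K) x - z e x) * (ev (u K) x - z e x) ∂(facetMeasure e.1) := by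
    intro e
    rw [← integral_finsetSum _ fun K _ => hdiff K e, ← integral_const_mul]
    refine integral_mono_of_nonneg (Eventually.of_forall fun x => sq_nonneg _)
      ((integrable_finsetSum _ fun K _ => hdiff K e).const_mul 2) ?_
    -- On an interior facet the normals are opposite and `z` is single-valued, so the jump has
    -- length |(u⁺ − z) − (u⁻ − z)|. On a boundary facet `z` vanishes and the jump is u − z itself.
    by_cases he : T.IsInterior e
    · obtain ⟨K, L, hKL, hK, hL⟩ := he
      refine Eventually.of_forall fun x => ?_
      simp only [jump, filter_eq_pair hd hKL hK hL, Finset.sum_pair hKL,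
        normal_eq_neg hd hKL hK hL]
      rw [smul_neg, ← sub_eq_add_neg, ← sub_smul, norm_smul, norm_normal hd hK, mul_one,
        Real.norm_eq_abs, sq_abs]
      nlinarith [sq_nonneg ((ev (u K) x - z e x) + (ev (u L) x - z e x))]
    · obtain ⟨K, hK⟩ := exists_cell e
      have h0 : z e =ᵐ[facetMeasure e.1] 0 := by
        rw [hz e he]; exact Lp.coeFn_zero _ _ _
      filter_upwards [h0] with x hx
      simp only [jump, filter_eq_singleton he hK, Finset.sum_singleton, hx, Pi.zero_apply,
        sub_zero]
      rw [norm_smul, norm_normal hd hK, mul_one, Real.norm_eq_abs, sq_abs]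
      nlinarith [sq_nonneg (ev (u K) x)]
  have hD : ‖diffTraceMap hd (u, z)‖ ^ 2 = ∑ K : T.cells, ∑ e : T.facets with e.1 ⊆ K.1,
      (T.hCell K)⁻¹ * ∫ x, (ev (u K) x - z e x) * (ev (u K) x - z e x) ∂(facetMeasure e.1) := by
    have h := stab_tau_eq hd 1 u u z z
    rw [inv_one, one_mul, real_inner_self_eq_norm_sq] at h
    rw [← h, stab]
    refine Finset.sum_congr rfl fun K _ => ?_
    rw [tau, inv_one, one_mul, Finset.mul_sum]
  have hsq : ∑ e : T.facets, (T.hFacet e)⁻¹ * ∫ x, ‖jump u e x‖ ^ 2 ∂(facetMeasure e.1) ≤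
      2 * max 1 γ⁻¹ * ‖diffTraceMap hd (u, z)‖ ^ 2 := by
    rw [hD]
    simp only [Finset.sum_filter]
    rw [Finset.sum_comm, Finset.mul_sum]
    refine Finset.sum_le_sum fun e _ => ?_
    rw [← Finset.sum_filter]
    have hpos : 0 < T.hFacet e := by
      obtain ⟨K, hK⟩ := exists_cell e
      have h1 := (hCell_pos hd K).trans_le (hCell_le_hFacet hd hγ hT hK)
      exact pos_of_mul_pos_right h1 hM.le
    refine (mul_le_mul_of_nonneg_left (hjump e) (by positivity)).trans ?_
    rw [Finset.mul_sum, Finset.mul_sum, Finset.mul_sum]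
    refine Finset.sum_le_sum fun K hK => ?_
    have h1 := hCell_le_hFacet hd hγ hT (Finset.mem_filter.1 hK).2
    -- Shape regularity exchanges the facet weight of the jumps for the cell weight of the
    -- stabilization.
    have h2 : (T.hFacet e)⁻¹ ≤ max 1 γ⁻¹ * (T.hCell K)⁻¹ := by
      rw [← div_eq_mul_inv, le_div_iff₀ (hCell_pos hd K), inv_mul_le_iff₀ hpos, mul_comm]
      exact h1
    have h3 : 0 ≤ ∫ x, (ev (u K) x - z e x) * (ev (u K) x - z e x) ∂(facetMeasure e.1) :=
      integral_nonneg fun x => mul_self_nonneg _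
    calc _ ≤ (max 1 γ⁻¹ * (T.hCell K)⁻¹) * (2 *
          ∫ x, (ev (u K) x - z e x) * (ev (u K) x - z e x) ∂(facetMeasure e.1)) := by gcongr
      _ = _ := by ring
  have := Real.sqrt_le_sqrt hsq
  rwa [Real.sqrt_mul (by positivity), Real.sqrt_sq (norm_nonneg _)] at this

end Triangulation

/-! ### The finite element spaces as an instance of the abstract setting -/

namespace Triangulation

variable {d : ℕ} {Ω : Set (E d)} {T : Triangulation Ω}

lemma normS_eq (v : T.Scal) : normS v = ‖scalMap v‖ := by
  rw [normS, ← inner_scalMap, real_inner_self_eq_norm_sq, Real.sqrt_sq (norm_nonneg _)]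

lemma normV_eq (q : T.Vect) : normV q = ‖vectMap q‖ := by
  rw [normV, ← inner_vectMap, real_inner_self_eq_norm_sq, Real.sqrt_sq (norm_nonneg _)]

lemma norm1h_eq (v : T.Scal) :
    norm1h v = √(‖scalMap v‖ ^ 2 + ‖vectMap (gradMap v)‖ ^ 2) := by
  rw [norm1h, ← inner_scalMap, ← inner_vectMap, real_inner_self_eq_norm_sq,
    real_inner_self_eq_norm_sq]
  rfl

lemma normTilde_eq (hd : 1 ≤ d) (ρ : ℝ) (v : T.Scal) (z : T.Skel) : normTilde ρ v z =
    √(‖vectMap (gradMap v)‖ ^ 2 + ρ⁻¹ * ‖diffTraceMap hd (v, z)‖ ^ 2) := by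
  rw [normTilde, stab_tau_eq hd, ← inner_vectMap, real_inner_self_eq_norm_sq,
    real_inner_self_eq_norm_sq]
  rfl

lemma diffTraceMap_eq_zero_iff (hd : 1 ≤ d) (v : T.Scal) (z : T.Skel) :
    diffTraceMap hd (v, z) = 0 ↔
      ∀ (K : T.cells) (e : T.facets), e.1 ⊆ K.1 → facetLp hd e (v K) = z e := by
  constructor
  · intro h K e he
    have h1 := congrArg (fun w : T.TraceSpace => w (K, e)) h
    simp only [diffTraceMap_apply hd v z he, PiLp.zero_apply] at h1
    rcases smul_eq_zero.1 h1 with h2 | h2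
    · exact absurd h2 (inv_ne_zero (Real.sqrt_pos.2 (hCell_pos hd K)).ne')
    · exact sub_eq_zero.1 h2
  · intro h
    ext1 ⟨K, e⟩
    by_cases he : e.1 ⊆ K.1
    · rw [diffTraceMap_apply hd v z he, h K e he, sub_self, smul_zero, PiLp.zero_apply]
    · rw [diffTraceMap_apply_of_not hd _ he, PiLp.zero_apply]

namespace Spaces

variable {k : ℕ} (S : T.Spaces k)

/-- The conforming potentials as a submodule. -/
def conformingSubmodule : Submodule ℝ T.Scal where
  carrier := S.Vc
  add_mem' := by
    rintro u v ⟨hu, hu'⟩ ⟨hv, hv'⟩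
    exact ⟨S.V.add_mem hu hv, by rw [toFun_add]; exact hu'.add hv'⟩
  zero_mem' := ⟨S.V.zero_mem, by rw [toFun_zero]; exact memH10_zero⟩
  smul_mem' := by
    rintro c v ⟨hv, hv'⟩
    exact ⟨S.V.smul_mem c hv, by rw [toFun_smul]; exact hv'.const_mul c⟩

/-- The space of numerical traces as a submodule. -/
def traceSubmodule : Submodule ℝ T.Skel where
  carrier := {z | S.MemVhat z}
  add_mem' := by
    intro y z hy hz e
    refine ⟨fun he => (S.Vhat e).add_mem ((hy e).1 he) ((hz e).1 he), fun he => ?_⟩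
    rw [Pi.add_apply, (hy e).2 he, (hz e).2 he, add_zero]
  zero_mem' := fun e => ⟨fun _ => (S.Vhat e).zero_mem, fun _ => rfl⟩
  smul_mem' := by
    intro c z hz e
    refine ⟨fun he => (S.Vhat e).smul_mem c ((hz e).1 he), fun he => ?_⟩
    rw [Pi.smul_apply, (hz e).2 he, smul_zero]

lemma finiteDimensional_V : FiniteDimensional ℝ S.V := by
  let F : S.V →ₗ[ℝ] (T.cells → MvPolynomial.restrictTotalDegree (Fin d) ℝ k) :=
    { toFun := fun v K => ⟨v.1 K, (MvPolynomial.mem_restrictTotalDegree _ _ _).2 (S.degV _ v.2 K)⟩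
      map_add' := fun _ _ => rfl
      map_smul' := fun _ _ => rfl }
  refine FiniteDimensional.of_injective F fun u v h => Subtype.ext ?_
  ext1 K
  exact congrArg Subtype.val (congrFun h K)

lemma finiteDimensional_Q : FiniteDimensional ℝ S.Q := by
  let F : S.Q →ₗ[ℝ] (T.cells → Fin d → MvPolynomial.restrictTotalDegree (Fin d) ℝ k) :=
    { toFun := fun q K i =>
        ⟨q.1 K i, (MvPolynomial.mem_restrictTotalDegree _ _ _).2 (S.degQ _ q.2 K i)⟩
      map_add' := fun _ _ => rfl
      map_smul' := fun _ _ => rfl }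
  refine FiniteDimensional.of_injective F fun u v h => Subtype.ext ?_
  ext1 K
  ext1 i
  exact congrArg Subtype.val (congrFun (congrFun h K) i)

lemma mem_Vhat_of_memVhat {z : T.Skel} (hz : S.MemVhat z) (e : T.facets) : z e ∈ S.Vhat e := by
  by_cases he : T.IsInterior e
  · exact (hz e).1 he
  · rw [(hz e).2 he]; exact (S.Vhat e).zero_mem

lemma finiteDimensional_traceSubmodule : FiniteDimensional ℝ S.traceSubmodule := by
  have := S.finVhat
  let F : S.traceSubmodule →ₗ[ℝ] (∀ e : T.facets, S.Vhat e) :=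
    { toFun := fun z e => ⟨z.1 e, S.mem_Vhat_of_memVhat z.2 e⟩
      map_add' := fun _ _ => rfl
      map_smul' := fun _ _ => rfl }
  refine FiniteDimensional.of_injective F fun u v h => Subtype.ext ?_
  ext1 e
  exact congrArg Subtype.val (congrFun h e)

lemma conformingSubmodule_le : S.conformingSubmodule ≤ S.V := fun _ h => h.1

/-- The traces of a conforming potential are numerical traces. -/
lemma exists_diffTraceMap_eq_zero (hd : 1 ≤ d) (hreg : interior (closure Ω) = Ω) {CI : ℝ}
    (hS : S.Compatible CI) {v : T.Scal} (hv : v ∈ S.Vc) :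
    ∃ z, S.MemVhat z ∧ diffTraceMap hd (v, z) = 0 := by
  choose L hL using exists_cell (T := T)
  have hcongr : ∀ (e : T.facets) (p q : Poly d),
      (∀ᵐ x ∂(facetMeasure e.1), ev p x = ev q x) → facetLp hd e p = facetLp hd e q := by
    intro e p q h
    refine Lp.ext ?_
    filter_upwards [facetLp_ae hd e p, facetLp_ae hd e q, h] with x h1 h2 h3
    rw [h1, h2, h3]
  -- The trace may be taken from any adjacent cell `L e`, as all sides agree almost everywhere.
  refine ⟨fun e => facetLp hd e (v (L e)), fun e => ⟨?_, fun he => ?_⟩, ?_⟩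
  · rintro ⟨K, K', hne, hK, hK'⟩
    -- The average of two equal traces is the trace, so assumption 2 places it in the facet space.
    obtain ⟨w, hw, hwe⟩ := hS.2.1 v hv.1 e K K' hne hK hK'
    convert hw
    refine Lp.ext ?_
    filter_upwards [facetLp_ae hd e (v (L e)), hwe, ev_ae_eq hd hreg hv.2 hK (hL e),
      ev_ae_eq hd hreg hv.2 hK' (hL e)] with x h1 h2 h3 h4
    rw [h1, h2, h3, h4]
    ring
  · have h := hcongr e (v (L e)) 0 (by simpa using ev_ae_eq_zero hd hreg hv.2 he (hL e))
    exact h.trans (map_zero _)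
  · rw [diffTraceMap_eq_zero_iff]
    exact fun K e he => hcongr e _ _ (ev_ae_eq hd hreg hv.2 he (hL e))

/-- Assumption 3 combined with `jumpNorm_le`. No sign is assumed for `CI`, hence `max CI 0`. -/
lemma exists_approx (hd : 1 ≤ d) {γ : ℝ} (hγ : 0 < γ) (hT : T.ShapeRegular γ) {CI : ℝ}
    (hS : S.Compatible CI) {u : T.Scal} (hu : u ∈ S.V) {z : T.Skel} (hz : S.MemVhat z) {ε : ℝ}
    (hε : 0 < ε) : ∃ w ∈ S.Vc, ‖scalMap (w - u)‖ + ‖vectMap (gradMap (w - u))‖ ≤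
      max CI 0 * √(2 * max 1 γ⁻¹) * ‖diffTraceMap hd (u, z)‖ + ε := by
  have : Nonempty S.Vc := ⟨⟨0, S.conformingSubmodule.zero_mem⟩⟩
  have h1 : (⨅ w : S.Vc, (normS (w.1 - u) + normV (gradh (w.1 - u)))) <
      max CI 0 * √(2 * max 1 γ⁻¹) * ‖diffTraceMap hd (u, z)‖ + ε := by
    refine lt_of_le_of_lt (hS.2.2 u hu) (lt_of_le_of_lt ?_ (lt_add_of_pos_right _ hε))
    rw [mul_assoc]
    exact (mul_le_mul_of_nonneg_right (le_max_left CI 0) (Real.sqrt_nonneg _)).trans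
      (mul_le_mul_of_nonneg_left (jumpNorm_le hd hγ hT u fun e he => (hz e).2 he)
        (le_max_right _ _))
  obtain ⟨w, hw⟩ := exists_lt_of_ciInf_lt h1
  refine ⟨w.1, w.2, ?_⟩
  rw [normS_eq, normV_eq] at hw
  exact hw.le

lemma norm_scalMap_le_of_mem_Vc (hd : 1 ≤ d) (hreg : interior (closure Ω) = Ω) {R : ℝ}
    (hR0 : 0 ≤ R) (hR : ∀ x ∈ Ω, ‖x‖ ≤ R) {v : T.Scal} (hv : v ∈ S.Vc) :
    ‖scalMap v‖ ≤ 2 * R * ‖vectMap (gradMap v)‖ := by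
  have h := inS_self_le_of_memH10 hd hreg hR hv.2
  rw [← inner_scalMap, ← inner_vectMap, real_inner_self_eq_norm_sq,
    real_inner_self_eq_norm_sq] at h
  refine le_of_sq_le_sq ?_ (by positivity)
  rw [mul_pow, mul_pow]
  norm_num
  exact h

section Setting

variable {α : E d → Matrix (Fin d) (Fin d) ℝ} {lo hi : ℝ} (hd : 1 ≤ d)
  (hreg : interior (closure Ω) = Ω)
  (hm : ∀ i j, AEMeasurable (fun x => α x i j) (volume.restrict Ω)) (hlo : 0 < lo)
  (h : ∀ x ∈ Ω, ∀ ξ : Fin d → ℝ, lo * (ξ ⬝ᵥ ξ) ≤ ξ ⬝ᵥ (α x *ᵥ ξ)) (hhi : 0 < hi)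
  (hs : ∀ x ∈ Ω, (α x).IsSymm)
  (h' : ∀ x ∈ Ω, ∀ ξ : Fin d → ℝ, ξ ⬝ᵥ (α x *ᵥ ξ) ≤ hi * (ξ ⬝ᵥ ξ)) {γ : ℝ} (hγ : 0 < γ)
  (hT : T.ShapeRegular γ) {CI : ℝ} (hS : S.Compatible CI) {R : ℝ} (hR0 : 0 ≤ R)
  (hR : ∀ x ∈ Ω, ‖x‖ ≤ R) {Ct : ℝ}
  (hCt : ∀ q : T.Vect, (∀ K i, (q K i).totalDegree ≤ k) →
    ‖normalTraceMap hd q‖ ≤ Ct * ‖vectMap q‖)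

/-- The finite element spaces with the `L²` realizations of the forms. -/
noncomputable def setting : DiscreteSetting T.Vect T.Scal T.Skel T.VectSpace T.ScalSpace
    T.TraceSpace lo hi Ct (2 * R) (max CI 0 * √(2 * max 1 γ⁻¹)) where
  J := vectMap
  A := fluxMap hreg hm hlo h
  N := normalTraceMap hd
  I := scalMap
  D := diffTraceMap hd
  grad := gradMap
  Q := S.Q
  V := S.V
  Vc := S.conformingSubmodule
  Zh := S.traceSubmodule
  finQ := S.finiteDimensional_Q
  finV := S.finiteDimensional_V
  finVc := by
    have := S.finiteDimensional_V
    exact Submodule.finiteDimensional_of_le S.conformingSubmodule_le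
  finZ := S.finiteDimensional_traceSubmodule
  Vc_le := S.conformingSubmodule_le
  J_inj _ := vectMap_eq_zero
  I_inj _ := scalMap_eq_zero
  -- Every facet lies in some cell, where `D (0, z) = 0` forces `z` to equal the zero trace.
  D_inj z hz := by
    ext1 e
    obtain ⟨K, hK⟩ := exists_cell e
    have := (diffTraceMap_eq_zero_iff hd 0 z).1 hz K e hK
    rw [← this, Pi.zero_apply, map_zero, Pi.zero_apply]
  lower := fluxMap_lower hreg hm hlo h
  upper := fluxMap_upper hreg hm hlo h hhi hs h'
  trace q hq := hCt q (S.degQ q hq)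
  grad_mem := hS.1
  conforming _ hv := S.exists_diffTraceMap_eq_zero hd hreg hS hv
  poincare _ hv := S.norm_scalMap_le_of_mem_Vc hd hreg hR0 hR hv
  approx _ hu _ hz _ hε := S.exists_approx hd hγ hT hS hu hz hε

end Setting

end Spaces

/-- The load functional. -/
lemma exists_load (hreg : interior (closure Ω) = Ω) {f : E d → ℝ}
    (hf : MemLp f 2 (volume.restrict Ω)) :
    ∃ (ℓ : T.Scal →ₗ[ℝ] ℝ) (M : ℝ), 0 ≤ M ∧ (∀ v, ℓ v = load f v) ∧
      ∀ v, ℓ v ≤ M * ‖scalMap v‖ := by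
  have hfK : ∀ K : T.cells, MemLp f 2 (volume.restrict (hull K.1)) :=
    fun K => hf.mono_measure (restrict_hull_le hreg K)
  let F : T.ScalSpace := WithLp.toLp 2 fun K => (hfK K).toLp f
  refine ⟨(innerₛₗ ℝ F).comp scalMap, ‖F‖, norm_nonneg _, fun v => ?_,
    fun v => real_inner_le_norm F (scalMap v)⟩
  change inner ℝ F (scalMap v) = _
  rw [PiLp.inner_apply, load]
  exact Finset.sum_congr rfl fun K _ => inner_eq_integral_of_ae _ _ (MemLp.coeFn_toLp (hfK K))
    (cellLp_ae K.1 (v K))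

end Triangulation

namespace Triangulation

variable {d : ℕ} {Ω : Set (E d)} {T : Triangulation Ω}

namespace Spaces

variable {k : ℕ} (S : T.Spaces k)

/-- The a priori bound `B` makes the supremum a genuine one, since a real `sSup` of an unbounded set
would be 0. It also gives the estimate where `normTilde` is 0 and the quotient defaults to 0. -/
lemma dualNorm_spec {ρ B : ℝ} {f : E d → ℝ} (hB : 0 ≤ B)
    (h : ∀ v ∈ S.V, ∀ z, S.MemVhat z → load f v ≤ B * normTilde ρ v z) :
    0 ≤ S.dualNorm ρ f ∧ S.dualNorm ρ f ≤ B ∧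
      ∀ v ∈ S.V, ∀ z, S.MemVhat z → load f v ≤ S.dualNorm ρ f * normTilde ρ v z := by
  have hub : ∀ r ∈ {r | ∃ v ∈ S.V, ∃ z, S.MemVhat z ∧ r = load f v / normTilde ρ v z}, r ≤ B := by
    rintro r ⟨v, hv, z, hz, rfl⟩
    exact div_le_of_le_mul₀ (Real.sqrt_nonneg _) hB (h v hv z hz)
  have h0 : (0 : ℝ) ∈ {r | ∃ v ∈ S.V, ∃ z, S.MemVhat z ∧ r = load f v / normTilde ρ v z} :=
    ⟨0, S.V.zero_mem, 0, S.traceSubmodule.zero_mem, by simp [load]⟩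
  refine ⟨le_csSup ⟨B, hub⟩ h0, csSup_le ⟨0, h0⟩ hub, fun v hv z hz => ?_⟩
  have hN : 0 ≤ normTilde ρ v z := Real.sqrt_nonneg _
  rcases hN.eq_or_lt with h1 | h1
  · have := h v hv z hz
    rwa [← h1, mul_zero] at this ⊢
  · rw [← div_le_iff₀ h1]
    exact le_csSup ⟨B, hub⟩ ⟨v, hv, z, hz, rfl⟩

end Spaces

end Triangulation

end HDG

/-! ### Assembly of the theorem -/

open HDG HDG.Triangulation in
theorem mainTheorem7 {d : ℕ} (hd : 1 ≤ d) (Ω : Set (HDG.E d))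
    (hΩ_open : IsOpen Ω) (hΩ_conn : IsConnected Ω) (hΩ_reg : interior (closure Ω) = Ω)
    (α : HDG.E d → Matrix (Fin d) (Fin d) ℝ) (hα : HDG.IsDiffusion Ω α)
    (γ : ℝ) (hγ : 0 < γ) (k : ℕ) (CI : ℝ) (ρ₀ : ℝ) (hρ₀ : 0 < ρ₀) :
    ∃ C : ℝ, 0 < C ∧
      ∀ T : HDG.Triangulation Ω, T.ShapeRegular γ →
      ∀ S : T.Spaces k, S.Compatible CI →
      ∀ f : HDG.E d → ℝ, MemLp f 2 (volume.restrict Ω) →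
        (∃! s, S.IsPrimal α f s) ∧
        (∀ ρ : ℝ, 0 < ρ → ∃! s, S.IsHDG α (T.tau ρ) f s) ∧
        ∀ pc uc, S.IsPrimal α f (pc, uc) →
          (∀ ρ : ℝ, 0 < ρ → ρ ≤ ρ₀ → ∀ p u uh, S.IsHDG α (T.tau ρ) f (p, u, uh) →
            HDG.Triangulation.normC α (p - pc) + HDG.Triangulation.norm1h (u - uc)
              ≤ C * ρ ^ (1 / 2 : ℝ) * S.dualNorm ρ f) ∧
          (∀ (p : ℝ → T.Vect) (u : ℝ → T.Scal) (uh : ℝ → T.Skel),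
            (∀ ρ : ℝ, 0 < ρ → S.IsHDG α (T.tau ρ) f (p ρ, u ρ, uh ρ)) →
            Tendsto (fun ρ => HDG.Triangulation.normC α (p ρ - pc)
              + HDG.Triangulation.norm1h (u ρ - uc)) (𝓝[>] 0) (𝓝 0)) := by
  obtain ⟨hm, hs, lo, hi, hlo, hα⟩ := hα
  have h := fun x hx ξ => (hα x hx ξ).1
  -- The upper bound comes without a sign; `max hi 1` is positive.
  have h' : ∀ x ∈ Ω, ∀ ξ : Fin d → ℝ, ξ ⬝ᵥ (α x *ᵥ ξ) ≤ max hi 1 * (ξ ⬝ᵥ ξ) := fun x hx ξ =>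
    ((hα x hx ξ).2).trans
      (mul_le_mul_of_nonneg_right (le_max_left _ _) (dotProduct_self_nonneg_real ξ))
  have hhi : 0 < max hi 1 := lt_max_of_lt_right one_pos
  -- An unbounded `Ω` has no finite triangulation, and the claim is vacuous.
  by_cases hb : Bornology.IsBounded Ω
  swap
  · exact ⟨1, one_pos, fun T => absurd T.isBounded_domain hb⟩
  obtain ⟨R, hR0, hR⟩ := hb.exists_pos_norm_le
  obtain ⟨Ct, hCt0, hCt⟩ := exists_norm_normalTraceMap_le hd k hγ
  set CP := 2 * R with hCP
  set CJ := max CI 0 * √(2 * max 1 γ⁻¹) with hCJ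
  have hCP0 : 0 ≤ CP := by positivity
  have hCJ0 : 0 ≤ CJ := mul_nonneg (le_max_right _ _) (Real.sqrt_nonneg _)
  set C₁ := √(max hi 1) * (CJ + Ct) +
    ((1 + CP) * CJ + (1 + CP) * ((√lo)⁻¹ * (√(max hi 1) * (CJ + Ct)) + Ct)) with hC₁
  have hC₁0 : 0 ≤ C₁ := by positivity
  set C₂ := √(2 * lo⁻¹ + 2 * Ct ^ 2 * ρ₀ + 1) with hC₂
  have hC₂0 : 0 ≤ C₂ := Real.sqrt_nonneg _
  -- `C₁` is the constant of `error_le` and `C₂` that of `norm_D_le`, both fixed before the mesh;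
  -- the `+ 1` only ensures positivity.
  refine ⟨C₁ * C₂ + 1, by positivity, fun T hT S hS f hf => ?_⟩
  let D := S.setting hd hΩ_reg hm hlo h hhi hs h' hγ hT hS hR0.le hR (hCt Ω T hT)
  obtain ⟨ℓ, M, hM, hℓ, hℓM⟩ := exists_load (T := T) hΩ_reg hf
  have hprimal : ∀ p u, S.IsPrimal α f (p, u) ↔ D.IsConformingSolution ℓ p u := by
    intro p u
    simp only [Spaces.IsPrimal, ← hℓ, ← inner_fluxMap hΩ_reg hm hlo h, ← inner_vectMap]
    rfl
  have hHDG : ∀ ρ p u z, S.IsHDG α (T.tau ρ) f (p, u, z) ↔ D.IsSolution ρ⁻¹ ℓ p u z := by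
    intro ρ p u z
    simp only [Spaces.IsHDG, cForm, ← hℓ, ← inner_fluxMap hΩ_reg hm hlo h, bForm_eq hd,
      stab_tau_eq hd, ← sub_eq_add_neg]
    rfl
  -- A bound for the dual norm valid for all `ρ ≤ ρ₀`, by the discrete Poincaré inequality. It makes
  -- the supremum finite and drives the limit `ρ → 0`.
  set B := M * ((1 + CP) * (CJ * √ρ₀) + CP) with hB
  have hB0 : 0 ≤ B := by positivity
  have hdual : ∀ ρ, 0 < ρ → ρ ≤ ρ₀ → 0 ≤ S.dualNorm ρ f ∧ S.dualNorm ρ f ≤ B ∧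
      ∀ v ∈ S.V, ∀ z, S.MemVhat z → load f v ≤ S.dualNorm ρ f * normTilde ρ v z := by
    intro ρ hρ hρρ₀
    refine S.dualNorm_spec hB0 fun v hv z hz => ?_
    rw [← hℓ, hB, mul_assoc, normTilde_eq hd]
    exact (hℓM v).trans
      (mul_le_mul_of_nonneg_left (D.norm_I_le_of_le hCP0 hCJ0 hρ hρρ₀ hv hz) hM)
  have hest : ∀ pc uc, S.IsPrimal α f (pc, uc) → ∀ ρ : ℝ, 0 < ρ → ρ ≤ ρ₀ →
      ∀ p u uh, S.IsHDG α (T.tau ρ) f (p, u, uh) →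
        normC α (p - pc) + norm1h (u - uc) ≤ (C₁ * C₂ + 1) * √ρ * S.dualNorm ρ f := by
    intro pc uc hc ρ hρ hρρ₀ p u uh hsol
    obtain ⟨hF0, -, hF⟩ := hdual ρ hρ hρρ₀
    have hload : ℓ u ≤ S.dualNorm ρ f *
        √(‖D.J (D.grad u)‖ ^ 2 + ρ⁻¹ * ‖D.D (u, uh)‖ ^ 2) := by
      rw [hℓ]
      refine (hF u hsol.2.1 uh hsol.2.2.1).trans_eq ?_
      rw [normTilde_eq hd]
      rfl
    rw [hHDG] at hsol
    rw [hprimal] at hc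
    have h1 := D.error_le hlo hhi hCt0 hCP0 hCJ0 hsol hc
    have h2 := D.norm_D_le hlo hCt0 hρ hρρ₀ hsol hF0 hload
    have h3 : normC α (p - pc) + norm1h (u - uc) =
        √(inner ℝ (D.A (p - pc)) (D.J (p - pc))) +
          √(‖D.I (u - uc)‖ ^ 2 + ‖D.J (D.grad (u - uc))‖ ^ 2) := by
      rw [norm1h_eq, normC, ← inner_fluxMap hΩ_reg hm hlo h]
      rfl
    rw [h3]
    refine h1.trans ((mul_le_mul_of_nonneg_left h2 hC₁0).trans ?_)
    have : 0 ≤ √ρ * S.dualNorm ρ f := mul_nonneg (Real.sqrt_nonneg _) hF0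
    linarith
  refine ⟨?_, fun ρ hρ => ?_, fun pc uc hc => ⟨fun ρ hρ hρρ₀ p u uh hsol => ?_,
    fun p u uh hsol => ?_⟩⟩
  · simpa only [← hprimal] using D.existsUnique_isConformingSolution ℓ
  · simpa only [← hHDG] using D.existsUnique_isSolution hlo hCP0 (inv_pos.2 hρ) ℓ
  · rw [← Real.sqrt_eq_rpow]
    exact hest pc uc hc ρ hρ hρρ₀ p u uh hsol
  -- The dual norm varies with `ρ`, so convergence uses its uniform bound `B`.
  · have hlim : Tendsto (fun ρ : ℝ => (C₁ * C₂ + 1) * √ρ * B) (𝓝[>] 0) (𝓝 0) := by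
      have : Tendsto (fun ρ : ℝ => (C₁ * C₂ + 1) * √ρ * B) (𝓝 0)
          (𝓝 ((C₁ * C₂ + 1) * √0 * B)) := by
        refine Continuous.tendsto ?_ 0
        fun_prop
      simp only [Real.sqrt_zero, mul_zero, zero_mul] at this
      exact this.mono_left nhdsWithin_le_nhds
    refine squeeze_zero' (Eventually.of_forall fun ρ =>
      add_nonneg (Real.sqrt_nonneg _) (Real.sqrt_nonneg _)) ?_ hlim
    filter_upwards [Ioc_mem_nhdsGT hρ₀] with ρ hρ
    exact (hest pc uc hc ρ hρ.1 hρ.2 _ _ _ (hsol ρ hρ.1)).trans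
      (mul_le_mul_of_nonneg_left (hdual ρ hρ.1 hρ.2).2.1 (by positivity))
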